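/- Let $(M,g)$ be a $d$-dimensional Riemannian manifold (Hausdorff, without boundary) which is either smooth (then "regular" below means $C^\infty$) or real analytic, with $g$ real analytic (then "regular" means real analytic). Let $\nabla$ be its Levi-Civita connection and $R(X,Y)=\nabla_X\nabla_Y-\nabla_Y\nabla_X-\nabla_{[X,Y]}$ its curvature. Let $p\in M$, let $E_1,\dots,E_d$ be an orthonormal basis of $T_pM$, and let $F(x)=\exp_p\big(\sum_i x_iE_i\big)$ be the geodesic normal coordinates at $p$. Then $F$ is defined for all $x\in\mathbb R^d$ near $0$, $F(0)=p$, and $F$ is a regular local diffeomorphism at $0$. With $X_i=F_*\partial_{x_i}$ and $g_{ij}(x)=g(X_i,X_j)$ at the point $F(x)$, for all $i,j$, $$g_{ij}(x)=\delta_{ij}+\frac13\sum_{k,\ell}g(R(E_k,E_i)E_\ell,E_j)\,x_kx_\ell+\frac16\sum_{k,\ell,m}g\big((\nabla_{E_k}R)(E_\ell,E_i)E_m,E_j\big)\,x_kx_\ell x_m+\mathcal O(|x|^4),$$ where all curvature terms are evaluated at $p$. Here $\mathcal O(|x|^r)$ denotes a function $f$ for which there is a ball $B$ around $0$ such that $f$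 is regular on $B$ and, for every finite sequence of vector fields of the form $x_j\partial_{x_i}$ (including the empty one), the corresponding iterated derivative of $f$ is bounded on $B$ by a constant (which may depend on the sequence) times $|x|^r$. -/

import Mathlib

open Set Filter Topology Bundle Manifold
open scoped Manifold ContDiff

noncomputable section

namespace RiemannianNormal

variable {E : Type*} [NormedAddCommGroup E] [NormedSpace ℝ E]
  {M : Type*} [TopologicalSpace M] [ChartedSpace E M] [IsManifold 𝓘(ℝ, E) 1 M] {m : ℕ∞ω}

/-! Throughout, `φ_q = extChartAt 𝓘(ℝ, E) q` is the chart at `q`, with values in the model space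
`E`. Coordinate expressions are written without indices: elements of `E` stand for the constant
coefficient vector fields of a chart. -/

/-- The Riemannian metric `g` read in the chart `φ_q`: the bilinear form
`(u, v) ↦ g(dφ_q⁻¹ u, dφ_q⁻¹ v)` at the point of `M` with coordinates `y`. -/
def metricInChart (g : ContMDiffRiemannianMetric 𝓘(ℝ, E) m E (TangentSpace 𝓘(ℝ, E) : M → Type _))
    (q : M) (y : E) : E →L[ℝ] E →L[ℝ] ℝ :=
  let A : E →L[ℝ] TangentSpace 𝓘(ℝ, E) ((extChartAt 𝓘(ℝ, E) q).symm y) :=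
    mfderiv 𝓘(ℝ, E) 𝓘(ℝ, E) (extChartAt 𝓘(ℝ, E) q).symm y
  let B : E →L[ℝ] E →L[ℝ] ℝ := g.inner ((extChartAt 𝓘(ℝ, E) q).symm y)
  B.bilinearComp A A

/-- Christoffel symbols of the first kind of a field of bilinear forms `G` on `E`: the linear form
`w ↦ ½ (∂_u G(v, w) + ∂_v G(u, w) - ∂_w G(u, v))` at `y`. -/
def christoffelFirst (G : E → E →L[ℝ] E →L[ℝ] ℝ) (y u v : E) : E →L[ℝ] ℝ :=
  (1 / 2 : ℝ) • (fderiv ℝ G y u v + fderiv ℝ G y v u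
    - (((fderiv ℝ G y).flip u).flip v))

/-- Christoffel symbols (of the second kind): `Γ(u, v)` is the coordinate expression of `∇_u v` for
constant coefficient fields `u`, `v`, where `∇` is the Levi-Civita connection of `G`. It is the
vector with `G(Γ(u, v), w) = ½ (∂_u G(v, w) + ∂_v G(u, w) - ∂_w G(u, v))` for all `w`, i.e. the
first-kind symbols multiplied by the inverse of `G`. -/
def christoffel (G : E → E →L[ℝ] E →L[ℝ] ℝ) (y u v : E) : E :=
  (G y).inverse (christoffelFirst G y u v)

/-- The curvature operator `R(u, v) w = ∇_u ∇_v w - ∇_v ∇_u w - ∇_[u, v] w` in coordinates. -/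
def curvatureCoord (G : E → E →L[ℝ] E →L[ℝ] ℝ) (y u v w : E) : E :=
  fderiv ℝ (fun z => christoffel G z v w) y u - fderiv ℝ (fun z => christoffel G z u w) y v
    + christoffel G y u (christoffel G y v w) - christoffel G y v (christoffel G y u w)

/-- The covariant derivative `(∇_a R)(u, v) w = ∇_a (R(u, v) w) - R(∇_a u, v) w - R(u, ∇_a v) w
- R(u, v) ∇_a w` of the curvature tensor in coordinates. -/
def covDerivCurvatureCoord (G : E → E →L[ℝ] E →L[ℝ] ℝ) (y a u v w : E) : E :=
  fderiv ℝ (fun z => curvatureCoord G z u v w) y a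
    + christoffel G y a (curvatureCoord G y u v w)
    - curvatureCoord G y (christoffel G y a u) v w
    - curvatureCoord G y u (christoffel G y a v) w
    - curvatureCoord G y u v (christoffel G y a w)

/-- The coordinates `dφ_p v ∈ E` of a tangent vector `v ∈ T_p M` in the chart `φ_p`. -/
def toCoord (p : M) (v : TangentSpace 𝓘(ℝ, E) p) : E :=
  mfderiv 𝓘(ℝ, E) 𝓘(ℝ, E) (extChartAt 𝓘(ℝ, E) p) p v

/-- The scalar `g(R(u, v) w, z)` for `u, v, w, z ∈ T_p M`, where
`R(X, Y) = ∇_X ∇_Y - ∇_Y ∇_X - ∇_[X, Y]`, computed in the chart `φ_p`. -/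
def curvature (g : ContMDiffRiemannianMetric 𝓘(ℝ, E) m E (TangentSpace 𝓘(ℝ, E) : M → Type _))
    (p : M) (u v w z : TangentSpace 𝓘(ℝ, E) p) : ℝ :=
  metricInChart g p (extChartAt 𝓘(ℝ, E) p p)
    (curvatureCoord (metricInChart g p) (extChartAt 𝓘(ℝ, E) p p)
      (toCoord p u) (toCoord p v) (toCoord p w))
    (toCoord p z)

/-- The scalar `g((∇_a R)(u, v) w, z)` for `a, u, v, w, z ∈ T_p M`, computed in the chart `φ_p`. -/
def covDerivCurvature
    (g : ContMDiffRiemannianMetric 𝓘(ℝ, E) m E (TangentSpace 𝓘(ℝ, E) : M → Type _))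
    (p : M) (a u v w z : TangentSpace 𝓘(ℝ, E) p) : ℝ :=
  metricInChart g p (extChartAt 𝓘(ℝ, E) p p)
    (covDerivCurvatureCoord (metricInChart g p) (extChartAt 𝓘(ℝ, E) p p)
      (toCoord p a) (toCoord p u) (toCoord p v) (toCoord p w))
    (toCoord p z)

/-- `γ` is a geodesic of `g` on the open set `s` of times: it is continuous on `s`, and its
expression `c` in each chart `φ_q` satisfies `c'' + Γ(c', c') = 0` at all times `t ∈ s` for which
`γ t` is in the domain of `φ_q`. -/
def IsGeodesicOn
    (g : ContMDiffRiemannianMetric 𝓘(ℝ, E) m E (TangentSpace 𝓘(ℝ, E) : M → Type _))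
    (γ : ℝ → M) (s : Set ℝ) : Prop :=
  ContinuousOn γ s ∧ ∀ q : M, ∀ t ∈ s, γ t ∈ (extChartAt 𝓘(ℝ, E) q).source →
    let c : ℝ → E := fun τ => extChartAt 𝓘(ℝ, E) q (γ τ)
    DifferentiableAt ℝ c t ∧
      HasDerivAt (deriv c) (-christoffel (metricInChart g q) (c t) (deriv c t) (deriv c t)) t

/-- `γ` is a geodesic on an open interval containing `[0, 1]`, with `γ(0) = p`, `γ'(0) = v`. -/
def IsGeodesicFrom
    (g : ContMDiffRiemannianMetric 𝓘(ℝ, E) m E (TangentSpace 𝓘(ℝ, E) : M → Type _))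
    (p : M) (v : TangentSpace 𝓘(ℝ, E) p) (γ : ℝ → M) : Prop :=
  (∃ ε : ℝ, 0 < ε ∧ IsGeodesicOn g γ (Ioo (-ε) (1 + ε))) ∧ γ 0 = p ∧
    HasDerivAt (fun τ => extChartAt 𝓘(ℝ, E) p (γ τ)) (toCoord p v) 0

/-- The domain of the exponential map at `p`. -/
def expDomain
    (g : ContMDiffRiemannianMetric 𝓘(ℝ, E) m E (TangentSpace 𝓘(ℝ, E) : M → Type _))
    (p : M) : Set (TangentSpace 𝓘(ℝ, E) p) :=
  {v | ∃ γ : ℝ → M, IsGeodesicFrom g p v γ}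

open Classical in
/-- The exponential map at `p`: `exp_p v = γ(1)` for the geodesic `γ` with `γ(0) = p` and
`γ'(0) = v` (with value `p` outside its domain of definition). -/
def expMap
    (g : ContMDiffRiemannianMetric 𝓘(ℝ, E) m E (TangentSpace 𝓘(ℝ, E) : M → Type _))
    (p : M) (v : TangentSpace 𝓘(ℝ, E) p) : M :=
  if h : ∃ γ : ℝ → M, IsGeodesicFrom g p v γ then h.choose 1 else p

end RiemannianNormal

namespace RiemannianNormal

variable {d : ℕ} {m : ℕ∞ω} {M : Type*} [TopologicalSpace M]
  [ChartedSpace (EuclideanSpace ℝ (Fin d)) M] [IsManifold (𝓡 d) 1 M]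

/-- Geodesic normal coordinates at `p` associated with `e : Fin d → T_p M`:
`F(x) = exp_p (∑ i, x_i e_i)`. -/
def normalCoord
    (g : ContMDiffRiemannianMetric (𝓡 d) m (EuclideanSpace ℝ (Fin d))
      (TangentSpace (𝓡 d) : M → Type _))
    (p : M) (e : Fin d → TangentSpace (𝓡 d) p) (x : EuclideanSpace ℝ (Fin d)) : M :=
  expMap g p (∑ i, x i • e i)

/-- The coefficients `g_ij(x) = g(X_i, X_j)` at the point `F(x)`, where `X_i = F_* ∂_{x_i}`. -/
def metricCoeff
    (g : ContMDiffRiemannianMetric (𝓡 d) m (EuclideanSpace ℝ (Fin d))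
      (TangentSpace (𝓡 d) : M → Type _))
    (F : EuclideanSpace ℝ (Fin d) → M) (i j : Fin d) (x : EuclideanSpace ℝ (Fin d)) : ℝ :=
  g.inner (F x)
    (mfderiv 𝓘(ℝ, EuclideanSpace ℝ (Fin d)) (𝓡 d) F x (EuclideanSpace.single i (1 : ℝ)))
    (mfderiv 𝓘(ℝ, EuclideanSpace ℝ (Fin d)) (𝓡 d) F x (EuclideanSpace.single j (1 : ℝ)))

/-- The derivative `x_j ∂f/∂x_i` of `f` along the vector field `x_j ∂_{x_i}`. -/
def scaledDeriv (j i : Fin d) (f : EuclideanSpace ℝ (Fin d) → ℝ) :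
    EuclideanSpace ℝ (Fin d) → ℝ :=
  fun x => x j * fderiv ℝ f x (EuclideanSpace.single i (1 : ℝ))

/-- `f = O(|x|^r)` in the class `C^m`: on a fixed ball around `0`, `f` is of class `C^m`
(analytic for `m = ω`), and `f` as well as all its iterated derivatives along the vector
fields `x_j ∂_{x_i}`, of any order, are bounded by a constant (depending on the derivative)
times `|x|^r`. -/
def IsBigOrder (m : ℕ∞ω) (r : ℕ) (f : EuclideanSpace ℝ (Fin d) → ℝ) : Prop :=
  ∃ ρ : ℝ, 0 < ρ ∧ ContDiffOn ℝ m f (Metric.ball 0 ρ) ∧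
    ∀ L : List (Fin d × Fin d), ∃ C : ℝ, ∀ x ∈ Metric.ball (0 : EuclideanSpace ℝ (Fin d)) ρ,
      |L.foldr (fun a h => scaledDeriv a.1 a.2 h) f x| ≤ C * ‖x‖ ^ r

end RiemannianNormal

end

/-! Everything is computed in the chart at `p`, where geodesics solve `c'' + Γ(c', c') = 0`.

Exponential map. Take the initial velocity `v` as parameter and the acceleration `a ∈ C([-1, 1], E)`
as unknown; displacement and velocity are recovered from `(v, a)` by integration, and the equation
reads `a + h ∘ (displacement, velocity) = 0`. Since `h` is quadratic in the velocity, its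
differential at the origin vanishes, so `(v, a) ↦ (v, a + h ∘ …)` has the identity as derivative at
`0`. The inverse function theorem in Banach spaces gives `a` as a function of `v`, smooth or
analytic because the superposition operator is (`exists_acceleration`). Injectivity gives the
scaling law of geodesics, so the time-one map `f` satisfies: `t ↦ f (t • v)` is the geodesic with
velocity `v` (`exists_exponential_of_spray`). Uniqueness of geodesics on a Hausdorff manifold
identifies `f` with `expMap` (`exists_expMap_chart`).

Expansion. Put `T(t) = df_{tx}(x)` and `K(t) = df_{tx}(a)`, so that `tK` is a Jacobi field along the
radial geodesic, and let `D` be the covariant derivative along it. Linearizing the geodesic equation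
gives `t D²K + 2 DK = t R(T, K)T`. This equation and its first two derivatives at `t = 0` yield `DK
= 0`, `D²K = R(x, a)x / 3` and `D³K = (∇_x R)(x, a)x / 2`. As `D` is compatible with the metric and
the operators `a ↦ R(x, a)x`, `a ↦ (∇_x R)(x, a)x` are self-adjoint, the first three derivatives of
`g(K_a, K_b)` at `0` are `0`, `(2/3) g(R(x, a)x, b)` and `g((∇_x R)(x, a)x, b)`
(`radial_expansion`). Division by `2!` and `3!` gives the coefficients `1/3` and `1/6`.

Remainder. The metric coefficient minus the cubic polynomial has vanishing derivatives of order at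
most three along every ray, hence, by polarization, vanishing partial derivatives of these orders at
`0`. Such functions are `O(|x|^4)`, and the class is stable under `x_j ∂_i`: the derivative loses
one order and the factor `x_j` regains it. -/

noncomputable section

namespace RiemannianNormal

/-! ### Inverse function theorem with regularity on neighbourhoods -/

section InverseFunction

variable {X Y : Type*} [NormedAddCommGroup X] [NormedSpace ℝ X] [CompleteSpace X]
  [NormedAddCommGroup Y] [NormedSpace ℝ Y]

/-- Inverse function theorem with regularity of `f` and of the local inverse in neighbourhoods. -/
theorem exists_openPartialHomeomorph_contDiffAt {m : ℕ∞ω} (hm : 1 ≤ m) {f : X → Y} {x₀ : X}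
    (hf : ∀ᶠ x in 𝓝 x₀, ContDiffAt ℝ m f x) {f' : X ≃L[ℝ] Y}
    (hf' : HasFDerivAt f (f' : X →L[ℝ] Y) x₀) :
    ∃ e : OpenPartialHomeomorph X Y, x₀ ∈ e.source ∧ (e : X → Y) = f ∧
      (∀ x ∈ e.source, ContDiffAt ℝ m f x) ∧ ∀ y ∈ e.target, ContDiffAt ℝ m e.symm y := by
  have hf0 := hf.self_of_nhds
  have hm0 : m ≠ 0 := (zero_lt_one.trans_le hm).ne'
  have hs := hf0.hasStrictFDerivAt' hf' hm0
  have hcont : ContinuousAt (fderiv ℝ f) x₀ :=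
    (hf0.fderiv_right (m := 0) (by simpa using hm)).continuousAt
  -- Invertible operators form an open set. Invertibility of the derivative near `x₀`, and not only
  -- at `x₀`, makes the inverse regular on the whole target.
  have hinv : ∀ᶠ x in 𝓝 x₀, fderiv ℝ f x ∈ range ((↑) : (X ≃L[ℝ] Y) → X →L[ℝ] Y) := by
    have h := f'.nhds
    rw [← hf'.fderiv] at h
    exact hcont h
  obtain ⟨u, hu, huo, hxu⟩ := eventually_nhds_iff.1 (hf.and hinv)
  let e := (hs.toOpenPartialHomeomorph f).restrOpen u huo
  have hes : e.source = (hs.toOpenPartialHomeomorph f).source ∩ u := rfl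
  have hef : (e : X → Y) = f := rfl
  refine ⟨e, ⟨hs.mem_toOpenPartialHomeomorph_source, hxu⟩, hef, fun x hx => (hu x hx.2).1, ?_⟩
  intro y hy
  have hx : e.symm y ∈ u := (e.map_target hy).2
  obtain ⟨⟨f'', hf''⟩, hcd⟩ := (hu _ hx).symm
  refine e.contDiffAt_symm (f₀' := f'') hy ?_ hcd
  rw [hf'', hef]
  exact (hcd.differentiableAt hm0).hasFDerivAt

end InverseFunction

/-! ### Regularity of the superposition operator on spaces of continuous curves -/

section Superposition

set_option synthInstance.maxHeartbeats 200000

variable {K : Type*} [TopologicalSpace K] [CompactSpace K]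

/-- The superposition operator `γ ↦ h ∘ γ` on continuous maps (with value `0` where `h ∘ γ` is not
continuous). -/
def superposition {P F : Type*} [TopologicalSpace P] [TopologicalSpace F] [Zero F] (h : P → F)
    (γ : C(K, P)) : C(K, F) :=
  open Classical in if hc : Continuous (h ∘ γ) then ⟨h ∘ γ, hc⟩ else 0

omit [CompactSpace K] in
theorem superposition_apply {P F : Type*} [TopologicalSpace P] [TopologicalSpace F] [Zero F]
    {h : P → F} {γ : C(K, P)} (hc : Continuous (h ∘ γ)) (t : K) :
    superposition h γ t = h (γ t) := by
  simp [superposition, hc]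

omit [CompactSpace K] in
theorem superposition_apply_of_mem {P F : Type*} [TopologicalSpace P] [TopologicalSpace F] [Zero F]
    {h : P → F} {U : Set P} (hh : ContinuousOn h U) {γ : C(K, P)} (hγ : ∀ t, γ t ∈ U) (t : K) :
    superposition h γ t = h (γ t) :=
  superposition_apply (hh.comp_continuous γ.continuous hγ) t

theorem isOpen_setOf_forall_mem {P : Type*} [TopologicalSpace P] {U : Set P} (hU : IsOpen U) :
    IsOpen {γ : C(K, P) | ∀ t, γ t ∈ U} := by
  simpa [MapsTo] using ContinuousMap.isOpen_setOfPred_mapsTo (isCompact_univ (X := K)) hU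

omit [CompactSpace K] in
-- Curves with values in `U` lift continuously to `C(K, U)`, where the operator is composition with
-- a globally continuous map, continuous for the compact-open topology.
theorem continuousOn_superposition {P F : Type*} [TopologicalSpace P] [TopologicalSpace F] [Zero F]
    {h : P → F} {U : Set P} (hh : ContinuousOn h U) :
    ContinuousOn (superposition h : C(K, P) → C(K, F)) {γ | ∀ t, γ t ∈ U} := by
  rw [continuousOn_iff_continuous_domRestrict]
  let hU : C(U, F) := ⟨U.domRestrict h, continuousOn_iff_continuous_domRestrict.1 hh⟩
  let lift : {γ : C(K, P) | ∀ t, γ t ∈ U} → C(K, U) := fun γ =>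
    ⟨fun t => ⟨γ.1 t, γ.2 t⟩, by fun_prop⟩
  have hlift : Continuous lift := by
    have := ContinuousMap.isInducing_postcomp (X := K) (⟨Subtype.val, continuous_subtype_val⟩ : C(U, P))
      Topology.IsInducing.subtypeVal
    rw [this.continuous_iff]
    exact continuous_subtype_val
  have heq : ({γ : C(K, P) | ∀ t, γ t ∈ U}).domRestrict (superposition h) = fun γ => hU.comp (lift γ) := by
    ext γ t
    exact superposition_apply_of_mem hh γ.2 t
  rw [heq]
  exact (ContinuousMap.continuous_postcomp hU).comp hlift

universe u

variable {P F : Type u} [NormedAddCommGroup P] [NormedSpace ℝ P]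
  [NormedAddCommGroup F] [NormedSpace ℝ F]

/-- The pointwise application of a continuous family of operators to a continuous family of
vectors. -/
def pointwiseApply : C(K, P →L[ℝ] F) →L[ℝ] C(K, P) →L[ℝ] C(K, F) :=
  LinearMap.mkContinuous₂
    (LinearMap.mk₂ ℝ (fun (A : C(K, P →L[ℝ] F)) (δ : C(K, P)) => (⟨fun t => A t (δ t), by fun_prop⟩ : C(K, F)))
      (fun _ _ _ => by ext; simp) (fun _ _ _ => by ext; simp)
      (fun _ _ _ => by ext; simp) (fun _ _ _ => by ext; simp)) 1
    (fun A δ => by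
      refine (ContinuousMap.norm_le _ (by rw [one_mul]; positivity)).2 fun t => ?_
      rw [one_mul]
      exact (A t).le_of_opNorm_le_of_le (A.norm_coe_le_norm t) (δ.norm_coe_le_norm t))

@[simp]
theorem pointwiseApply_apply (A : C(K, P →L[ℝ] F)) (δ : C(K, P)) (t : K) :
    pointwiseApply A δ t = A t (δ t) := rfl

omit [NormedSpace ℝ P] [NormedSpace ℝ F] in
-- Continuity of the superposition operator at `γ`, read pointwise: a bound uniform in `t`. It is
-- applied to `fderiv ℝ h` in the mean value estimate below.
theorem exists_forall_mem_ball_norm_sub_le {h : P → F} {U : Set P} (hU : IsOpen U)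
    (hh : ContinuousOn h U) {γ : C(K, P)} (hγ : ∀ t, γ t ∈ U) {ε : ℝ} (hε : 0 < ε) :
    ∃ η > 0, ∀ σ ∈ Metric.ball γ η, ∀ t, σ t ∈ U ∧ ‖h (σ t) - h (γ t)‖ ≤ ε := by
  have hΩ := (isOpen_setOf_forall_mem (K := K) hU).mem_nhds hγ
  have hN := (continuousOn_superposition (K := K) hh).continuousAt hΩ
  have hev := (Metric.tendsto_nhds.1 hN ε hε).and hΩ
  obtain ⟨η, hη, hball⟩ := Metric.eventually_nhds_iff_ball.1 hev
  refine ⟨η, hη, fun σ hσ t => ⟨(hball σ hσ).2 t, ?_⟩⟩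
  have h1 := (hball σ hσ).1
  rw [dist_eq_norm] at h1
  have h2 := (ContinuousMap.norm_coe_le_norm (superposition h σ - superposition h γ) t).trans h1.le
  rwa [ContinuousMap.sub_apply, superposition_apply_of_mem hh (hball σ hσ).2,
    superposition_apply_of_mem hh hγ] at h2

/-- The mean value inequality on the segment from `γ t` to `γ' t`, with an oscillation bound for
`fderiv ℝ h` uniform in `t`, makes the pointwise remainder a uniform one. -/
theorem hasFDerivAt_superposition {h : P → F} {U : Set P} (hU : IsOpen U)
    (hh : ContDiffOn ℝ 1 h U) {γ : C(K, P)} (hγ : ∀ t, γ t ∈ U) :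
    HasFDerivAt (superposition h : C(K, P) → C(K, F))
      (pointwiseApply (superposition (fderiv ℝ h) γ)) γ := by
  have hh' : ContinuousOn (fderiv ℝ h) U := hh.continuousOn_fderiv_of_isOpen hU le_rfl
  rw [hasFDerivAt_iff_isLittleO, Asymptotics.isLittleO_iff]
  intro ε hε
  obtain ⟨η, hη, hball⟩ := exists_forall_mem_ball_norm_sub_le hU hh' hγ hε
  filter_upwards [Metric.ball_mem_nhds γ hη] with γ' hγ'
  refine (ContinuousMap.norm_le _ (by positivity)).2 fun t => ?_
  have hseg : ∀ s ∈ Icc (0 : ℝ) 1, γ + s • (γ' - γ) ∈ Metric.ball γ η := by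
    intro s hs
    rw [mem_ball_iff_norm] at hγ' ⊢
    rw [add_sub_cancel_left, norm_smul, Real.norm_of_nonneg hs.1]
    exact (mul_le_of_le_one_left (norm_nonneg _) hs.2).trans_lt hγ'
  -- Each point of the segment is the value at `t` of a curve on the segment from `γ` to `γ'`, so
  -- the estimate valid on the ball of curves applies to it.
  have hmem : ∀ x ∈ segment ℝ (γ t) (γ' t), ∃ σ ∈ Metric.ball γ η, σ t = x := by
    intro x hx
    rw [segment_eq_image'] at hx
    obtain ⟨s, hs, rfl⟩ := hx
    exact ⟨_, hseg s hs, by simp⟩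
  have key := Convex.norm_image_sub_le_of_norm_hasFDerivWithin_le' (f := h) (f' := fderiv ℝ h)
    (φ := fderiv ℝ h (γ t)) (C := ε) (s := segment ℝ (γ t) (γ' t)) (x := γ t) (y := γ' t)
    (fun x hx => by
      obtain ⟨σ, hσ, rfl⟩ := hmem x hx
      exact ((hh.differentiableOn one_ne_zero).differentiableAt
        (hU.mem_nhds (hball σ hσ t).1)).hasFDerivAt.hasFDerivWithinAt)
    (fun x hx => by
      obtain ⟨σ, hσ, rfl⟩ := hmem x hx
      exact (hball σ hσ t).2)
    (convex_segment _ _) (left_mem_segment ℝ _ _) (right_mem_segment ℝ _ _)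
  rw [ContinuousMap.sub_apply, ContinuousMap.sub_apply,
    superposition_apply_of_mem hh.continuousOn (fun t => (hball γ' hγ' t).1),
    superposition_apply_of_mem hh.continuousOn hγ, pointwiseApply_apply,
    superposition_apply_of_mem hh' hγ]
  refine key.trans ?_
  gcongr
  exact ContinuousMap.norm_coe_le_norm (γ' - γ) t

/-- The derivative is again a superposition operator, that of `fderiv ℝ h`, followed by the
continuous linear map `pointwiseApply`. The induction therefore changes the target to `P →L[ℝ] F`,
which is why `F` is quantified inside and shares the universe of `P`. -/
theorem contDiffOn_superposition_nat {P : Type u} [NormedAddCommGroup P] [NormedSpace ℝ P]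
    {U : Set P} (hU : IsOpen U) (n : ℕ) :
    ∀ {F : Type u} [NormedAddCommGroup F] [NormedSpace ℝ F] {h : P → F}, ContDiffOn ℝ n h U →
    ContDiffOn ℝ n (superposition h : C(K, P) → C(K, F)) {γ | ∀ t, γ t ∈ U} := by
  induction n with
  | zero =>
    intro F _ _ h hh
    exact contDiffOn_zero.2 (continuousOn_superposition hh.continuousOn)
  | succ n ih =>
    intro F _ _ h hh
    have hΩ := isOpen_setOf_forall_mem (K := K) hU
    have h1 : ContDiffOn ℝ 1 h U := hh.of_le (by exact_mod_cast Nat.le_add_left 1 n)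
    rw [Nat.cast_succ, contDiffOn_succ_iff_fderiv_of_isOpen hΩ]
    rw [Nat.cast_succ, contDiffOn_succ_iff_fderiv_of_isOpen hU] at hh
    refine ⟨fun γ hγ => (hasFDerivAt_superposition hU h1 hγ).differentiableAt.differentiableWithinAt,
      fun hn => by simp at hn, ?_⟩
    refine ((pointwiseApply (K := K) (P := P) (F := F)).contDiff.comp_contDiffOn
      (ih hh.2.2)).congr fun γ hγ => ?_
    exact (hasFDerivAt_superposition hU h1 hγ).fderiv

/-- The multilinear maps `(γ₁, …, γₙ) ↦ (t ↦ p (γ₁ t, …, γₙ t))`. -/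
def superpositionMultilinear {n : ℕ} (p : P [×n]→L[ℝ] F) : C(K, P) [×n]→L[ℝ] C(K, F) :=
  MultilinearMap.mkContinuous
    { toFun := fun γ => ⟨fun t => p fun i => γ i t, by fun_prop⟩
      map_update_add' := by
        intro _ γ i a b
        ext t
        have h (c : C(K, P)) : (fun j => Function.update γ i c j t)
            = Function.update (fun j => γ j t) i (c t) := by
          ext j; rcases eq_or_ne j i with rfl | hj <;> simp [*]
        cases Subsingleton.elim ‹DecidableEq (Fin n)› (instDecidableEqFin n)
        simp [h]
      map_update_smul' := by
        intro _ γ i r a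
        ext t
        have h (c : C(K, P)) : (fun j => Function.update γ i c j t)
            = Function.update (fun j => γ j t) i (c t) := by
          ext j; rcases eq_or_ne j i with rfl | hj <;> simp [*]
        cases Subsingleton.elim ‹DecidableEq (Fin n)› (instDecidableEqFin n)
        simp [h] } ‖p‖
    (fun γ => by
      refine (ContinuousMap.norm_le _ (by positivity)).2 fun t => ?_
      refine (p.le_opNorm _).trans ?_
      gcongr with i
      exact (γ i).norm_coe_le_norm t)

theorem norm_superpositionMultilinear_le {n : ℕ} (p : P [×n]→L[ℝ] F) :
    ‖superpositionMultilinear (K := K) p‖ ≤ ‖p‖ :=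
  MultilinearMap.mkContinuous_norm_le _ (norm_nonneg _) _

/-- The power series of `h` at `z₀` acts pointwise on curves, and its terms have no larger norms, so
it converges on at least the same ball. A constant curve is needed so that one series serves every
`t`. -/
theorem analyticAt_superposition [CompleteSpace F] {h : P → F} {z₀ : P} (hh : AnalyticAt ℝ h z₀) :
    AnalyticAt ℝ (superposition h : C(K, P) → C(K, F)) (ContinuousMap.const K z₀) := by
  obtain ⟨p, r, hp⟩ := hh
  let q : FormalMultilinearSeries ℝ C(K, P) C(K, F) := fun n => superpositionMultilinear (p n)
  have hq : r ≤ q.radius := by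
    refine hp.r_le.trans (ENNReal.le_of_forall_nnreal_lt fun s hs => ?_)
    refine q.le_radius_of_summable ((p.summable_norm_mul_pow hs).of_nonneg_of_le
      (fun n => by positivity) fun n => ?_)
    gcongr
    exact norm_superpositionMultilinear_le (p n)
  refine (HasFPowerSeriesOnBall.mk (p := q) hq hp.r_pos fun {y} hy => ?_).analyticAt
  have hs := q.hasSum (Metric.eball_subset_eball hq hy)
  have heq : ∀ t, q.sum y t = h (z₀ + y t) := by
    intro t
    have h1 := hs.mapL (ContinuousMap.evalCLM ℝ t)
    refine h1.unique (hp.hasSum ?_)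
    rw [Metric.mem_eball, edist_zero_right] at hy ⊢
    refine lt_of_le_of_lt ?_ hy
    exact enorm_le_iff_norm_le.2 (y.norm_coe_le_norm t)
  -- The composition equals a sum of the series in `C(K, F)`, hence is continuous, and
  -- `superposition` does not take its default value `0`.
  have hcont : Continuous (h ∘ (ContinuousMap.const K z₀ + y)) := by
    have : h ∘ (ContinuousMap.const K z₀ + y) = q.sum y := by ext t; simp [heq]
    rw [this]; exact (q.sum y).continuous
  have : superposition h (ContinuousMap.const K z₀ + y) = q.sum y := by
    ext t; rw [superposition_apply hcont, heq]; rfl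
  rw [this]
  exact hs

/-- In the smooth case every finite order holds on the same open set of curves. In the analytic case
analyticity at the constant curve propagates to nearby curves. -/
theorem eventually_contDiffAt_superposition [CompleteSpace F] {m : ℕ∞ω} (hm : m = ∞ ∨ m = ω)
    {h : P → F} {z₀ : P} (hh : ∀ᶠ z in 𝓝 z₀, ContDiffAt ℝ m h z) :
    ∀ᶠ γ in 𝓝 (ContinuousMap.const K z₀),
      ContDiffAt ℝ m (superposition h : C(K, P) → C(K, F)) γ := by
  rcases hm with rfl | rfl
  · obtain ⟨U, hU, hUo, hzU⟩ := eventually_nhds_iff.1 hh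
    have hΩ := isOpen_setOf_forall_mem (K := K) hUo
    filter_upwards [hΩ.mem_nhds (fun _ => hzU : ContinuousMap.const K z₀ ∈ _)] with γ hγ
    rw [contDiffAt_infty]
    intro n
    exact (contDiffOn_superposition_nat hUo n fun z hz =>
      ((hU z hz).of_le (by exact_mod_cast le_top)).contDiffWithinAt).contDiffAt (hΩ.mem_nhds hγ)
  · filter_upwards [(analyticAt_superposition (K := K)
      hh.self_of_nhds.analyticAt).eventually_analyticAt] with γ hγ using hγ.contDiffAt

end Superposition

/-! ### Derivatives of first and second differentials along curves -/

section Derivatives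

variable {E F : Type*} [NormedAddCommGroup E] [NormedSpace ℝ E]
  [NormedAddCommGroup F] [NormedSpace ℝ F]

theorem hasDerivAt_fderiv_apply {f : E → F} {c : ℝ → E} {c' : E} {t : ℝ}
    (hf : ContDiffAt ℝ 2 f (c t)) (hc : HasDerivAt c c' t) {v : ℝ → E} {v' : E}
    (hv : HasDerivAt v v' t) :
    HasDerivAt (fun τ => fderiv ℝ f (c τ) (v τ))
      (fderiv ℝ (fderiv ℝ f) (c t) c' (v t) + fderiv ℝ f (c t) v') t := by
  have h1 := (hf.fderiv_right (m := 1) le_rfl).differentiableAt one_ne_zero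
  exact (h1.hasFDerivAt.comp_hasDerivAt t hc).clm_apply hv

theorem hasDerivAt_fderiv_fderiv_apply {f : E → F} {c : ℝ → E} {c' : E} {t : ℝ}
    (hf : ContDiffAt ℝ 3 f (c t)) (hc : HasDerivAt c c' t) {v w : ℝ → E} {v' w' : E}
    (hv : HasDerivAt v v' t) (hw : HasDerivAt w w' t) :
    HasDerivAt (fun τ => fderiv ℝ (fderiv ℝ f) (c τ) (v τ) (w τ))
      (fderiv ℝ (fderiv ℝ (fderiv ℝ f)) (c t) c' (v t) (w t)
        + fderiv ℝ (fderiv ℝ f) (c t) v' (w t) + fderiv ℝ (fderiv ℝ f) (c t) (v t) w') t := by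
  have h1 := ((hf.fderiv_right (m := 2) le_rfl).fderiv_right (m := 1) le_rfl).differentiableAt
    one_ne_zero
  exact ((h1.hasFDerivAt.comp_hasDerivAt t hc).clm_apply hv).clm_apply hw

end Derivatives

/-! ### Solving the geodesic equation by the inverse function theorem -/

section GeodesicFamily

universe u

variable {E : Type u} [NormedAddCommGroup E] [NormedSpace ℝ E]

/-- The interval `[-1, 1]`. -/
abbrev TimeInterval : Type := Icc (-1 : ℝ) 1

theorem neg_one_le_one_real : (-1 : ℝ) ≤ 1 := by norm_num

/-- The constant extension of a continuous curve on `[-1, 1]` to `ℝ`. -/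
def extendCurve (a : C(TimeInterval, E)) (τ : ℝ) : E :=
  a (projIcc (-1) 1 neg_one_le_one_real τ)

omit [NormedSpace ℝ E] in
theorem continuous_extendCurve (a : C(TimeInterval, E)) : Continuous (extendCurve a) :=
  a.continuous.comp continuous_projIcc

omit [NormedSpace ℝ E] in
theorem extendCurve_of_mem (a : C(TimeInterval, E)) {τ : ℝ} (hτ : τ ∈ Icc (-1 : ℝ) 1) :
    extendCurve a τ = a ⟨τ, hτ⟩ := by
  rw [extendCurve, projIcc_of_mem _ hτ]

theorem continuous_primitive_extendCurve (a : C(TimeInterval, E)) :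
    Continuous fun s : ℝ => ∫ τ in (0 : ℝ)..s, extendCurve a τ :=
  intervalIntegral.continuous_primitive
    (fun _ _ => (continuous_extendCurve a).intervalIntegrable _ _) 0

/-- The primitive vanishing at `0` of a curve on `[-1, 1]`. -/
def primitive : C(TimeInterval, E) →L[ℝ] C(TimeInterval, E) :=
  LinearMap.mkContinuous
    { toFun := fun a => ⟨fun s => ∫ τ in (0 : ℝ)..s, extendCurve a τ,
        (continuous_primitive_extendCurve a).comp continuous_subtype_val⟩
      map_add' := fun a b => by
        ext s
        exact intervalIntegral.integral_add ((continuous_extendCurve a).intervalIntegrable _ _)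
          ((continuous_extendCurve b).intervalIntegrable _ _)
      map_smul' := fun r a => by
        ext s
        exact intervalIntegral.integral_smul r (extendCurve a) } 1
    (fun a => by
      refine (ContinuousMap.norm_le _ (by positivity)).2 fun s => ?_
      have h := intervalIntegral.norm_integral_le_of_norm_le_const (a := 0) (b := (s : ℝ))
        (f := extendCurve a) (C := ‖a‖) fun τ _ => a.norm_coe_le_norm _
      have hs : |(s : ℝ) - 0| ≤ 1 := by rw [sub_zero, abs_le]; exact s.2
      calc _ ≤ ‖a‖ * |(s : ℝ) - 0| := h
        _ ≤ ‖a‖ * 1 := by gcongr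
        _ = 1 * ‖a‖ := mul_comm _ _)

theorem primitive_apply (a : C(TimeInterval, E)) (s : TimeInterval) :
    primitive a s = ∫ τ in (0 : ℝ)..s, extendCurve a τ := rfl

theorem hasDerivAt_extendCurve_primitive [CompleteSpace E] (a : C(TimeInterval, E)) {s : ℝ}
    (hs : s ∈ Ioo (-1 : ℝ) 1) : HasDerivAt (extendCurve (primitive a)) (extendCurve a s) s := by
  have h := intervalIntegral.integral_hasDerivAt_right
    ((continuous_extendCurve a).intervalIntegrable 0 s)
    (continuous_extendCurve a).stronglyMeasurable.stronglyMeasurableAtFilter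
    (continuous_extendCurve a).continuousAt
  refine h.congr_of_eventuallyEq ?_
  filter_upwards [Ioo_mem_nhds hs.1 hs.2] with τ hτ
  rw [extendCurve_of_mem _ (Ioo_subset_Icc_self hτ), primitive_apply]

/-- The curve `s ↦ a (t s)`. -/
def rescaleCurve (t : TimeInterval) (a : C(TimeInterval, E)) : C(TimeInterval, E) :=
  a.comp ⟨fun s => ⟨t * s, by
    have := abs_mul (t : ℝ) s
    rw [mem_Icc, ← abs_le, this]
    exact mul_le_one₀ (abs_le.2 t.2) (abs_nonneg _) (abs_le.2 s.2)⟩, by fun_prop⟩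

theorem mul_mem_timeInterval (t s : TimeInterval) : (t * s : ℝ) ∈ Icc (-1 : ℝ) 1 := by
  have := abs_mul (t : ℝ) s
  rw [mem_Icc, ← abs_le, this]
  exact mul_le_one₀ (abs_le.2 t.2) (abs_nonneg _) (abs_le.2 s.2)

omit [NormedSpace ℝ E] in
theorem rescaleCurve_apply (t : TimeInterval) (a : C(TimeInterval, E)) (s : TimeInterval) :
    rescaleCurve t a s = a ⟨t * s, mul_mem_timeInterval t s⟩ := rfl

omit [NormedSpace ℝ E] in
theorem norm_rescaleCurve_le (t : TimeInterval) (a : C(TimeInterval, E)) :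
    ‖rescaleCurve t a‖ ≤ ‖a‖ :=
  (ContinuousMap.norm_le _ (norm_nonneg _)).2 fun _ => a.norm_coe_le_norm _

/-- The substitution `τ ↦ t τ` in the integral; multiplying by `t` avoids a case distinction at `t =
0`. -/
theorem smul_primitive_rescaleCurve (t : TimeInterval) (a : C(TimeInterval, E)) :
    (t : ℝ) • primitive (rescaleCurve t a) = rescaleCurve t (primitive a) := by
  ext s
  rw [ContinuousMap.smul_apply, rescaleCurve_apply, primitive_apply, primitive_apply]
  have h : ∫ τ in (0 : ℝ)..s, extendCurve (rescaleCurve t a) τ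
      = ∫ τ in (0 : ℝ)..s, extendCurve a (t * τ) := by
    refine intervalIntegral.integral_congr fun τ hτ => ?_
    have hτ' : τ ∈ Icc (-1 : ℝ) 1 :=
      uIcc_subset_Icc ⟨by norm_num, by norm_num⟩ s.2 hτ
    change extendCurve (rescaleCurve t a) τ = extendCurve a (t * τ)
    rw [extendCurve_of_mem _ hτ', extendCurve_of_mem _ (mul_mem_timeInterval t ⟨τ, hτ'⟩),
      rescaleCurve_apply]
  rw [h, intervalIntegral.smul_integral_comp_mul_left, mul_zero]

variable [FiniteDimensional ℝ E]

/-- The linear curve `s ↦ s v`. -/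
def linearCurve : E →L[ℝ] C(TimeInterval, E) :=
  LinearMap.toContinuousLinearMap
    { toFun := fun v => ⟨fun s => (s : ℝ) • v, by fun_prop⟩
      map_add' := fun v w => by ext; simp
      map_smul' := fun r v => by ext s; exact smul_comm (s : ℝ) r v }

@[simp]
theorem linearCurve_apply (v : E) (s : TimeInterval) : linearCurve v s = (s : ℝ) • v := rfl

/-- The constant curve, as a continuous linear map. -/
def constCurve : E →L[ℝ] C(TimeInterval, E) :=
  LinearMap.toContinuousLinearMap
    { toFun := fun v => ContinuousMap.const _ v
      map_add' := fun v w => by ext; simp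
      map_smul' := fun r v => by ext; simp }

@[simp]
theorem constCurve_apply (v : E) (s : TimeInterval) : constCurve v s = v := rfl

/-- The pair (displacement, velocity) of the curve with initial displacement `0`, initial velocity
`v` and acceleration `a`. -/
def phaseCurve : E × C(TimeInterval, E) →L[ℝ] C(TimeInterval, E × E) :=
  ((ContinuousLinearMap.inl ℝ E E).compLeftContinuous ℝ TimeInterval).comp
      (linearCurve.coprod (primitive.comp primitive))
    + ((ContinuousLinearMap.inr ℝ E E).compLeftContinuous ℝ TimeInterval).comp
      (constCurve.coprod primitive)

theorem phaseCurve_apply (v : E) (a : C(TimeInterval, E)) (s : TimeInterval) :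
    phaseCurve (v, a) s = ((s : ℝ) • v + primitive (primitive a) s, v + primitive a s) := by
  simp [phaseCurve]

/-- If `c` has data `(v, a)`, then `s ↦ c (t s)` has initial velocity `t v` and acceleration `t² a(t
s)`. This underlies the scaling of geodesics. -/
theorem phaseCurve_smul_rescaleCurve (t : TimeInterval) (v : E) (a : C(TimeInterval, E))
    (s : TimeInterval) :
    phaseCurve ((t : ℝ) • v, (t : ℝ) ^ 2 • rescaleCurve t a) s =
      ((phaseCurve (v, a) ⟨t * s, mul_mem_timeInterval t s⟩).1,
        (t : ℝ) • (phaseCurve (v, a) ⟨t * s, mul_mem_timeInterval t s⟩).2) := by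
  have h1 : primitive ((t : ℝ) ^ 2 • rescaleCurve t a)
      = (t : ℝ) • rescaleCurve t (primitive a) := by
    rw [map_smul, pow_two, mul_smul, smul_primitive_rescaleCurve]
  rw [phaseCurve_apply, phaseCurve_apply, h1, map_smul, smul_primitive_rescaleCurve,
    ContinuousMap.smul_apply, rescaleCurve_apply, rescaleCurve_apply]
  simp [smul_smul, mul_comm]

/-- Solutions on `[-1, 1]` of the second order equation `c'' = -h(c, c')` with `h` quadratic in the
velocity: their acceleration depends regularly on the initial velocity. -/
theorem exists_acceleration {m : ℕ∞ω} (hm : m = ∞ ∨ m = ω) {h : E × E → E}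
    (hh : ∀ᶠ z in 𝓝 (0 : E × E), ContDiffAt ℝ m h z) (hh0 : h 0 = 0) (hdh : fderiv ℝ h 0 = 0)
    (hhom : ∀ (t : ℝ) (y u : E), h (y, t • u) = t ^ 2 • h (y, u)) :
    ∃ ρ > 0, ∃ a : E → C(TimeInterval, E), a 0 = 0 ∧
      (∀ v ∈ Metric.ball (0 : E) ρ, ContDiffAt ℝ m a v) ∧
      (∀ v ∈ Metric.ball (0 : E) ρ, ∀ s, a v s = - h (phaseCurve (v, a v) s)) ∧
      ∀ v ∈ Metric.ball (0 : E) ρ, ∀ t : TimeInterval,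
        a ((t : ℝ) • v) = (t : ℝ) ^ 2 • rescaleCurve t (a v) := by
  have := FiniteDimensional.complete ℝ E
  have hm1 : (1 : ℕ∞ω) ≤ m := by rcases hm with rfl | rfl <;> simp
  let X := C(TimeInterval, E)
  obtain ⟨U, hU, hUo, h0U⟩ := eventually_nhds_iff.1 hh
  have hhU : ContDiffOn ℝ 1 h U := fun z hz => ((hU z hz).of_le hm1).contDiffWithinAt
  have hconst : ContinuousMap.const TimeInterval (0 : E × E) = 0 := rfl
  have hN := eventually_contDiffAt_superposition (K := TimeInterval) hm hh
  rw [hconst] at hN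
  have hphase0 : Tendsto (phaseCurve (E := E)) (𝓝 0) (𝓝 0) :=
    phaseCurve.continuous.tendsto' _ _ (map_zero _)
  -- The points with `Ψ (v, a) = (v, 0)` are the solutions with initial velocity `v`; keeping `v` as
  -- first component turns the implicit function problem into an inverse function problem.
  let Ψ : E × X → E × X := fun z => (z.1, z.2 + superposition h (phaseCurve z))
  have hΨ : ∀ᶠ z in 𝓝 (0 : E × X), ContDiffAt ℝ m Ψ z := by
    filter_upwards [hphase0.eventually hN] with z hz
    exact contDiffAt_fst.prodMk (contDiffAt_snd.add (hz.comp z (phaseCurve (E := E)).contDiff.contDiffAt))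
  -- The superposition term has derivative `0` at the zero curve because `fderiv ℝ h 0 = 0`, so only
  -- the identity remains.
  have hΨ' : HasFDerivAt Ψ ((ContinuousLinearEquiv.refl ℝ (E × X) : (E × X) ≃L[ℝ] (E × X)) :
      E × X →L[ℝ] E × X) 0 := by
    have h1 := hasFDerivAt_superposition (K := TimeInterval) hUo hhU (γ := 0) (fun _ => h0U)
    have h2 : HasFDerivAt (superposition h : C(TimeInterval, E × E) → C(TimeInterval, E))
        (0 : C(TimeInterval, E × E) →L[ℝ] C(TimeInterval, E)) 0 := by
      refine h1.congr_fderiv ?_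
      ext δ t
      rw [pointwiseApply_apply, superposition_apply_of_mem
        (hhU.continuousOn_fderiv_of_isOpen hUo le_rfl) (fun _ => h0U)]
      change fderiv ℝ h 0 (δ t) = 0
      simp [hdh]
    have h3 : HasFDerivAt (fun z : E × X => superposition h (phaseCurve z))
        (0 : E × X →L[ℝ] X) 0 := by
      have h2' : HasFDerivAt (superposition h : C(TimeInterval, E × E) → C(TimeInterval, E))
        (0 : C(TimeInterval, E × E) →L[ℝ] C(TimeInterval, E))
        (phaseCurve (0 : E × X)) := by rw [map_zero]; exact h2
      exact (h2'.comp 0 (phaseCurve (E := E)).hasFDerivAt).congr_fderiv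
        (ContinuousLinearMap.zero_comp _)
    have h4 := (hasFDerivAt_fst (𝕜 := ℝ) (p := (0 : E × X))).prodMk
      ((hasFDerivAt_snd (𝕜 := ℝ) (p := (0 : E × X))).add h3)
    refine h4.congr_fderiv ?_
    ext <;> simp
  obtain ⟨e, he0, heΨ, -, hesymm⟩ := exists_openPartialHomeomorph_contDiffAt hm1 hΨ hΨ'
  have hsup (γ : C(TimeInterval, E × E)) (hγ : ∀ t, γ t ∈ U) (s : TimeInterval) :
      superposition h γ s = h (γ s) := superposition_apply_of_mem hhU.continuousOn hγ s
  have hΨ0 : Ψ 0 = 0 := by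
    refine Prod.ext rfl ?_
    ext s
    have : superposition h (0 : C(TimeInterval, E × E)) s = 0 := by
      rw [hsup 0 (fun _ => h0U)]; exact hh0
    simpa [Ψ] using this
  -- On this open set `Ψ` is injective and the phase curves stay where `h` is regular, so that
  -- `superposition h` is the genuine composition.
  have hopen : IsOpen (e.source ∩ {z | ∀ t, phaseCurve z t ∈ U}) :=
    e.open_source.inter ((isOpen_setOf_forall_mem hUo).preimage phaseCurve.continuous)
  obtain ⟨δ, hδ, hδS⟩ := Metric.isOpen_iff.1 hopen 0 ⟨he0, fun t => by rw [map_zero]; exact h0U⟩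
  let A : E → E × X := fun v => e.symm (v, 0)
  have h0t : ((0, 0) : E × X) ∈ e.target := by
    have := e.map_source he0
    rwa [heΨ, hΨ0] at this
  have hA0 : A 0 = 0 := by
    have := e.left_inv he0
    rw [heΨ, hΨ0] at this
    exact this
  have hAc : ContinuousAt A 0 :=
    ContinuousAt.comp (f := fun v : E => ((v, 0) : E × X)) (e.continuousAt_symm h0t) (by fun_prop)
  have hev : ∀ᶠ v in 𝓝 (0 : E), ((v, 0) : E × X) ∈ e.target ∧ A v ∈ Metric.ball 0 δ := by
    refine Filter.Eventually.and ?_ ?_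
    · exact (Continuous.prodMk_left (0 : X)).continuousAt.preimage_mem_nhds
        (e.open_target.mem_nhds h0t)
    · refine hAc.preimage_mem_nhds ?_
      rw [hA0]; exact Metric.ball_mem_nhds _ hδ
  obtain ⟨ρ, hρ, hρA⟩ := Metric.eventually_nhds_iff_ball.1 hev
  have hΨA : ∀ v ∈ Metric.ball (0 : E) ρ, Ψ (A v) = (v, 0) := fun v hv => by
    rw [← heΨ]; exact e.right_inv (hρA v hv).1
  have hA1 : ∀ v ∈ Metric.ball (0 : E) ρ, A v = (v, (A v).2) := fun v hv =>
    Prod.ext (show (Ψ (A v)).1 = v by rw [hΨA v hv]) rfl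
  have hAU : ∀ v ∈ Metric.ball (0 : E) ρ, ∀ s, phaseCurve (A v) s ∈ U := fun v hv =>
    (hδS (hρA v hv).2).2
  have hA2 : ∀ v ∈ Metric.ball (0 : E) ρ, ∀ s, (A v).2 s = - h (phaseCurve (A v) s) := by
    intro v hv s
    have h1 : ((A v).2 + superposition h (phaseCurve (A v))) s = (0 : X) s :=
      congrArg (fun z : E × X => z.2 s) (hΨA v hv)
    rw [ContinuousMap.add_apply, hsup _ (hAU v hv)] at h1
    exact eq_neg_of_add_eq_zero_left h1
  have hball : ∀ v ∈ Metric.ball (0 : E) ρ, ∀ t : TimeInterval,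
      (t : ℝ) • v ∈ Metric.ball (0 : E) ρ := by
    intro v hv t
    rw [mem_ball_zero_iff] at hv ⊢
    rw [norm_smul]
    exact (mul_le_of_le_one_left (norm_nonneg _) (abs_le.2 t.2)).trans_lt hv
  -- The rescaled solution lies in the domain of injectivity of `Ψ` and is mapped to `(t v, 0)`, so
  -- it is the solution already chosen for `t v`.
  have hscale : ∀ v ∈ Metric.ball (0 : E) ρ, ∀ t : TimeInterval,
      A ((t : ℝ) • v) = ((t : ℝ) • v, (t : ℝ) ^ 2 • rescaleCurve t (A v).2) := by
    intro v hv t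
    have ht1 : |(t : ℝ)| ≤ 1 := abs_le.2 t.2
    have hz : ((t : ℝ) • v, (t : ℝ) ^ 2 • rescaleCurve t (A v).2) ∈ Metric.ball (0 : E × X) δ := by
      have h1 := (hρA v hv).2
      rw [hA1 v hv, mem_ball_zero_iff, Prod.norm_mk, max_lt_iff] at h1
      rw [mem_ball_zero_iff, Prod.norm_mk, max_lt_iff, norm_smul, norm_smul, norm_pow]
      refine ⟨(mul_le_of_le_one_left (norm_nonneg _) ht1).trans_lt h1.1, ?_⟩
      exact (mul_le_of_le_one_left (norm_nonneg _) (pow_le_one₀ (norm_nonneg _) ht1)).trans_lt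
        ((norm_rescaleCurve_le t _).trans_lt h1.2)
    have hzΨ : Ψ ((t : ℝ) • v, (t : ℝ) ^ 2 • rescaleCurve t (A v).2) = ((t : ℝ) • v, 0) := by
      refine Prod.ext rfl ?_
      ext s
      change ((t : ℝ) ^ 2 • rescaleCurve t (A v).2) s + superposition h _ s = 0
      rw [hsup _ (hδS hz).2, phaseCurve_smul_rescaleCurve, ContinuousMap.smul_apply,
        rescaleCurve_apply, hA2 v hv, ← hA1 v hv]
      rw [hhom, smul_neg, neg_add_cancel]
    have := e.left_inv (hδS hz).1
    rw [heΨ, hzΨ] at this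
    exact this
  refine ⟨ρ, hρ, fun v => (A v).2, by simp [hA0], fun v hv => ?_, fun v hv s => ?_, fun v hv t => ?_⟩
  · exact contDiffAt_snd.comp v ((hesymm _ (hρA v hv).1).comp v
      (by fun_prop : ContDiffAt ℝ m (fun w : E => ((w, 0) : E × X)) v))
  · rw [hA2 v hv, hA1 v hv]
  · simp only [hscale v hv]

omit [FiniteDimensional ℝ E] in
-- Along positions `h (y, 0) = 0`, and along velocities `h` is quadratic in the parameter, so both
-- partial derivatives vanish.
theorem fderiv_eq_zero_of_homogeneous {h : E × E → E} (hh : DifferentiableAt ℝ h 0)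
    (hhom : ∀ (t : ℝ) (y u : E), h (y, t • u) = t ^ 2 • h (y, u)) : fderiv ℝ h 0 = 0 := by
  have hzero (y : E) : h (y, 0) = 0 := by simpa using hhom 0 y 0
  have hd (z : E × E) : HasDerivAt (fun t : ℝ => h (t • z)) (fderiv ℝ h 0 z) 0 := by
    have h1 : HasDerivAt (fun t : ℝ => t • z) z 0 := by
      simpa using (hasDerivAt_id (0 : ℝ)).smul_const z
    have h2 : DifferentiableAt ℝ h ((0 : ℝ) • z) := by rwa [zero_smul]
    have h3 := h2.hasFDerivAt.comp_hasDerivAt 0 h1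
    rwa [zero_smul] at h3
  refine ContinuousLinearMap.ext fun z => ?_
  have h1 : fderiv ℝ h 0 (z.1, 0) = 0 := by
    refine (hd (z.1, 0)).unique ((hasDerivAt_const 0 0).congr_of_eventuallyEq ?_)
    exact Eventually.of_forall fun t => by simp [hzero]
  have h2 : fderiv ℝ h 0 (0, z.2) = 0 := by
    have h3 : HasDerivAt (fun t : ℝ => t ^ 2 • h (0, z.2)) 0 0 := by
      simpa using (hasDerivAt_pow 2 (0 : ℝ)).smul_const (h (0, z.2))
    refine (hd (0, z.2)).unique (h3.congr_of_eventuallyEq ?_)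
    exact Eventually.of_forall fun t => by simp [hhom]
  have : z = (z.1, 0) + (0, z.2) := by simp
  rw [this, map_add, h1, h2, add_zero]
  rfl

/-- The local exponential map of a spray `(u, -S(y, u))`: solutions of `c'' + S(c, c') = 0`
starting at `y₀` have the form `t ↦ f (t v)`. -/
theorem exists_exponential_of_spray {m : ℕ∞ω} (hm : m = ∞ ∨ m = ω)
    {S : E → E → E} {y₀ : E} (hS : ∀ᶠ z in 𝓝 (y₀, (0 : E)), ContDiffAt ℝ m (fun z => S z.1 z.2) z)
    (hhom : ∀ (t : ℝ) (y u : E), S y (t • u) = t ^ 2 • S y u) :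
    ∃ ρ > 0, ∃ f : E → E, f 0 = y₀ ∧ HasFDerivAt f (ContinuousLinearMap.id ℝ E) 0 ∧
      (∀ v ∈ Metric.ball (0 : E) ρ, ContDiffAt ℝ m f v) ∧
      ∀ v : E, ∀ t : ℝ, t • v ∈ Metric.ball (0 : E) ρ →
        fderiv ℝ (fderiv ℝ f) (t • v) v v + S (f (t • v)) (fderiv ℝ f (t • v) v) = 0 := by
  have := FiniteDimensional.complete ℝ E
  have hm1 : (1 : ℕ∞ω) ≤ m := by rcases hm with rfl | rfl <;> simp
  have hm2 : (2 : ℕ∞ω) ≤ m := by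
    rcases hm with rfl | rfl
    · exact WithTop.coe_le_coe.2 le_top
    · exact le_top
  let h : E × E → E := fun z => S (y₀ + z.1) z.2
  have hh : ∀ᶠ z in 𝓝 (0 : E × E), ContDiffAt ℝ m h z := by
    have ht : Tendsto (fun z : E × E => (y₀ + z.1, z.2)) (𝓝 0) (𝓝 (y₀, 0)) :=
      Continuous.tendsto' (by fun_prop) _ _ (by simp)
    filter_upwards [ht.eventually hS] with z hz
    exact hz.comp z (by fun_prop : ContDiffAt ℝ m (fun z : E × E => (y₀ + z.1, z.2)) z)
  have hhom' (t : ℝ) (y u : E) : h (y, t • u) = t ^ 2 • h (y, u) := hhom t _ u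
  have hh0 : h 0 = 0 := by
    have := hhom' 0 0 0
    rwa [zero_smul, zero_pow two_ne_zero, zero_smul] at this
  have hdh0 : fderiv ℝ h 0 = 0 := fderiv_eq_zero_of_homogeneous
    (hh.self_of_nhds.differentiableAt (zero_lt_one.trans_le hm1).ne') hhom'
  obtain ⟨ρ, hρ, a, ha0, ham, hsol, hscale⟩ := exists_acceleration hm hh hh0 hdh0 hhom'
  have hball : ∀ v ∈ Metric.ball (0 : E) ρ, ∀ t : TimeInterval,
      (t : ℝ) • v ∈ Metric.ball (0 : E) ρ := by
    intro v hv t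
    rw [mem_ball_zero_iff] at hv ⊢
    rw [norm_smul]
    exact (mul_le_of_le_one_left (norm_nonneg _) (abs_le.2 t.2)).trans_lt hv
  let one : TimeInterval := ⟨1, by norm_num, le_rfl⟩
  -- The position at time `1`. By the scaling law, `f (t • v)` is then the position at time `t` of
  -- the solution with velocity `v`.
  let f : E → E := fun v => y₀ + (phaseCurve (v, a v) one).1
  have hfs : ∀ v ∈ Metric.ball (0 : E) ρ, ∀ t : TimeInterval,
      f ((t : ℝ) • v) = y₀ + (phaseCurve (v, a v) t).1 := by
    intro v hv t
    have := congrArg Prod.fst (phaseCurve_smul_rescaleCurve t v (a v) one)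
    rw [← hscale v hv t] at this
    simp only [f, this, one, mul_one]
  have hfm : ∀ v ∈ Metric.ball (0 : E) ρ, ContDiffAt ℝ m f v := by
    intro v hv
    have h1 : ContDiffAt ℝ m (fun w => (w, a w)) v := contDiffAt_id.prodMk (ham v hv)
    let Λ : E × C(TimeInterval, E) →L[ℝ] E :=
      (ContinuousLinearMap.fst ℝ E E).comp ((ContinuousMap.evalCLM ℝ one).comp phaseCurve)
    exact contDiffAt_const.add (Λ.contDiff.contDiffAt.comp v h1)
  have hpos : ∀ v ∈ Metric.ball (0 : E) ρ, ∀ s ∈ Ioo (-1 : ℝ) 1,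
      HasDerivAt (fun τ : ℝ => f (τ • v)) (v + extendCurve (primitive (a v)) s) s := by
    intro v hv s hs
    have h1 := hasDerivAt_extendCurve_primitive (primitive (a v)) hs
    have h2 := (((hasDerivAt_id s).smul_const v).add h1).const_add y₀
    rw [one_smul] at h2
    refine h2.congr_of_eventuallyEq ?_
    filter_upwards [Ioo_mem_nhds hs.1 hs.2] with τ hτ
    have h3 := hfs v hv ⟨τ, Ioo_subset_Icc_self hτ⟩
    rw [phaseCurve_apply] at h3
    simpa [extendCurve_of_mem _ (Ioo_subset_Icc_self hτ)] using h3
  have hline : ∀ (v : E) (s : ℝ), HasDerivAt (fun τ : ℝ => τ • v) v s := fun v s => by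
    simpa using (hasDerivAt_id s).smul_const v
  have hball' : ∀ v ∈ Metric.ball (0 : E) ρ, ∀ s ∈ Ioo (-1 : ℝ) 1, s • v ∈ Metric.ball (0 : E) ρ :=
    fun v hv s hs => hball v hv ⟨s, Ioo_subset_Icc_self hs⟩
  have hvel : ∀ v ∈ Metric.ball (0 : E) ρ, ∀ s ∈ Ioo (-1 : ℝ) 1,
      fderiv ℝ f (s • v) v = v + extendCurve (primitive (a v)) s := by
    intro v hv s hs
    have h1 := ((hfm _ (hball' v hv s hs)).differentiableAt
      (zero_lt_one.trans_le hm1).ne').hasFDerivAt.comp_hasDerivAt s (hline v s)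
    exact h1.unique (hpos v hv s hs)
  have hspray : ∀ v ∈ Metric.ball (0 : E) ρ, ∀ s ∈ Ioo (-1 : ℝ) 1,
      fderiv ℝ (fderiv ℝ f) (s • v) v v
          + S (f (s • v)) (fderiv ℝ f (s • v) v) = 0 := by
    intro v hv s hs
    have hsI := Ioo_subset_Icc_self hs
    have h2 := hasDerivAt_fderiv_apply ((hfm _ (hball' v hv s hs)).of_le hm2) (hline v s)
      (hasDerivAt_const s v)
    have h3 := (hasDerivAt_extendCurve_primitive (a v) hs).const_add v
    have h4 : HasDerivAt (fun τ : ℝ => fderiv ℝ f (τ • v) v) (extendCurve (a v) s) s := by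
      refine h3.congr_of_eventuallyEq ?_
      filter_upwards [Ioo_mem_nhds hs.1 hs.2] with τ hτ using hvel v hv τ hτ
    have h5 := h2.unique h4
    rw [map_zero, add_zero, extendCurve_of_mem _ hsI, hsol v hv] at h5
    have h6 := hfs v hv ⟨s, hsI⟩
    have h7 : (phaseCurve (v, a v) ⟨s, hsI⟩).2 = fderiv ℝ f (s • v) v := by
      rw [hvel v hv s hs, phaseCurve_apply, extendCurve_of_mem _ hsI]
    rw [h5, ← h7]
    simp only at h6
    simp [h, h6]
  have h0ball : (0 : E) ∈ Metric.ball (0 : E) ρ := Metric.mem_ball_self hρ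
  have hf0 : f 0 = y₀ := by
    simp [f, ha0, phaseCurve_apply]
  refine ⟨ρ, hρ, f, hf0, ?_, hfm, ?_⟩
  · have hd := (hfm 0 h0ball).differentiableAt (zero_lt_one.trans_le hm1).ne'
    refine hd.hasFDerivAt.congr_fderiv ?_
    -- Known only for small `v`; linearity of the derivative extends it to all `v` below.
    have hvel0 : ∀ v ∈ Metric.ball (0 : E) ρ, fderiv ℝ f 0 v = v := by
      intro v hv
      have h1 := hvel v hv 0 (by norm_num)
      rw [zero_smul, extendCurve_of_mem _ (by norm_num : (0 : ℝ) ∈ Icc (-1 : ℝ) 1),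
        primitive_apply] at h1
      simpa using h1
    ext v
    obtain ⟨r, hr, hrv⟩ : ∃ r : ℝ, 0 < r ∧ r • v ∈ Metric.ball (0 : E) ρ := by
      have : Tendsto (fun r : ℝ => r • v) (𝓝[>] 0) (𝓝 0) :=
        (Continuous.tendsto' (by fun_prop) _ _ (by simp)).mono_left nhdsWithin_le_nhds
      obtain ⟨r, hr1, hr2⟩ := ((this.eventually (Metric.ball_mem_nhds 0 hρ)).and
        self_mem_nhdsWithin).exists
      exact ⟨r, hr2, hr1⟩
    have h1 := hvel0 _ hrv
    rw [map_smul] at h1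
    simpa using smul_right_injective E hr.ne' h1
  · intro v t htv
    -- Here `v` itself may lie outside the ball. Use instead the velocity `r • v` at the time `t /
    -- r`, which lies in `(-1, 1)`; both terms of the equation scale by `r²`, which is then
    -- cancelled.
    obtain ⟨r, hr, hrv⟩ : ∃ r : ℝ, |t| < r ∧ r • v ∈ Metric.ball (0 : E) ρ := by
      have h1 : |t| • v ∈ Metric.ball (0 : E) ρ := by
        rw [mem_ball_zero_iff, norm_smul] at htv ⊢
        simpa using htv
      have : ContinuousAt (fun r : ℝ => r • v) |t| := by fun_prop
      have h2 : ∀ᶠ r in 𝓝[>] |t|, r • v ∈ Metric.ball (0 : E) ρ :=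
        Eventually.filter_mono nhdsWithin_le_nhds
          (this.preimage_mem_nhds (Metric.isOpen_ball.mem_nhds h1))
      obtain ⟨r, hr1, hr2⟩ := (h2.and self_mem_nhdsWithin).exists
      exact ⟨r, hr2, hr1⟩
    have hr0 : 0 < r := (abs_nonneg t).trans_lt hr
    have h1 := hspray _ hrv (t / r) (by
      rw [mem_Ioo, ← abs_lt, abs_div, abs_of_pos hr0, div_lt_one hr0]; exact hr)
    have h2 : (t / r) • r • v = t • v := by rw [smul_smul, div_mul_cancel₀ _ hr0.ne']
    simp only [h2, map_smul, smul_apply, hhom, pow_two, mul_smul, ← smul_add] at h1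
    exact (smul_eq_zero_iff_right hr0.ne').1 ((smul_eq_zero_iff_right hr0.ne').1 h1)

end GeodesicFamily

/-! ### Leibniz rules for fields of multilinear maps along curves -/

section PartialDerivatives

variable {E F X : Type*} [NormedAddCommGroup E] [NormedSpace ℝ E] [NormedAddCommGroup F]
  [NormedSpace ℝ F] [NormedAddCommGroup X] [NormedSpace ℝ X]

theorem hasDerivAt_add_smul (p q : X) (t : ℝ) : HasDerivAt (fun s : ℝ => p + s • q) q t := by
  simpa using ((hasDerivAt_id t).smul_const q).const_add p

theorem fderiv_apply_eq_of_hasDerivAt {Φ : X → F} {p q : X} {d : F}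
    (hΦ : DifferentiableAt ℝ Φ p) (h : HasDerivAt (fun s : ℝ => Φ (p + s • q)) d 0) :
    fderiv ℝ Φ p q = d := by
  have h1 : HasFDerivAt Φ (fderiv ℝ Φ p) (p + (0 : ℝ) • q) := by
    rw [zero_smul, add_zero]; exact hΦ.hasFDerivAt
  exact (h1.comp_hasDerivAt 0 (hasDerivAt_add_smul p q 0)).unique h

theorem fderiv_apply_eq_of_linear {Φ : X → F} {p q : X} {d : F} (hΦ : DifferentiableAt ℝ Φ p)
    (h : ∀ s : ℝ, Φ (p + s • q) = Φ p + s • d) : fderiv ℝ Φ p q = d := by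
  refine fderiv_apply_eq_of_hasDerivAt hΦ ?_
  simp only [h]
  exact hasDerivAt_add_smul _ _ _

theorem fderiv_prodMk_right {Φ : E × X → F} {y w : E} {p : X}
    (hΦ : DifferentiableAt ℝ Φ (y, p)) :
    fderiv ℝ Φ (y, p) (w, 0) = fderiv ℝ (fun z => Φ (z, p)) y w := by
  have h1 : HasFDerivAt (fun z : E => (z, p)) (ContinuousLinearMap.inl ℝ E X) y :=
    hasFDerivAt_prodMk_left y p
  exact (congrArg (fun A => A w) (hΦ.hasFDerivAt.comp y h1).fderiv).symm

/-- Leibniz rule along a curve for a field of bilinear maps. -/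
theorem hasDerivAt_bilinear {T : E → E → E → F} {c u v : ℝ → E} {c' u' v' : E} {t : ℝ}
    (hT : DifferentiableAt ℝ (fun z : E × E × E => T z.1 z.2.1 z.2.2) (c t, u t, v t))
    (hl : ∀ (a b w : E) (s : ℝ), T (c t) (a + s • b) w = T (c t) a w + s • T (c t) b w)
    (hr : ∀ (a b w : E) (s : ℝ), T (c t) w (a + s • b) = T (c t) w a + s • T (c t) w b)
    (hc : HasDerivAt c c' t) (hu : HasDerivAt u u' t) (hv : HasDerivAt v v' t) :
    HasDerivAt (fun s => T (c s) (u s) (v s))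
      (fderiv ℝ (fun y => T y (u t) (v t)) (c t) c' + T (c t) u' (v t) + T (c t) (u t) v') t := by
  have h1 := hT.hasFDerivAt.comp_hasDerivAt t (hc.prodMk (hu.prodMk hv))
  refine h1.congr_deriv ?_
  -- The velocity is split into its base component, giving the partial derivative in `y`, and its
  -- two fibre components, along which `T` is affine.
  have h2 : ((c', u', v') : E × E × E) = (c', 0) + (0, u', 0) + (0, 0, v') := by simp
  rw [h2, map_add, map_add, fderiv_prodMk_right hT,
    fderiv_apply_eq_of_linear (q := (0, u', 0)) hT (d := T (c t) u' (v t)) (fun s => by simp [hl]),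
    fderiv_apply_eq_of_linear (q := (0, 0, v')) hT (d := T (c t) (u t) v') (fun s => by simp [hr])]

/-- Leibniz rule along a curve for a field of trilinear maps. -/
theorem hasDerivAt_trilinear {T : E → E → E → E → F} {c u v w : ℝ → E} {c' u' v' w' : E} {t : ℝ}
    (hT : DifferentiableAt ℝ (fun z : E × E × E × E => T z.1 z.2.1 z.2.2.1 z.2.2.2)
      (c t, u t, v t, w t))
    (h₁ : ∀ (a b x y : E) (s : ℝ), T (c t) (a + s • b) x y = T (c t) a x y + s • T (c t) b x y)
    (h₂ : ∀ (a b x y : E) (s : ℝ), T (c t) x (a + s • b) y = T (c t) x a y + s • T (c t) x b y)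
    (h₃ : ∀ (a b x y : E) (s : ℝ), T (c t) x y (a + s • b) = T (c t) x y a + s • T (c t) x y b)
    (hc : HasDerivAt c c' t) (hu : HasDerivAt u u' t) (hv : HasDerivAt v v' t)
    (hw : HasDerivAt w w' t) :
    HasDerivAt (fun s => T (c s) (u s) (v s) (w s))
      (fderiv ℝ (fun y => T y (u t) (v t) (w t)) (c t) c' + T (c t) u' (v t) (w t)
        + T (c t) (u t) v' (w t) + T (c t) (u t) (v t) w') t := by
  have h1 := hT.hasFDerivAt.comp_hasDerivAt t (hc.prodMk (hu.prodMk (hv.prodMk hw)))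
  refine h1.congr_deriv ?_
  have h2 : ((c', u', v', w') : E × E × E × E)
      = (c', 0) + (0, u', 0) + (0, 0, v', 0) + (0, 0, 0, w') := by simp
  rw [h2, map_add, map_add, map_add, fderiv_prodMk_right hT,
    fderiv_apply_eq_of_linear (q := (0, u', 0)) hT (d := T (c t) u' (v t) (w t))
      (fun s => by simp [h₁]),
    fderiv_apply_eq_of_linear (q := (0, 0, v', 0)) hT (d := T (c t) (u t) v' (w t))
      (fun s => by simp [h₂]),
    fderiv_apply_eq_of_linear (q := (0, 0, 0, w')) hT (d := T (c t) (u t) (v t) w')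
      (fun s => by simp [h₃])]

end PartialDerivatives

/-! ### The Levi-Civita connection of a metric on an open subset of a vector space -/

section Metric

set_option synthInstance.maxHeartbeats 400000

variable {E : Type*} [NormedAddCommGroup E] [NormedSpace ℝ E]

/-- `G` is a Riemannian metric of class `C^m` on the open subset `U` of a vector space. -/
structure IsMetricOn (m : ℕ∞ω) (G : E → E →L[ℝ] E →L[ℝ] ℝ) (U : Set E) : Prop where
  isOpen : IsOpen U
  contDiffOn : ContDiffOn ℝ m G U
  symm : ∀ y ∈ U, ∀ v w, G y v w = G y w v
  pos : ∀ y ∈ U, ∀ v, v ≠ 0 → 0 < G y v v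

theorem christoffelFirst_apply (G : E → E →L[ℝ] E →L[ℝ] ℝ) (y u v w : E) :
    christoffelFirst G y u v w
      = 1 / 2 * (fderiv ℝ G y u v w + fderiv ℝ G y v u w - fderiv ℝ G y w u v) := by
  simp [christoffelFirst]

/-- Linearity in a slot is stated throughout in the form `a + s • b`: it contains additivity (`s =
1`) and homogeneity (`a = 0`), and is the form used by the Leibniz rules. -/
theorem christoffelFirst_add_smul_left (G : E → E →L[ℝ] E →L[ℝ] ℝ) (y a b w : E) (s : ℝ) :
    christoffelFirst G y (a + s • b) w
      = christoffelFirst G y a w + s • christoffelFirst G y b w := by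
  refine ContinuousLinearMap.ext fun z => ?_
  simp only [christoffelFirst_apply, add_apply, smul_apply, map_add, map_smul, smul_eq_mul]
  ring

theorem christoffelFirst_add_smul_right (G : E → E →L[ℝ] E →L[ℝ] ℝ) (y a b w : E) (s : ℝ) :
    christoffelFirst G y w (a + s • b)
      = christoffelFirst G y w a + s • christoffelFirst G y w b := by
  refine ContinuousLinearMap.ext fun z => ?_
  simp only [christoffelFirst_apply, add_apply, smul_apply, map_add, map_smul, smul_eq_mul]
  ring

theorem christoffel_add_smul_left (G : E → E →L[ℝ] E →L[ℝ] ℝ) (y a b w : E) (s : ℝ) :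
    christoffel G y (a + s • b) w = christoffel G y a w + s • christoffel G y b w := by
  rw [christoffel, christoffelFirst_add_smul_left, map_add, map_smul]; rfl

theorem christoffel_add_smul_right (G : E → E →L[ℝ] E →L[ℝ] ℝ) (y a b w : E) (s : ℝ) :
    christoffel G y w (a + s • b) = christoffel G y w a + s • christoffel G y w b := by
  rw [christoffel, christoffelFirst_add_smul_right, map_add, map_smul]; rfl

@[simp]
theorem christoffel_zero_left (G : E → E →L[ℝ] E →L[ℝ] ℝ) (y v : E) : christoffel G y 0 v = 0 := by
  have := christoffel_add_smul_left G y 0 0 v 1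
  simpa using this

@[simp]
theorem christoffel_zero_right (G : E → E →L[ℝ] E →L[ℝ] ℝ) (y v : E) :
    christoffel G y v 0 = 0 := by
  have := christoffel_add_smul_right G y 0 0 v 1
  simpa using this

theorem christoffel_add_right (G : E → E →L[ℝ] E →L[ℝ] ℝ) (y a b w : E) :
    christoffel G y w (a + b) = christoffel G y w a + christoffel G y w b := by
  simpa using christoffel_add_smul_right G y a b w 1

theorem christoffel_smul_left (G : E → E →L[ℝ] E →L[ℝ] ℝ) (y b w : E) (s : ℝ) :
    christoffel G y (s • b) w = s • christoffel G y b w := by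
  simpa using christoffel_add_smul_left G y 0 b w s

theorem christoffel_smul_right (G : E → E →L[ℝ] E →L[ℝ] ℝ) (y b w : E) (s : ℝ) :
    christoffel G y w (s • b) = s • christoffel G y w b := by
  simpa using christoffel_add_smul_right G y 0 b w s

theorem christoffel_neg_left (G : E → E →L[ℝ] E →L[ℝ] ℝ) (y a w : E) :
    christoffel G y (-a) w = -christoffel G y a w := by
  simpa using christoffel_smul_left G y a w (-1)

/-- A definite form has trivial kernel, and `E` and its dual have the same finite dimension. -/
theorem isInvertible_of_pos [FiniteDimensional ℝ E] {B : E →L[ℝ] E →L[ℝ] ℝ}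
    (hB : ∀ v, v ≠ 0 → 0 < B v v) : B.IsInvertible := by
  have hinj : Function.Injective (B : E →ₗ[ℝ] E →L[ℝ] ℝ) := by
    rw [← LinearMap.ker_eq_bot, LinearMap.ker_eq_bot']
    intro v hv
    by_contra hne
    have h1 := hB v hne
    rw [show B v = 0 from hv] at h1
    exact lt_irrefl _ h1
  have hrank : Module.finrank ℝ E = Module.finrank ℝ (E →L[ℝ] ℝ) := by
    rw [LinearEquiv.finrank_eq (LinearMap.toContinuousLinearMap (𝕜 := ℝ) (E := E) (F' := ℝ)).symm]
    exact (Subspace.dual_finrank_eq (K := ℝ) (V := E)).symm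
  refine ⟨(LinearEquiv.ofInjectiveOfFinrankEq (B : E →ₗ[ℝ] E →L[ℝ] ℝ) hinj
    hrank).toContinuousLinearEquiv, ?_⟩
  ext; rfl

namespace IsMetricOn

variable {G : E → E →L[ℝ] E →L[ℝ] ℝ} {U : Set E} {m : ℕ∞ω}

theorem of_le (hG : IsMetricOn m G U) {n : ℕ∞ω} (hn : n ≤ m) : IsMetricOn n G U :=
  ⟨hG.isOpen, hG.contDiffOn.of_le hn, hG.symm, hG.pos⟩

theorem contDiffAt (hG : IsMetricOn m G U) {y : E} (hy : y ∈ U) : ContDiffAt ℝ m G y :=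
  hG.contDiffOn.contDiffAt (hG.isOpen.mem_nhds hy)

theorem fderiv_symm (hG : IsMetricOn m G U) (hm : m ≠ 0) {y : E} (hy : y ∈ U) (u v w : E) :
    fderiv ℝ G y u v w = fderiv ℝ G y u w v := by
  have hd := ((hG.contDiffAt hy).differentiableAt hm).hasFDerivAt
  have h1 (a b : E) : HasFDerivAt (fun z => G z a b)
      (((fderiv ℝ G y).flip a).flip b) y :=
    (hd.clm_apply (hasFDerivAt_const a y)).clm_apply (hasFDerivAt_const b y) |>.congr_fderiv
      (by ext; simp)
  have h2 : (fun z => G z v w) =ᶠ[𝓝 y] fun z => G z w v :=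
    (hG.isOpen.mem_nhds hy |> eventually_of_mem) fun z hz => hG.symm z hz v w
  have h3 := (h1 v w).unique ((h1 w v).congr_of_eventuallyEq h2)
  simpa using congrArg (fun A => A u) h3

variable [FiniteDimensional ℝ E]

/-- Positivity makes `G y` invertible, so `inverse` in `christoffel` is the true inverse and not the
default value `0`. -/
theorem apply_christoffel (hG : IsMetricOn m G U) {y : E} (hy : y ∈ U) (u v w : E) :
    G y (christoffel G y u v) w
      = 1 / 2 * (fderiv ℝ G y u v w + fderiv ℝ G y v u w - fderiv ℝ G y w u v) := by
  rw [← christoffelFirst_apply, christoffel]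
  obtain ⟨e, he⟩ := isInvertible_of_pos (hG.pos y hy)
  rw [← he, ContinuousLinearMap.inverse_equiv]
  simp

omit [FiniteDimensional ℝ E] in
theorem ext_of_apply (hG : IsMetricOn m G U) {y : E} (hy : y ∈ U) {u v : E}
    (h : ∀ w, G y u w = G y v w) : u = v := by
  by_contra hne
  have h1 := hG.pos y hy (u - v) (sub_ne_zero.2 hne)
  rw [(G y).map_sub, sub_apply, h, sub_self] at h1
  exact lt_irrefl _ h1

theorem christoffel_symm (hG : IsMetricOn m G U) (hm : m ≠ 0) {y : E} (hy : y ∈ U) (u v : E) :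
    christoffel G y u v = christoffel G y v u := by
  refine hG.ext_of_apply hy fun w => ?_
  rw [hG.apply_christoffel hy, hG.apply_christoffel hy, hG.fderiv_symm hm hy w u v]
  ring

/-- Metric compatibility: in the sum of the two Koszul expressions all terms cancel except the
derivative in the direction `u`, which appears twice with weight `1/2`. -/
theorem fderiv_apply (hG : IsMetricOn m G U) (hm : m ≠ 0) {y : E} (hy : y ∈ U) (u v w : E) :
    fderiv ℝ G y u v w
      = G y (christoffel G y u v) w + G y v (christoffel G y u w) := by
  rw [hG.symm y hy v, hG.apply_christoffel hy, hG.apply_christoffel hy, hG.fderiv_symm hm hy u w v,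
    hG.fderiv_symm hm hy w u v, hG.fderiv_symm hm hy v u w]
  ring

/-- The first-kind symbols are polynomial in the derivative of `G` and the vectors, and operator
inversion is regular at invertible operators. The condition `m + 1 ≤ m` says that differentiation
costs no regularity, as for `∞` and `ω`. -/
theorem contDiffOn_christoffel (hG : IsMetricOn m G U) (hm : m + 1 ≤ m) :
    ContDiffOn ℝ m (fun z : E × E × E => christoffel G z.1 z.2.1 z.2.2) (U ×ˢ univ) := by
  have := FiniteDimensional.complete ℝ E
  have hfst : ContDiffOn ℝ m (fun z : E × E × E => z.1) (U ×ˢ univ) := contDiff_fst.contDiffOn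
  have hmaps : MapsTo (fun z : E × E × E => z.1) (U ×ˢ univ) U := fun z hz => hz.1
  have hdG := (hG.contDiffOn.fderiv_of_isOpen hG.isOpen hm).comp hfst hmaps
  have h1 : ContDiffOn ℝ m (fun z : E × E × E => christoffelFirst G z.1 z.2.1 z.2.2)
      (U ×ˢ univ) := by
    rw [contDiffOn_clm_apply]
    intro w
    simp only [christoffelFirst_apply]
    have hu : ContDiffOn ℝ m (fun z : E × E × E => z.2.1) (U ×ˢ univ) := by fun_prop
    have hv : ContDiffOn ℝ m (fun z : E × E × E => z.2.2) (U ×ˢ univ) := by fun_prop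
    have hw : ContDiffOn ℝ m (fun _ : E × E × E => w) (U ×ˢ univ) := contDiffOn_const
    exact contDiffOn_const.mul (((((hdG.clm_apply hu).clm_apply hv).clm_apply hw).add
      (((hdG.clm_apply hv).clm_apply hu).clm_apply hw)).sub
      (((hdG.clm_apply hw).clm_apply hu).clm_apply hv))
  have h2 : ContDiffOn ℝ m (fun z : E × E × E => (G z.1).inverse) (U ×ˢ univ) := by
    intro z hz
    have h3 := (isInvertible_of_pos (hG.pos z.1 hz.1)).contDiffAt_map_inverse (n := m)
    exact h3.comp_contDiffWithinAt z ((hG.contDiffOn.comp hfst hmaps) z hz)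
  exact h2.clm_apply h1

end IsMetricOn

end Metric

/-! ### Covariant derivatives along curves and the symmetries of curvature -/

section Curvature

variable {E : Type*} [NormedAddCommGroup E] [NormedSpace ℝ E]
  {G : E → E →L[ℝ] E →L[ℝ] ℝ} {U : Set E}

/-- The vector field `V` along the curve `c` with velocity `T` has covariant derivative `W` at
time `t`. -/
def HasCovDerivAt (G : E → E →L[ℝ] E →L[ℝ] ℝ) (c T V : ℝ → E) (W : E) (t : ℝ) : Prop :=
  HasDerivAt V (W - christoffel G (c t) (T t) (V t)) t

namespace HasCovDerivAt

variable {c T V V₁ V₂ V₃ : ℝ → E} {W W₁ W₂ W₃ : E} {t : ℝ}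

theorem add (h₁ : HasCovDerivAt G c T V₁ W₁ t) (h₂ : HasCovDerivAt G c T V₂ W₂ t) :
    HasCovDerivAt G c T (fun s => V₁ s + V₂ s) (W₁ + W₂) t := by
  refine (HasDerivAt.add h₁ h₂).congr_deriv ?_
  rw [christoffel_add_right]
  abel

theorem smul {r : ℝ → ℝ} {r' : ℝ} (hr : HasDerivAt r r' t) (h : HasCovDerivAt G c T V W t) :
    HasCovDerivAt G c T (fun s => r s • V s) (r' • V t + r t • W) t := by
  refine (HasDerivAt.smul hr h).congr_deriv ?_
  rw [christoffel_smul_right, smul_sub]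
  abel

theorem unique (h₁ : HasCovDerivAt G c T V₁ W₁ t) (h₂ : HasCovDerivAt G c T V₂ W₂ t)
    (h : V₁ =ᶠ[𝓝 t] V₂) : W₁ = W₂ := by
  have h3 := HasDerivAt.unique h₁ (h₂.congr_of_eventuallyEq h)
  rwa [h.eq_of_nhds, sub_left_inj] at h3

end HasCovDerivAt

theorem hasCovDerivAt_of_hasDerivAt {c T V : ℝ → E} {V' : E} {t : ℝ} (h : HasDerivAt V V' t) :
    HasCovDerivAt G c T V (V' + christoffel G (c t) (T t) (V t)) t := by
  rw [HasCovDerivAt, add_sub_cancel_right]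
  exact h

variable [FiniteDimensional ℝ E]

namespace IsMetricOn

/-- From here on the curvature computations use smoothness only, also for analytic metrics. The
class `m` returns for the exponential map and for the regularity of the remainder. -/
theorem contDiffAt_christoffel (hG : IsMetricOn ∞ G U) {y : E} (hy : y ∈ U) (u v : E) :
    ContDiffAt ℝ ∞ (fun z : E × E × E => christoffel G z.1 z.2.1 z.2.2) (y, u, v) :=
  (hG.contDiffOn_christoffel le_rfl).contDiffAt
    ((hG.isOpen.prod isOpen_univ).mem_nhds ⟨hy, trivial⟩)

theorem differentiableAt_christoffel (hG : IsMetricOn ∞ G U) {y : E} (hy : y ∈ U) (u v : E) :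
    DifferentiableAt ℝ (fun z => christoffel G z u v) y :=
  DifferentiableAt.comp (g := fun z : E × E × E => christoffel G z.1 z.2.1 z.2.2) y
    ((hG.contDiffAt_christoffel hy u v).differentiableAt (by simp))
    (by fun_prop : DifferentiableAt ℝ (fun z : E => (z, u, v)) y)

theorem contDiffAt_christoffel_comp (hG : IsMetricOn ∞ G U) {c u v : ℝ → E} {t : ℝ}
    (hct : c t ∈ U) (hc : ContDiffAt ℝ ∞ c t) (hu : ContDiffAt ℝ ∞ u t)
    (hv : ContDiffAt ℝ ∞ v t) :
    ContDiffAt ℝ ∞ (fun s => christoffel G (c s) (u s) (v s)) t :=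
  ContDiffAt.comp (g := fun z : E × E × E => christoffel G z.1 z.2.1 z.2.2) t
    (hG.contDiffAt_christoffel hct (u t) (v t)) (hc.prodMk (hu.prodMk hv))

theorem hasDerivAt_christoffel (hG : IsMetricOn ∞ G U) {c u v : ℝ → E} {c' u' v' : E} {t : ℝ}
    (hct : c t ∈ U) (hc : HasDerivAt c c' t) (hu : HasDerivAt u u' t) (hv : HasDerivAt v v' t) :
    HasDerivAt (fun s => christoffel G (c s) (u s) (v s))
      (fderiv ℝ (fun y => christoffel G y (u t) (v t)) (c t) c'
        + christoffel G (c t) u' (v t) + christoffel G (c t) (u t) v') t :=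
  hasDerivAt_bilinear ((hG.contDiffAt_christoffel hct (u t) (v t)).differentiableAt (by simp))
    (fun a b w s => christoffel_add_smul_left G _ a b w s)
    (fun a b w s => christoffel_add_smul_right G _ a b w s) hc hu hv

theorem fderiv_christoffel_symm (hG : IsMetricOn ∞ G U) {y : E} (hy : y ∈ U) (u v w : E) :
    fderiv ℝ (fun z => christoffel G z u v) y w = fderiv ℝ (fun z => christoffel G z v u) y w := by
  have h : (fun z => christoffel G z u v) =ᶠ[𝓝 y] fun z => christoffel G z v u :=
    eventually_of_mem (hG.isOpen.mem_nhds hy) fun z hz => hG.christoffel_symm (by simp) hz u v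
  rw [h.fderiv_eq]

theorem fderiv_christoffel_left (hG : IsMetricOn ∞ G U) {y : E} (hy : y ∈ U) (a b w x : E)
    (s : ℝ) : fderiv ℝ (fun z => christoffel G z (a + s • b) w) y x
      = fderiv ℝ (fun z => christoffel G z a w) y x
        + s • fderiv ℝ (fun z => christoffel G z b w) y x := by
  simp only [christoffel_add_smul_left]
  have h := (hG.differentiableAt_christoffel hy a w).hasFDerivAt.add
    ((hG.differentiableAt_christoffel hy b w).hasFDerivAt.const_smul s)
  exact congrArg (fun A => A x) h.fderiv

theorem fderiv_christoffel_right (hG : IsMetricOn ∞ G U) {y : E} (hy : y ∈ U) (a b w x : E)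
    (s : ℝ) : fderiv ℝ (fun z => christoffel G z w (a + s • b)) y x
      = fderiv ℝ (fun z => christoffel G z w a) y x
        + s • fderiv ℝ (fun z => christoffel G z w b) y x := by
  simp only [christoffel_add_smul_right]
  have h := (hG.differentiableAt_christoffel hy w a).hasFDerivAt.add
    ((hG.differentiableAt_christoffel hy w b).hasFDerivAt.const_smul s)
  exact congrArg (fun A => A x) h.fderiv

set_option synthInstance.maxHeartbeats 400000 in
/-- Compatibility of the Levi-Civita connection with the metric, along a curve. -/
theorem hasDerivAt_inner (hG : IsMetricOn ∞ G U) {c T V₁ V₂ : ℝ → E} {W₁ W₂ : E} {t : ℝ}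
    (hct : c t ∈ U) (hc : HasDerivAt c (T t) t) (h₁ : HasCovDerivAt G c T V₁ W₁ t)
    (h₂ : HasCovDerivAt G c T V₂ W₂ t) :
    HasDerivAt (fun s => G (c s) (V₁ s) (V₂ s)) (G (c t) W₁ (V₂ t) + G (c t) (V₁ t) W₂) t := by
  have hd := ((hG.contDiffAt hct).differentiableAt (by simp)).hasFDerivAt
  refine (((hd.comp_hasDerivAt t hc).clm_apply h₁).clm_apply h₂).congr_deriv ?_
  simp only [Function.comp_apply, add_apply, (G (c t)).map_sub, ContinuousLinearMap.map_sub,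
    sub_apply, hG.fderiv_apply (by simp) hct]
  ring

theorem curvatureCoord_smul_add₁ (hG : IsMetricOn ∞ G U) {y : E} (hy : y ∈ U) (a b v w : E)
    (s : ℝ) : curvatureCoord G y (a + s • b) v w
      = curvatureCoord G y a v w + s • curvatureCoord G y b v w := by
  simp only [curvatureCoord]
  rw [hG.fderiv_christoffel_left hy, map_add, map_smul, christoffel_add_smul_left,
    christoffel_add_smul_left, christoffel_add_smul_right]
  module

omit [FiniteDimensional ℝ E] in
theorem curvatureCoord_antisymm (y u v w : E) :
    curvatureCoord G y u v w = -curvatureCoord G y v u w := by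
  simp only [curvatureCoord]
  abel

theorem curvatureCoord_smul_add₂ (hG : IsMetricOn ∞ G U) {y : E} (hy : y ∈ U) (a b v w : E)
    (s : ℝ) : curvatureCoord G y v (a + s • b) w
      = curvatureCoord G y v a w + s • curvatureCoord G y v b w := by
  rw [curvatureCoord_antisymm, hG.curvatureCoord_smul_add₁ hy, curvatureCoord_antisymm y a,
    curvatureCoord_antisymm y b]
  module

theorem curvatureCoord_smul_add₃ (hG : IsMetricOn ∞ G U) {y : E} (hy : y ∈ U) (a b v w : E)
    (s : ℝ) : curvatureCoord G y v w (a + s • b)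
      = curvatureCoord G y v w a + s • curvatureCoord G y v w b := by
  simp only [curvatureCoord]
  rw [hG.fderiv_christoffel_right hy, hG.fderiv_christoffel_right hy,
    christoffel_add_smul_right, christoffel_add_smul_right, christoffel_add_smul_right,
    christoffel_add_smul_right]
  module

/-- The partial derivative of `Γ` in the point is the full derivative of the joint map `Φ` in a
direction `(u, 0, 0)`, and in this form it is jointly smooth in the point and the vectors. -/
theorem contDiffAt_curvatureCoord (hG : IsMetricOn ∞ G U) {y : E} (hy : y ∈ U) (u v w : E) :
    ContDiffAt ℝ ∞ (fun z : E × E × E × E => curvatureCoord G z.1 z.2.1 z.2.2.1 z.2.2.2)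
      (y, u, v, w) := by
  let Φ : E × E × E → E := fun z => christoffel G z.1 z.2.1 z.2.2
  have hU : ∀ᶠ z in 𝓝 ((y, u, v, w) : E × E × E × E), z.1 ∈ U :=
    continuousAt_fst.preimage_mem_nhds (hG.isOpen.mem_nhds hy)
  have hΦ (p : E × E × E × E → E × E × E) (hp : ContDiffAt ℝ ∞ p (y, u, v, w))
      (hp1 : (p (y, u, v, w)).1 = y) : ContDiffAt ℝ ∞ (fun z => Φ (p z)) (y, u, v, w) := by
    refine ContDiffAt.comp (y, u, v, w) (g := Φ) ?_ hp
    exact hG.contDiffAt_christoffel (y := (p (y, u, v, w)).1) (by rw [hp1]; exact hy) _ _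
  have hdΦ (p q : E × E × E × E → E × E × E) (hp : ContDiffAt ℝ ∞ p (y, u, v, w))
      (hq : ContDiffAt ℝ ∞ q (y, u, v, w)) (hp1 : (p (y, u, v, w)).1 = y) :
      ContDiffAt ℝ ∞ (fun z => fderiv ℝ Φ (p z) (q z)) (y, u, v, w) := by
    refine ContDiffAt.clm_apply (ContDiffAt.comp (y, u, v, w) (g := fderiv ℝ Φ) ?_ hp) hq
    exact (hG.contDiffAt_christoffel (y := (p (y, u, v, w)).1) (by rw [hp1]; exact hy) _ _).fderiv_right le_rfl
  have h1 := hdΦ (fun z => (z.1, z.2.2.1, z.2.2.2)) (fun z => (z.2.1, 0, 0)) (by fun_prop)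
    (by fun_prop) rfl
  have h2 := hdΦ (fun z => (z.1, z.2.1, z.2.2.2)) (fun z => (z.2.2.1, 0, 0)) (by fun_prop)
    (by fun_prop) rfl
  have h3 := hΦ (fun z => (z.1, z.2.1, Φ (z.1, z.2.2.1, z.2.2.2)))
    (contDiffAt_fst.prodMk ((by fun_prop : ContDiffAt ℝ ∞ (fun z : E × E × E × E => z.2.1) _).prodMk
      (hΦ (fun z => (z.1, z.2.2.1, z.2.2.2)) (by fun_prop) rfl))) rfl
  have h4 := hΦ (fun z => (z.1, z.2.2.1, Φ (z.1, z.2.1, z.2.2.2)))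
    (contDiffAt_fst.prodMk ((by fun_prop : ContDiffAt ℝ ∞ (fun z : E × E × E × E => z.2.2.1) _).prodMk
      (hΦ (fun z => (z.1, z.2.1, z.2.2.2)) (by fun_prop) rfl))) rfl
  refine (((h1.sub h2).add h3).sub h4).congr_of_eventuallyEq ?_
  filter_upwards [hU] with z hz
  have hd (a b : E) : DifferentiableAt ℝ Φ (z.1, a, b) :=
    (hG.contDiffAt_christoffel hz a b).differentiableAt (by simp)
  change _ = fderiv ℝ Φ (z.1, z.2.2.1, z.2.2.2) (z.2.1, 0)
    - fderiv ℝ Φ (z.1, z.2.1, z.2.2.2) (z.2.2.1, 0) + _ - _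
  rw [fderiv_prodMk_right (hd _ _), fderiv_prodMk_right (hd _ _)]
  rfl

/-- The Leibniz rule defining the covariant derivative of the curvature tensor. -/
theorem hasCovDerivAt_curvatureCoord (hG : IsMetricOn ∞ G U) {c T V₁ V₂ V₃ : ℝ → E}
    {W₁ W₂ W₃ : E} {t : ℝ} (hct : c t ∈ U) (hc : HasDerivAt c (T t) t)
    (h₁ : HasCovDerivAt G c T V₁ W₁ t) (h₂ : HasCovDerivAt G c T V₂ W₂ t)
    (h₃ : HasCovDerivAt G c T V₃ W₃ t) :
    HasCovDerivAt G c T (fun s => curvatureCoord G (c s) (V₁ s) (V₂ s) (V₃ s))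
      (covDerivCurvatureCoord G (c t) (T t) (V₁ t) (V₂ t) (V₃ t)
        + curvatureCoord G (c t) W₁ (V₂ t) (V₃ t) + curvatureCoord G (c t) (V₁ t) W₂ (V₃ t)
        + curvatureCoord G (c t) (V₁ t) (V₂ t) W₃) t := by
  have h := hasDerivAt_trilinear (T := curvatureCoord G)
    ((hG.contDiffAt_curvatureCoord hct (V₁ t) (V₂ t) (V₃ t)).differentiableAt (by simp))
    (fun a b x y s => hG.curvatureCoord_smul_add₁ hct a b x y s)
    (fun a b x y s => hG.curvatureCoord_smul_add₂ hct a b x y s)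
    (fun a b x y s => hG.curvatureCoord_smul_add₃ hct a b x y s) hc h₁ h₂ h₃
  refine h.congr_deriv ?_
  -- The corrections `-Γ(T, Vᵢ)` in the derivatives of the three fields produce the Christoffel
  -- terms in the definition of `∇R`.
  have e (a b : E) : a - b = a + (-1 : ℝ) • b := by module
  rw [e W₁, e W₂, e W₃, hG.curvatureCoord_smul_add₁ hct, hG.curvatureCoord_smul_add₂ hct,
    hG.curvatureCoord_smul_add₃ hct, covDerivCurvatureCoord]
  module

/-- The connection is torsion free: by the symmetry of `Γ` and of its derivatives, the cyclic sum
cancels term by term. -/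
theorem bianchi (hG : IsMetricOn ∞ G U) {y : E} (hy : y ∈ U) (u v w : E) :
    curvatureCoord G y u v w + curvatureCoord G y v w u + curvatureCoord G y w u v = 0 := by
  have hs := hG.christoffel_symm (by simp) hy
  simp only [curvatureCoord]
  rw [hG.fderiv_christoffel_symm hy v w u, hG.fderiv_christoffel_symm hy w u v,
    hG.fderiv_christoffel_symm hy u v w, hs v w, hs w u, hs u v]
  abel

omit [FiniteDimensional ℝ E] in
/-- A curve through `y` along which the given vectors extend to fields with vanishing covariant
derivative at `y`. -/
theorem hasCovDerivAt_line (y u v : E) :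
    HasCovDerivAt G (fun s : ℝ => y + s • u) (fun _ => u)
      (fun s : ℝ => v + s • (-christoffel G y u v)) 0 0 := by
  have h := hasDerivAt_add_smul v (-christoffel G y u v) 0
  rw [HasCovDerivAt]
  simpa using h

/-- The second derivative of the function `G(w, z)` is symmetric. Expanded by metric compatibility,
its antisymmetric part is `G(R(u, v)w, z) + G(w, R(u, v)z)`, the mixed terms `G(∇w, ∇z)` cancelling.
-/
theorem curvatureCoord_skew (hG : IsMetricOn ∞ G U) {y : E} (hy : y ∈ U) (u v w z : E) :
    G y (curvatureCoord G y u v w) z = - G y w (curvatureCoord G y u v z) := by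
  let q : E → ℝ := fun x => G x w z
  have hq : ContDiffAt ℝ 2 q y :=
    (((hG.contDiffAt hy).of_le (by exact WithTop.coe_le_coe.2 le_top)).clm_apply
      contDiffAt_const).clm_apply contDiffAt_const
  have hq1 (x : E) (hx : x ∈ U) (a : E) :
      fderiv ℝ q x a = G x (christoffel G x a w) z + G x w (christoffel G x a z) := by
    have hd := ((hG.contDiffAt hx).differentiableAt (by simp)).hasFDerivAt
    have h1 := (hd.clm_apply (hasFDerivAt_const w x)).clm_apply (hasFDerivAt_const z x)
    rw [← hG.fderiv_apply (by simp) hx, h1.fderiv]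
    simp
  have hq2 (a b : E) : fderiv ℝ (fderiv ℝ q) y a b
      = G y (fderiv ℝ (fun x => christoffel G x b w) y a + christoffel G y a (christoffel G y b w)) z
        + G y (christoffel G y b w) (christoffel G y a z)
        + (G y (christoffel G y a w) (christoffel G y b z)
        + G y w (fderiv ℝ (fun x => christoffel G x b z) y a
          + christoffel G y a (christoffel G y b z))) := by
    have hline : HasDerivAt (fun s : ℝ => y + s • a) a 0 := hasDerivAt_add_smul y a 0
    have hc0 : y + (0 : ℝ) • a = y := by simp
    have hct : (fun s : ℝ => y + s • a) 0 ∈ U := by simpa using hy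
    have h1 : HasDerivAt (fun s : ℝ => fderiv ℝ q (y + s • a) b) (fderiv ℝ (fderiv ℝ q) y a b) 0 := by
      have := hasDerivAt_fderiv_apply (f := q) (c := fun s : ℝ => y + s • a) (t := 0)
        (by simpa using hq) hline (hasDerivAt_const 0 b)
      simpa using this
    have hV (x : E) : HasCovDerivAt G (fun s : ℝ => y + s • a) (fun _ => a) (fun _ => x)
        (christoffel G y a x) 0 := by
      have := hasCovDerivAt_of_hasDerivAt (G := G) (c := fun s : ℝ => y + s • a) (T := fun _ => a)
        (hasDerivAt_const (0 : ℝ) x)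
      simpa using this
    have hΓ (x : E) : HasCovDerivAt G (fun s : ℝ => y + s • a) (fun _ => a)
        (fun s => christoffel G (y + s • a) b x)
        (fderiv ℝ (fun z => christoffel G z b x) y a + christoffel G y a (christoffel G y b x)) 0 := by
      have h3 := hG.hasDerivAt_christoffel hct hline (hasDerivAt_const 0 b) (hasDerivAt_const 0 x)
      have := hasCovDerivAt_of_hasDerivAt (G := G) (c := fun s : ℝ => y + s • a) (T := fun _ => a) h3
      simpa using this
    have h2 := (hG.hasDerivAt_inner hct hline (hΓ w) (hV z)).add
      (hG.hasDerivAt_inner hct hline (hV w) (hΓ z))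
    simp only [hc0] at h2
    refine h1.unique (h2.congr_of_eventuallyEq ?_)
    have hev : ∀ᶠ s : ℝ in 𝓝 0, y + s • a ∈ U :=
      hline.continuousAt.preimage_mem_nhds (hG.isOpen.mem_nhds hct)
    filter_upwards [hev] with s hs
    simpa using hq1 _ hs b
  have hsymm : fderiv ℝ (fderiv ℝ q) y u v = fderiv ℝ (fderiv ℝ q) y v u :=
    (hq.isSymmSndFDerivAt (by simp)).eq u v
  rw [hq2, hq2] at hsymm
  simp only [curvatureCoord, (G y).map_add, (G y).map_sub, ContinuousLinearMap.map_add,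
    ContinuousLinearMap.map_sub, add_apply, sub_apply] at hsymm ⊢
  linarith

/-- Self-adjointness of `a ↦ R(x, a)x`, the only case of pair symmetry needed. Pair the Bianchi
identity for `x, a, b` with `x`: the term `G(R(a, b)x, x)` vanishes by skewness, which also converts
the other two. -/
theorem curvatureCoord_pair_symm (hG : IsMetricOn ∞ G U) {y : E} (hy : y ∈ U) (x a b : E) :
    G y (curvatureCoord G y x a x) b = G y (curvatureCoord G y x b x) a := by
  have h1 := congrArg (fun v => G y v x) (hG.bianchi hy x a b)
  simp only [(G y).map_add, add_apply, map_zero, zero_apply] at h1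
  have h2 := hG.curvatureCoord_skew hy a b x x
  rw [hG.symm y hy x] at h2
  have h3 := hG.curvatureCoord_skew hy x a b x
  have h4 := hG.curvatureCoord_skew hy b x a x
  have h5 : G y (curvatureCoord G y b x x) a = - G y (curvatureCoord G y x b x) a := by
    rw [curvatureCoord_antisymm y b x x, (G y).map_neg, neg_apply]
  rw [hG.symm y hy b] at h3
  rw [hG.symm y hy a, h5] at h4
  linarith

/-- The previous symmetry is differentiated along a line through `y`, with the vectors extended to
have zero covariant derivative at `y`, so that only the `∇R` term survives. -/
theorem covDerivCurvatureCoord_pair_symm (hG : IsMetricOn ∞ G U) {y : E} (hy : y ∈ U)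
    (u x a b : E) : G y (covDerivCurvatureCoord G y u x a x) b
      = G y (covDerivCurvatureCoord G y u x b x) a := by
  let c : ℝ → E := fun s => y + s • u
  let ext : E → ℝ → E := fun v s => v + s • (-christoffel G y u v)
  have hc0 : c 0 = y := by simp [c]
  have hext0 (v : E) : ext v 0 = v := by simp [ext]
  have hline : HasDerivAt c u 0 := hasDerivAt_add_smul y u 0
  have hct : c 0 ∈ U := by rwa [hc0]
  have hd (a b : E) : HasDerivAt
      (fun s => G (c s) (curvatureCoord G (c s) (ext x s) (ext a s) (ext x s)) (ext b s))
      (G y (covDerivCurvatureCoord G y u x a x) b) 0 := by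
    have h1 := hG.hasCovDerivAt_curvatureCoord (T := fun _ => u) hct hline
      (hasCovDerivAt_line y u x) (hasCovDerivAt_line y u a) (hasCovDerivAt_line y u x)
    have h2 := hG.hasDerivAt_inner hct hline h1 (hasCovDerivAt_line y u b)
    have z1 (v w : E) : curvatureCoord G y 0 v w = 0 := by
      simpa using hG.curvatureCoord_smul_add₁ hy 0 0 v w 1
    have z2 (v w : E) : curvatureCoord G y v 0 w = 0 := by
      simpa using hG.curvatureCoord_smul_add₂ hy 0 0 v w 1
    have z3 (v w : E) : curvatureCoord G y v w 0 = 0 := by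
      simpa using hG.curvatureCoord_smul_add₃ hy 0 0 v w 1
    refine h2.congr_deriv ?_
    simp [c, z1, z2, z3]
  refine (hd a b).unique ((hd b a).congr_of_eventuallyEq ?_)
  have hev : ∀ᶠ s : ℝ in 𝓝 0, c s ∈ U :=
    hline.continuousAt.preimage_mem_nhds (hG.isOpen.mem_nhds hct)
  filter_upwards [hev] with s hs
  exact hG.curvatureCoord_pair_symm hs _ _ _

end IsMetricOn

end Curvature

/-! ### The Jacobi equation and the radial derivatives of the metric -/

section Jacobi

variable {E : Type*} [NormedAddCommGroup E] [NormedSpace ℝ E]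
  {G : E → E →L[ℝ] E →L[ℝ] ℝ} {U : Set E}

/-- The covariant derivative of the vector field `V` along the curve `c` with velocity `T`. -/
def covDeriv (G : E → E →L[ℝ] E →L[ℝ] ℝ) (c T V : ℝ → E) (t : ℝ) : E :=
  deriv V t + christoffel G (c t) (T t) (V t)

theorem hasCovDerivAt_covDeriv {c T V : ℝ → E} {t : ℝ} (h : DifferentiableAt ℝ V t) :
    HasCovDerivAt G c T V (covDeriv G c T V t) t :=
  hasCovDerivAt_of_hasDerivAt h.hasDerivAt

theorem HasCovDerivAt.covDeriv_eq {c T V : ℝ → E} {W : E} {t : ℝ}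
    (h : HasCovDerivAt G c T V W t) : covDeriv G c T V t = W := by
  rw [covDeriv, HasDerivAt.deriv h, sub_add_cancel]

theorem contDiffAt_deriv {V : ℝ → E} {t : ℝ} (h : ContDiffAt ℝ ∞ V t) :
    ContDiffAt ℝ ∞ (deriv V) t := by
  have h1 : ContDiffAt ℝ ∞ (fun s => fderiv ℝ V s 1) t :=
    (h.fderiv_right (m := ∞) le_rfl).clm_apply contDiffAt_const
  exact h1.congr_of_eventuallyEq (Eventually.of_forall fun s => fderiv_apply_one_eq_deriv.symm)

theorem fderiv_fderiv_symm {F : Type*} [NormedAddCommGroup F] [NormedSpace ℝ F] {f : E → F} {z : E}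
    (hf : ContDiffAt ℝ ∞ f z) (u v : E) :
    fderiv ℝ (fderiv ℝ f) z u v = fderiv ℝ (fderiv ℝ f) z v u :=
  ((hf.of_le (WithTop.coe_le_coe.2 le_top : (2 : ℕ∞ω) ≤ ∞)).isSymmSndFDerivAt (by simp)).eq u v

theorem fderiv_fderiv_fderiv_symm_left {F : Type*} [NormedAddCommGroup F] [NormedSpace ℝ F]
    {f : E → F} {z : E} (hf : ContDiffAt ℝ ∞ f z) (u v w : E) :
    fderiv ℝ (fderiv ℝ (fderiv ℝ f)) z u v w = fderiv ℝ (fderiv ℝ (fderiv ℝ f)) z v u w :=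
  congrArg (fun A => A w) (fderiv_fderiv_symm (hf.fderiv_right (m := ∞) le_rfl) u v)

/-- The second derivative is symmetric on a neighbourhood of `z`, so the symmetry can be
differentiated in the direction `u`. -/
theorem fderiv_fderiv_fderiv_symm_right {F : Type*} [NormedAddCommGroup F] [NormedSpace ℝ F]
    {f : E → F} {z : E} (hf : ContDiffAt ℝ ∞ f z) (u v w : E) :
    fderiv ℝ (fderiv ℝ (fderiv ℝ f)) z u v w = fderiv ℝ (fderiv ℝ (fderiv ℝ f)) z u w v := by
  have h3 : ContDiffAt ℝ 3 f (z + (0 : ℝ) • u) := by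
    rw [zero_smul, add_zero]
    exact hf.of_le (WithTop.coe_le_coe.2 le_top : (3 : ℕ∞ω) ≤ ∞)
  have hd (a b : E) : HasDerivAt (fun s : ℝ => fderiv ℝ (fderiv ℝ f) (z + s • u) a b)
      (fderiv ℝ (fderiv ℝ (fderiv ℝ f)) z u a b) 0 := by
    have h := hasDerivAt_fderiv_fderiv_apply h3 (hasDerivAt_add_smul z u 0)
      (hasDerivAt_const 0 a) (hasDerivAt_const 0 b)
    simpa using h
  refine (hd v w).unique ((hd w v).congr_of_eventuallyEq ?_)
  have hc : ContinuousAt (fun s : ℝ => z + s • u) 0 := (hasDerivAt_add_smul z u 0).continuousAt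
  have hev : ∀ᶠ y in 𝓝 z, ContDiffAt ℝ (3 : ℕ) f y :=
    (hf.of_le (WithTop.coe_le_coe.2 le_top)).eventually (by simp)
  have hc0 : Tendsto (fun s : ℝ => z + s • u) (𝓝 0) (𝓝 z) := by
    simpa [ContinuousAt] using hc
  filter_upwards [hc0.eventually hev] with s hs
  exact ((hs.of_le (by norm_cast : (2 : ℕ∞ω) ≤ (3 : ℕ))).isSymmSndFDerivAt (by simp)).eq v w

/-- `f` parametrizes the geodesics `t ↦ f (t • v)` of the metric `G` on `U` through `f 0`. -/
structure IsExponentialOn (G : E → E →L[ℝ] E →L[ℝ] ℝ) (U : Set E) (f : E → E) (ρ : ℝ) : Prop where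
  mapsTo : ∀ v ∈ Metric.ball (0 : E) ρ, f v ∈ U
  contDiffAt : ∀ v ∈ Metric.ball (0 : E) ρ, ContDiffAt ℝ ∞ f v
  geodesic : ∀ (v : E) (t : ℝ), t • v ∈ Metric.ball (0 : E) ρ →
    fderiv ℝ (fderiv ℝ f) (t • v) v v
      + christoffel G (f (t • v)) (fderiv ℝ f (t • v) v) (fderiv ℝ f (t • v) v) = 0

variable [FiniteDimensional ℝ E]

theorem IsMetricOn.contDiffAt_covDeriv (hG : IsMetricOn ∞ G U) {c T V : ℝ → E} {t : ℝ}
    (hct : c t ∈ U) (hc : ContDiffAt ℝ ∞ c t) (hT : ContDiffAt ℝ ∞ T t)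
    (hV : ContDiffAt ℝ ∞ V t) : ContDiffAt ℝ ∞ (covDeriv G c T V) t :=
  (contDiffAt_deriv hV).add (hG.contDiffAt_christoffel_comp hct hc hT hV)

theorem IsMetricOn.contDiffAt_curvatureCoord_comp (hG : IsMetricOn ∞ G U) {c u v w : ℝ → E} {t : ℝ}
    (hct : c t ∈ U) (hc : ContDiffAt ℝ ∞ c t) (hu : ContDiffAt ℝ ∞ u t)
    (hv : ContDiffAt ℝ ∞ v t) (hw : ContDiffAt ℝ ∞ w t) :
    ContDiffAt ℝ ∞ (fun s => curvatureCoord G (c s) (u s) (v s) (w s)) t := by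
  have h1 : ContDiffAt ℝ ∞ (fun s => (c s, u s, v s, w s)) t :=
    hc.prodMk (hu.prodMk (hv.prodMk hw))
  have h2 := hG.contDiffAt_curvatureCoord hct (u t) (v t) (w t)
  generalize hΦ : (fun z : E × E × E × E => curvatureCoord G z.1 z.2.1 z.2.2.1 z.2.2.2) = Φ at h2
  have h3 : ContDiffAt ℝ ∞ (fun s => Φ (c s, u s, v s, w s)) t := ContDiffAt.comp t h2 h1
  rw [← hΦ] at h3
  exact h3

namespace IsExponentialOn

variable {f : E → E} {ρ : ℝ} {x : E} {t : ℝ}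

/-- The linearization of the geodesic equation. -/
theorem variation (hG : IsMetricOn ∞ G U) (hf : IsExponentialOn G U f ρ)
    (ht : t • x ∈ Metric.ball (0 : E) ρ) (a : E) :
    t • fderiv ℝ (fderiv ℝ (fderiv ℝ f)) (t • x) x x a + (2 : ℝ) • fderiv ℝ (fderiv ℝ f) (t • x) x a
      + (t • fderiv ℝ (fun y => christoffel G y (fderiv ℝ f (t • x) x) (fderiv ℝ f (t • x) x))
          (f (t • x)) (fderiv ℝ f (t • x) a)
        + (2 : ℝ) • christoffel G (f (t • x)) (fderiv ℝ f (t • x) x)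
          (t • fderiv ℝ (fderiv ℝ f) (t • x) x a + fderiv ℝ f (t • x) a)) = 0 := by
  have hsm := hf.contDiffAt _ ht
  have h0 : t • (x + (0 : ℝ) • a) = t • x := by simp
  have hl : HasDerivAt (fun s : ℝ => x + s • a) a 0 := hasDerivAt_add_smul x a 0
  have hc : HasDerivAt (fun s : ℝ => t • (x + s • a)) (t • a) 0 := hl.const_smul t
  have h3 : ContDiffAt ℝ 3 f (t • (x + (0 : ℝ) • a)) := by
    rw [h0]; exact hsm.of_le (WithTop.coe_le_coe.2 le_top : (3 : ℕ∞ω) ≤ ∞)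
  have h2 : ContDiffAt ℝ 2 f (t • (x + (0 : ℝ) • a)) := h3.of_le (by norm_cast)
  have hd1 := hasDerivAt_fderiv_fderiv_apply h3 hc hl hl
  have hu := hasDerivAt_fderiv_apply h2 hc hl
  have hfc := (h2.differentiableAt (by simp)).hasFDerivAt.comp_hasDerivAt 0 hc
  have hmem : (f ∘ fun s : ℝ => t • (x + s • a)) 0 ∈ U := by
    simpa using hf.mapsTo _ ht
  have hd2 := hG.hasDerivAt_christoffel hmem hfc hu hu
  have hd := hd1.add hd2
  -- The geodesic equation at time `t` with initial velocity `x + s • a` holds for all small `s`, so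
  -- its derivative at `s = 0` vanishes.
  have hz : (fun s : ℝ => fderiv ℝ (fderiv ℝ f) (t • (x + s • a)) (x + s • a) (x + s • a)
      + christoffel G ((f ∘ fun s : ℝ => t • (x + s • a)) s)
        (fderiv ℝ f (t • (x + s • a)) (x + s • a)) (fderiv ℝ f (t • (x + s • a)) (x + s • a)))
      =ᶠ[𝓝 0] fun _ => 0 := by
    have hev : ∀ᶠ s : ℝ in 𝓝 0, t • (x + s • a) ∈ Metric.ball (0 : E) ρ :=
      hc.continuousAt.preimage_mem_nhds (Metric.isOpen_ball.mem_nhds (by rwa [h0]))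
    filter_upwards [hev] with s hs
    exact hf.geodesic _ _ hs
  have key := hd.unique ((hasDerivAt_const 0 0).congr_of_eventuallyEq hz)
  simp only [Function.comp_apply, zero_smul, add_zero] at key
  have hU := hf.mapsTo _ ht
  rw [map_smul, smul_apply, smul_apply, map_smul, map_smul, map_smul, smul_apply,
    fderiv_fderiv_fderiv_symm_left hsm a x x, fderiv_fderiv_fderiv_symm_right hsm x a x,
    fderiv_fderiv_symm hsm a x,
    hG.christoffel_symm (by simp) hU _ (fderiv ℝ f (t • x) x)] at key
  rw [← key]
  module

omit [FiniteDimensional ℝ E] in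
variable (x) in
theorem eventually_mem (hρ : 0 < ρ) : ∀ᶠ t : ℝ in 𝓝 0, t • x ∈ Metric.ball (0 : E) ρ := by
  have h : ContinuousAt (fun t : ℝ => t • x) 0 := by fun_prop
  exact h.preimage_mem_nhds (Metric.isOpen_ball.mem_nhds (by simpa using hρ))

/-- The Jacobi equation for the variation fields of the family of geodesics, multiplied by `t` and
integrated once. -/
theorem jacobi (hG : IsMetricOn ∞ G U) (hf : IsExponentialOn G U f ρ)
    (ht : t • x ∈ Metric.ball (0 : E) ρ) (a : E) {c T K L : ℝ → E}
    (hc : c = fun t : ℝ => f (t • x)) (hT : T = fun t : ℝ => fderiv ℝ f (t • x) x)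
    (hK : K = fun t : ℝ => fderiv ℝ f (t • x) a) (hL : L = covDeriv G c T K) :
    ContDiffAt ℝ ∞ c t ∧ ContDiffAt ℝ ∞ T t ∧ ContDiffAt ℝ ∞ K t ∧ HasDerivAt c (T t) t ∧
      HasCovDerivAt G c T T 0 t ∧
      t • covDeriv G c T L t + (2 : ℝ) • L t = t • curvatureCoord G (c t) (T t) (K t) (T t) := by
  have hsm := hf.contDiffAt _ ht
  have hU := hf.mapsTo _ ht
  have hr : HasDerivAt (fun s : ℝ => s • x) x t := by simpa using (hasDerivAt_id t).smul_const x
  have hrs : ContDiffAt ℝ ∞ (fun s : ℝ => s • x) t := by fun_prop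
  have h3 : ContDiffAt ℝ 3 f (t • x) := hsm.of_le (WithTop.coe_le_coe.2 le_top : (3 : ℕ∞ω) ≤ ∞)
  have h2 : ContDiffAt ℝ 2 f (t • x) := h3.of_le (by norm_cast)
  have hcs : ContDiffAt ℝ ∞ c t := hc ▸ ContDiffAt.comp (g := f) t hsm hrs
  have hfs (b : E) : ContDiffAt ℝ ∞ (fun s : ℝ => fderiv ℝ f (s • x) b) t :=
    (ContDiffAt.comp (g := fderiv ℝ f) t (hsm.fderiv_right (m := ∞) le_rfl) hrs).clm_apply
      contDiffAt_const
  have hTs : ContDiffAt ℝ ∞ T t := hT ▸ hfs x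
  have hKs : ContDiffAt ℝ ∞ K t := hK ▸ hfs a
  have hcd : HasDerivAt c (T t) t := by
    subst hc hT; exact (h2.differentiableAt (by simp)).hasFDerivAt.comp_hasDerivAt t hr
  have hfd (b : E) : HasDerivAt (fun s : ℝ => fderiv ℝ f (s • x) b)
      (fderiv ℝ (fderiv ℝ f) (t • x) x b) t := by
    simpa using hasDerivAt_fderiv_apply h2 hr (hasDerivAt_const t b)
  have hT' : T t = fderiv ℝ f (t • x) x := by rw [hT]
  have hK' : K t = fderiv ℝ f (t • x) a := by rw [hK]
  have hc' : c t = f (t • x) := by rw [hc]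
  have hTd : HasDerivAt T (fderiv ℝ (fderiv ℝ f) (t • x) x x) t := hT ▸ hfd x
  have hKd : HasDerivAt K (fderiv ℝ (fderiv ℝ f) (t • x) x a) t := hK ▸ hfd a
  have hgeo : fderiv ℝ (fderiv ℝ f) (t • x) x x = -christoffel G (c t) (T t) (T t) := by
    rw [hT', hc']; exact eq_neg_of_add_eq_zero_left (hf.geodesic x t ht)
  have hTc : HasCovDerivAt G c T T 0 t := by
    rw [HasCovDerivAt, zero_sub, ← hgeo]; exact hTd
  refine ⟨hcs, hTs, hKs, hcd, hTc, ?_⟩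
  have hct : c t ∈ U := hc' ▸ hU
  have hLt : L t = fderiv ℝ (fderiv ℝ f) (t • x) x a + christoffel G (c t) (T t) (K t) := by
    rw [hL, covDeriv, hKd.deriv]
  -- The formula for `L` is needed on a neighbourhood of `t`, since it is differentiated once more.
  have hLev : L =ᶠ[𝓝 t] fun s => fderiv ℝ (fderiv ℝ f) (s • x) x a
      + christoffel G (c s) (T s) (K s) := by
    have hev : ∀ᶠ s : ℝ in 𝓝 t, s • x ∈ Metric.ball (0 : E) ρ :=
      hr.continuousAt.preimage_mem_nhds (Metric.isOpen_ball.mem_nhds ht)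
    filter_upwards [hev] with s hs
    have h2 : ContDiffAt ℝ 2 f (s • x) :=
      (hf.contDiffAt _ hs).of_le (WithTop.coe_le_coe.2 le_top : (2 : ℕ∞ω) ≤ ∞)
    have hd : HasDerivAt K (fderiv ℝ (fderiv ℝ f) (s • x) x a) s := by
      have hr : HasDerivAt (fun s : ℝ => s • x) x s := by
        simpa using (hasDerivAt_id s).smul_const x
      rw [hK]
      simpa using hasDerivAt_fderiv_apply h2 hr (hasDerivAt_const s a)
    rw [hL, covDeriv, hd.deriv]
  have hLd : HasDerivAt L (fderiv ℝ (fderiv ℝ (fderiv ℝ f)) (t • x) x x a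
      + (fderiv ℝ (fun y => christoffel G y (T t) (K t)) (c t) (T t)
        + christoffel G (c t) (-christoffel G (c t) (T t) (T t)) (K t)
        + christoffel G (c t) (T t) (fderiv ℝ (fderiv ℝ f) (t • x) x a))) t := by
    have hd3 := hasDerivAt_fderiv_fderiv_apply h3 hr (hasDerivAt_const t x) (hasDerivAt_const t a)
    simp only [map_zero, zero_apply, add_zero] at hd3
    have hΓ := hG.hasDerivAt_christoffel hct hcd hTd hKd
    rw [hgeo] at hΓ
    exact (hd3.add hΓ).congr_of_eventuallyEq hLev
  have hvar := variation hG hf ht a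
  rw [← hT', ← hK', ← hc'] at hvar
  rw [covDeriv, hLd.deriv, hLt, curvatureCoord, hG.fderiv_christoffel_symm hct (K t) (T t),
    hG.christoffel_symm (by simp) hct (K t) (T t), hG.christoffel_symm (by simp) hct (K t)]
  simp only [christoffel_add_right, christoffel_smul_right, christoffel_neg_left] at hvar ⊢
  -- With the symmetries of `Γ` inserted, the difference of the two sides is exactly the left side
  -- of the linearized geodesic equation.
  rw [← sub_eq_zero, ← hvar]
  module

/-- The covariant derivatives at `t = 0` of the variation fields of the family of geodesics. -/
theorem covDeriv_variation_zero (hG : IsMetricOn ∞ G U) (hf : IsExponentialOn G U f ρ) (hρ : 0 < ρ)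
    (hf' : HasFDerivAt f (ContinuousLinearMap.id ℝ E) 0) (a : E) {c T K L : ℝ → E}
    (hc : c = fun t : ℝ => f (t • x)) (hT : T = fun t : ℝ => fderiv ℝ f (t • x) x)
    (hK : K = fun t : ℝ => fderiv ℝ f (t • x) a) (hL : L = covDeriv G c T K) :
    L 0 = 0 ∧ covDeriv G c T L 0 = (1 / 3 : ℝ) • curvatureCoord G (f 0) x a x ∧
      covDeriv G c T (covDeriv G c T L) 0
        = (1 / 2 : ℝ) • covDerivCurvatureCoord G (f 0) x x a x := by
  have hev := eventually_mem x hρ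
  have hc0 : c 0 = f 0 := by simp [hc]
  have hT0 : T 0 = x := by simp [hT, hf'.fderiv]
  have hK0 : K 0 = a := by simp [hK, hf'.fderiv]
  let S : ℝ → E := fun t => curvatureCoord G (c t) (T t) (K t) (T t)
  let M := covDeriv G c T L
  let N := covDeriv G c T M
  have hsmooth {t : ℝ} (ht : t • x ∈ Metric.ball (0 : E) ρ) :
      ContDiffAt ℝ ∞ K t ∧ ContDiffAt ℝ ∞ L t ∧ ContDiffAt ℝ ∞ M t ∧ ContDiffAt ℝ ∞ N t
        ∧ ContDiffAt ℝ ∞ S t := by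
    obtain ⟨h1, h2, h3, -, -, -⟩ := jacobi hG hf ht a hc hT hK hL
    have hU : c t ∈ U := by rw [hc]; exact hf.mapsTo _ ht
    have hL' : ContDiffAt ℝ ∞ L t := hL ▸ hG.contDiffAt_covDeriv hU h1 h2 h3
    have hM := hG.contDiffAt_covDeriv hU h1 h2 hL'
    refine ⟨h3, hL', hM, hG.contDiffAt_covDeriv hU h1 h2 hM, ?_⟩
    exact hG.contDiffAt_curvatureCoord_comp hU h1 h2 h3 h2
  have hcov {V : ℝ → E} {t : ℝ} (hV : ContDiffAt ℝ ∞ V t) :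
      HasCovDerivAt G c T V (covDeriv G c T V t) t :=
    hasCovDerivAt_covDeriv (hV.differentiableAt (by simp))
  have hmem0 : (0 : ℝ) • x ∈ Metric.ball (0 : E) ρ := by simpa using hρ
  obtain ⟨hK0', hL0, hM0, hN0, hS0⟩ := hsmooth hmem0
  obtain ⟨-, -, -, hcd, hTc, hj0⟩ := jacobi hG hf hmem0 a hc hT hK hL
  -- At `t = 0` the equation `t M + 2 L = t S` reduces to `2 L(0) = 0`.
  have hLz : L 0 = 0 := by simpa using hj0
  have e0 : (fun t => t • M t + (2 : ℝ) • L t) =ᶠ[𝓝 0] fun t => t • S t := by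
    filter_upwards [hev] with t ht
    exact (jacobi hG hf ht a hc hT hK hL).2.2.2.2.2
  have hconst (r t : ℝ) : HasDerivAt (fun _ : ℝ => r) 0 t := hasDerivAt_const t r
  -- The covariant derivative of `t M + 2 L = t S`, valid near `0` so that it can be differentiated
  -- again; at `t = 0` it gives `3 M(0) = S(0)`.
  have e1 : ∀ᶠ t : ℝ in 𝓝 0, (3 : ℝ) • M t + t • N t = S t + t • covDeriv G c T S t := by
    filter_upwards [hev, e0.eventually_nhds] with t ht h0
    obtain ⟨-, hL', hM', hN', hS'⟩ := hsmooth ht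
    have h1 := (HasCovDerivAt.smul (hasDerivAt_id t) (hcov hM')).add ((hcov hL').smul (hconst 2 t))
    have h2 := h1.unique (HasCovDerivAt.smul (hasDerivAt_id t) (hcov hS')) h0
    have hL2 : covDeriv G c T L t = M t := rfl
    have hM2 : covDeriv G c T M t = N t := rfl
    rw [hL2, hM2] at h2
    simp only [id] at h2
    rw [one_smul, one_smul, zero_smul, zero_add] at h2
    rw [← h2]
    module
  have hS0' : S 0 = curvatureCoord G (f 0) x a x := by simp only [S, hc0, hT0, hK0]
  have hMz : M 0 = (1 / 3 : ℝ) • curvatureCoord G (f 0) x a x := by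
    have h1 := e1.self_of_nhds
    rw [zero_smul, zero_smul, add_zero, add_zero, hS0'] at h1
    rw [← h1]
    module
  refine ⟨hLz, hMz, ?_⟩
  have hU : c 0 ∈ U := by rw [hc]; exact hf.mapsTo _ hmem0
  -- Since `T` is parallel and `DK = L` vanishes at `0`, only the derivative of the curvature tensor
  -- itself contributes.
  have hSd : covDeriv G c T S 0 = covDerivCurvatureCoord G (f 0) x x a x := by
    have hKc := hcov hK0'
    rw [← hL, hLz] at hKc
    have h1 := (hG.hasCovDerivAt_curvatureCoord hU hcd hTc hKc hTc).covDeriv_eq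
    have z1 (v w : E) : curvatureCoord G (c 0) 0 v w = 0 := by
      simpa using hG.curvatureCoord_smul_add₁ hU 0 0 v w 1
    have z2 (v w : E) : curvatureCoord G (c 0) v 0 w = 0 := by
      simpa using hG.curvatureCoord_smul_add₂ hU 0 0 v w 1
    have z3 (v w : E) : curvatureCoord G (c 0) v w 0 = 0 := by
      simpa using hG.curvatureCoord_smul_add₃ hU 0 0 v w 1
    rw [z1, z2, z3, add_zero, add_zero, add_zero, hT0, hK0, hc0] at h1
    exact h1
  have hDS : ContDiffAt ℝ ∞ (covDeriv G c T S) 0 := by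
    obtain ⟨h1, h2, -, -, -, -⟩ := jacobi hG hf hmem0 a hc hT hK hL
    exact hG.contDiffAt_covDeriv hU h1 h2 hS0
  -- A second differentiation gives `3 N + N = 2 DS` at `0`, whence the factor `1/2`.
  have h1 := ((hcov hM0).smul (hconst 3 0)).add (HasCovDerivAt.smul (hasDerivAt_id 0) (hcov hN0))
  have h2 := h1.unique ((hcov hS0).add (HasCovDerivAt.smul (hasDerivAt_id 0) (hcov hDS))) e1
  have hM2 : covDeriv G c T M 0 = N 0 := rfl
  rw [hM2, hSd] at h2
  simp only [id, zero_smul, one_smul, add_zero, zero_add] at h2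
  change N 0 = _
  have h4 : (4 : ℝ) • N 0 = (2 : ℝ) • covDerivCurvatureCoord G (f 0) x x a x := by
    calc (4 : ℝ) • N 0 = (3 : ℝ) • N 0 + N 0 := by module
      _ = _ := by rw [h2]; module
  calc N 0 = (1 / 4 : ℝ) • ((4 : ℝ) • N 0) := by module
    _ = _ := by rw [h4]; module

/-- Third order radial expansion of the metric pulled back by the exponential map. -/
theorem radial_expansion (hG : IsMetricOn ∞ G U) (hf : IsExponentialOn G U f ρ) (hρ : 0 < ρ)
    (hf' : HasFDerivAt f (ContinuousLinearMap.id ℝ E) 0) (x a b : E) :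
    ∃ φ₁ φ₂ : ℝ → ℝ,
      (∀ᶠ t : ℝ in 𝓝 0, HasDerivAt
        (fun t : ℝ => G (f (t • x)) (fderiv ℝ f (t • x) a) (fderiv ℝ f (t • x) b)) (φ₁ t) t) ∧
      (∀ᶠ t in 𝓝 0, HasDerivAt φ₁ (φ₂ t) t) ∧
      HasDerivAt φ₂ (G (f 0) (covDerivCurvatureCoord G (f 0) x x a x) b) 0 ∧
      φ₁ 0 = 0 ∧ φ₂ 0 = 2 / 3 * G (f 0) (curvatureCoord G (f 0) x a x) b := by
  let c : ℝ → E := fun t => f (t • x)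
  let T : ℝ → E := fun t => fderiv ℝ f (t • x) x
  let K : E → ℝ → E := fun a t => fderiv ℝ f (t • x) a
  let L : E → ℝ → E := fun a => covDeriv G c T (K a)
  let M : E → ℝ → E := fun a => covDeriv G c T (L a)
  let N : E → ℝ → E := fun a => covDeriv G c T (M a)
  have hc0 : c 0 = f 0 := by simp [c]
  have hK0 (a : E) : K a 0 = a := by simp [K, hf'.fderiv]
  have hev := eventually_mem x hρ
  have hd {t : ℝ} (ht : t • x ∈ Metric.ball (0 : E) ρ) (a : E) : HasCovDerivAt G c T (K a) (L a t) t
      ∧ HasCovDerivAt G c T (L a) (M a t) t ∧ HasCovDerivAt G c T (M a) (N a t) t := by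
    obtain ⟨h1, h2, h3, -, -, -⟩ := jacobi (c := c) (T := T) (K := K a) hG hf ht a rfl rfl rfl rfl
    have hU : c t ∈ U := hf.mapsTo _ ht
    have hL := hG.contDiffAt_covDeriv hU h1 h2 h3
    have hM := hG.contDiffAt_covDeriv hU h1 h2 hL
    exact ⟨hasCovDerivAt_covDeriv (h3.differentiableAt (by simp)),
      hasCovDerivAt_covDeriv (hL.differentiableAt (by simp)),
      hasCovDerivAt_covDeriv (hM.differentiableAt (by simp))⟩
  have hcd {t : ℝ} (ht : t • x ∈ Metric.ball (0 : E) ρ) : c t ∈ U ∧ HasDerivAt c (T t) t :=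
    ⟨hf.mapsTo _ ht, (jacobi (c := c) (T := T) (K := K a) hG hf ht a rfl rfl rfl rfl).2.2.2.1⟩
  have hmem0 : (0 : ℝ) • x ∈ Metric.ball (0 : E) ρ := by simpa using hρ
  have hz (a : E) := covDeriv_variation_zero (x := x) (c := c) (T := T) (K := K a) (L := L a)
    hG hf hρ hf' a rfl rfl rfl rfl
  have hU0 : f 0 ∈ U := hc0 ▸ (hcd hmem0).1
  refine ⟨fun t => G (c t) (L a t) (K b t) + G (c t) (K a t) (L b t),
    fun t => G (c t) (M a t) (K b t) + G (c t) (L a t) (L b t)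
      + (G (c t) (L a t) (L b t) + G (c t) (K a t) (M b t)), ?_, ?_, ?_, ?_, ?_⟩
  · filter_upwards [hev] with t ht
    exact hG.hasDerivAt_inner (hcd ht).1 (hcd ht).2 (hd ht a).1 (hd ht b).1
  · filter_upwards [hev] with t ht
    exact (hG.hasDerivAt_inner (hcd ht).1 (hcd ht).2 (hd ht a).2.1 (hd ht b).1).add
      (hG.hasDerivAt_inner (hcd ht).1 (hcd ht).2 (hd ht a).1 (hd ht b).2.1)
  · obtain ⟨hU, hc'⟩ := hcd hmem0
    obtain ⟨a1, a2, a3⟩ := hd hmem0 a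
    obtain ⟨b1, b2, b3⟩ := hd hmem0 b
    have h := ((hG.hasDerivAt_inner hU hc' a3 b1).add (hG.hasDerivAt_inner hU hc' a2 b2)).add
      ((hG.hasDerivAt_inner hU hc' a2 b2).add (hG.hasDerivAt_inner hU hc' a1 b3))
    refine h.congr_deriv ?_
    -- As `L` vanishes at `0`, only `G(N_a, b) + G(a, N_b)` remains: two halves, equal by the
    -- symmetry of `∇R`. The same argument for `φ₂` combines two thirds.
    have hN (a : E) : N a 0 = (1 / 2 : ℝ) • covDerivCurvatureCoord G (f 0) x x a x := (hz a).2.2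
    rw [(hz a).1, (hz b).1, hN, hN, hK0, hK0, hc0]
    simp only [(G (f 0)).map_zero, zero_apply, map_zero, add_zero, zero_add]
    rw [(G (f 0)).map_smul, smul_apply, map_smul, hG.symm _ hU0 a,
      hG.covDerivCurvatureCoord_pair_symm hU0 x x b a, smul_eq_mul]
    ring
  · simp only [(hz a).1, (hz b).1, (G (c 0)).map_zero, zero_apply, map_zero, add_zero]
  · have hM (a : E) : M a 0 = (1 / 3 : ℝ) • curvatureCoord G (f 0) x a x := (hz a).2.1
    simp only [(hz a).1, (hz b).1, hM, hK0, hc0, map_zero, (G (f 0)).map_smul, smul_apply, map_smul]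
    rw [hG.symm _ hU0 a, hG.curvatureCoord_pair_symm hU0 x b a]
    simp only [smul_eq_mul]
    ring

end IsExponentialOn

end Jacobi

/-! ### Functions vanishing to a given order at the origin -/

section Vanishing

variable {E : Type*} [NormedAddCommGroup E] [NormedSpace ℝ E]

/-- `f` is smooth at `0` and its partial derivatives of order less than `r` vanish at `0`. -/
def VanishesToOrder : ℕ → (E → ℝ) → Prop
  | 0, f => ContDiffAt ℝ ∞ f 0
  | r + 1, f => ContDiffAt ℝ ∞ f 0 ∧ f 0 = 0 ∧ ∀ a, VanishesToOrder r fun x => fderiv ℝ f x a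

namespace VanishesToOrder

theorem congr : ∀ {r : ℕ} {f g : E → ℝ}, VanishesToOrder r f → g =ᶠ[𝓝 0] f → VanishesToOrder r g
  | 0, _, _, h, hg => ContDiffAt.congr_of_eventuallyEq h hg
  | r + 1, f, g, ⟨h1, h2, h3⟩, hg => by
    refine ⟨h1.congr_of_eventuallyEq hg, hg.eq_of_nhds.trans h2, fun a => (h3 a).congr ?_⟩
    filter_upwards [hg.eventuallyEq_nhds] with x hx
    rw [hx.fderiv_eq]

theorem eventually_differentiableAt {f : E → ℝ} (hf : ContDiffAt ℝ ∞ f 0) :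
    ∀ᶠ x in 𝓝 0, DifferentiableAt ℝ f x := by
  have h1 : ∀ᶠ x in 𝓝 0, ContDiffAt ℝ (1 : ℕ) f x :=
    (hf.of_le (WithTop.coe_le_coe.2 le_top)).eventually (by simp)
  exact h1.mono fun x hx => hx.differentiableAt (by simp)

theorem add : ∀ {r : ℕ} {f g : E → ℝ}, VanishesToOrder r f → VanishesToOrder r g →
    VanishesToOrder r fun x => f x + g x
  | 0, _, _, hf, hg => ContDiffAt.add hf hg
  | r + 1, f, g, ⟨hf1, hf2, hf3⟩, ⟨hg1, hg2, hg3⟩ => by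
    refine ⟨hf1.add hg1, by simp [hf2, hg2], fun a => ((hf3 a).add (hg3 a)).congr ?_⟩
    filter_upwards [eventually_differentiableAt hf1, eventually_differentiableAt hg1] with x h1 h2
    exact congrArg (fun A => A a) (h1.hasFDerivAt.add h2.hasFDerivAt).fderiv

theorem const_mul (c : ℝ) : ∀ {r : ℕ} {f : E → ℝ}, VanishesToOrder r f →
    VanishesToOrder r fun x => c * f x
  | 0, _, hf => ContDiffAt.mul contDiffAt_const hf
  | r + 1, f, ⟨hf1, hf2, hf3⟩ => by
    refine ⟨contDiffAt_const.mul hf1, by simp [hf2], fun a => ((hf3 a).const_mul c).congr ?_⟩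
    filter_upwards [eventually_differentiableAt hf1] with x h1
    exact congrArg (fun A => A a) (h1.hasFDerivAt.const_mul c).fderiv

/-- The product rule gives `l a * f + l * ∂_a f`: the first term has the order of `f`, and in the
second the induction hypothesis restores the order lost by `∂_a f`. -/
theorem linear_mul (l : E →L[ℝ] ℝ) : ∀ {r : ℕ} {f : E → ℝ}, VanishesToOrder r f →
    VanishesToOrder (r + 1) fun x => l x * f x := by
  have hs {f : E → ℝ} (hf : ContDiffAt ℝ ∞ f 0) : ContDiffAt ℝ ∞ (fun x => l x * f x) 0 :=
    l.contDiff.contDiffAt.mul hf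
  have hd {f : E → ℝ} (hf : ContDiffAt ℝ ∞ f 0) (a : E) :
      (fun x => fderiv ℝ (fun x => l x * f x) x a) =ᶠ[𝓝 0]
        fun x => l a * f x + l x * fderiv ℝ f x a := by
    filter_upwards [eventually_differentiableAt hf] with x hx
    have h : HasFDerivAt (fun x => l x * f x) _ x := l.hasFDerivAt.mul hx.hasFDerivAt
    rw [h.fderiv]
    simp only [add_apply, smul_apply, smul_eq_mul]
    ring
  intro r
  induction r with
  | zero =>
    intro f hf
    refine ⟨hs hf, by simp, fun a => ?_⟩
    refine ContDiffAt.congr_of_eventuallyEq ?_ (hd hf a)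
    exact (contDiffAt_const.mul hf).add
      (hs ((hf.fderiv_right (m := ∞) le_rfl).clm_apply contDiffAt_const))
  | succ r ih =>
    intro f hf
    refine ⟨hs hf.1, by simp, fun a => VanishesToOrder.congr ?_ (hd hf.1 a)⟩
    exact (hf.const_mul (l a)).add (ih (hf.2.2 a))

end VanishesToOrder

theorem fderiv_fderiv_apply_const {F : Type*} [NormedAddCommGroup F] [NormedSpace ℝ F] {f : E → F}
    {x : E} (hf : ContDiffAt ℝ 2 f x) (a b : E) :
    fderiv ℝ (fun z => fderiv ℝ f z a) x b = fderiv ℝ (fderiv ℝ f) x b a := by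
  have h1 := (hf.fderiv_right (m := 1) le_rfl).differentiableAt one_ne_zero
  rw [(h1.hasFDerivAt.clm_apply (hasFDerivAt_const a x)).fderiv]
  simp

theorem fderiv_fderiv_fderiv_apply_const {F : Type*} [NormedAddCommGroup F] [NormedSpace ℝ F]
    {f : E → F} {x : E} (hf : ContDiffAt ℝ 3 f x) (a b c : E) :
    fderiv ℝ (fun z => fderiv ℝ (fderiv ℝ f) z b a) x c
      = fderiv ℝ (fderiv ℝ (fderiv ℝ f)) x c b a := by
  have h1 := ((hf.fderiv_right (m := 2) le_rfl).fderiv_right (m := 1) le_rfl).differentiableAt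
    one_ne_zero
  rw [((h1.hasFDerivAt.clm_apply (hasFDerivAt_const b x)).clm_apply
    (hasFDerivAt_const a x)).fderiv]
  simp

omit [NormedSpace ℝ E] in
-- Polarization: the cubes of `a + b` and `a + 2b` give two independent equations for `T a a b` and
-- `T a b b`; then `T (a + b) (a + b) c = 0` gives the general entry.
theorem eq_zero_of_symmetric_trilinear {T : E → E → E → ℝ} (s₁ : ∀ a b c, T a b c = T b a c)
    (s₂ : ∀ a b c, T a b c = T a c b) (add : ∀ a b c e, T (a + b) c e = T a c e + T b c e)
    (h : ∀ a, T a a a = 0) (a b c : E) : T a b c = 0 := by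
  have add₂ (a b c e : E) : T c (a + b) e = T c a e + T c b e := by
    rw [s₁, add, s₁ a, s₁ b]
  have add₃ (a b c e : E) : T c e (a + b) = T c e a + T c e b := by
    rw [s₂, add₂, s₂ c a, s₂ c b]
  have p (a b : E) : T a a b = 0 := by
    have h₁ := h (a + b)
    have h₂ := h (a + b + b)
    simp only [add, add₂, add₃, h] at h₁ h₂
    rw [s₁ b a b, s₁ b a a, s₂ b b a, s₂ a b a, s₁ b a b] at h₁ h₂
    linarith
  have q := p (a + b) c
  rw [add, add₂, add₂, p, p, s₁ b a] at q
  linarith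

/-- Symmetry and polarization reduce all second and third derivatives to the diagonal ones. Order
four itself requires only smoothness of the fourth derivatives. -/
theorem vanishesToOrder_four {f : E → ℝ} (hf : ContDiffAt ℝ ∞ f 0) (h0 : f 0 = 0)
    (h1 : ∀ a, fderiv ℝ f 0 a = 0) (h2 : ∀ a, fderiv ℝ (fderiv ℝ f) 0 a a = 0)
    (h3 : ∀ a, fderiv ℝ (fderiv ℝ (fderiv ℝ f)) 0 a a a = 0) : VanishesToOrder 4 f := by
  have hev : ∀ᶠ x in 𝓝 (0 : E), ContDiffAt ℝ (2 : ℕ) f x :=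
    (hf.of_le (WithTop.coe_le_coe.2 le_top)).eventually (by simp)
  have p2 (a b : E) : fderiv ℝ (fderiv ℝ f) 0 a b = 0 := by
    have h := h2 (a + b)
    simp only [map_add, add_apply, h2, fderiv_fderiv_symm hf b a] at h
    linarith
  have p3' (a b c : E) : fderiv ℝ (fderiv ℝ (fderiv ℝ f)) 0 a b c = 0 :=
    eq_zero_of_symmetric_trilinear (T := fun a b c => fderiv ℝ (fderiv ℝ (fderiv ℝ f)) 0 a b c)
      (fderiv_fderiv_fderiv_symm_left hf) (fderiv_fderiv_fderiv_symm_right hf)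
      (fun a b c e => by rw [ContinuousLinearMap.map_add]; rfl) h3 a b c
  have s1 {g : E → ℝ} (hg : ContDiffAt ℝ ∞ g 0) (a : E) :
      ContDiffAt ℝ ∞ (fun x => fderiv ℝ g x a) 0 :=
    (hg.fderiv_right (m := ∞) le_rfl).clm_apply contDiffAt_const
  refine ⟨hf, h0, fun a => ⟨s1 hf a, h1 a, fun b => ⟨s1 (s1 hf a) b, ?_, fun c =>
    ⟨s1 (s1 (s1 hf a) b) c, ?_, fun e => s1 (s1 (s1 (s1 hf a) b) c) e⟩⟩⟩⟩
  · exact (fderiv_fderiv_apply_const hev.self_of_nhds a b).trans (p2 b a)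
  · have he : (fun x => fderiv ℝ (fun x => fderiv ℝ f x a) x b) =ᶠ[𝓝 0]
        fun x => fderiv ℝ (fderiv ℝ f) x b a := by
      filter_upwards [hev] with x hx
      exact fderiv_fderiv_apply_const hx a b
    change fderiv ℝ (fun x => fderiv ℝ (fun x => fderiv ℝ f x a) x b) 0 c = 0
    rw [he.fderiv_eq, fderiv_fderiv_fderiv_apply_const
      (hf.of_le (WithTop.coe_le_coe.2 le_top : (3 : ℕ∞ω) ≤ ∞)), p3']

/-- Vanishing to fourth order can be tested on rays. -/
theorem vanishesToOrder_four_of_radial {f : E → ℝ} (hf : ContDiffAt ℝ ∞ f 0) (h0 : f 0 = 0)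
    (h : ∀ x : E, ∃ φ₁ φ₂ : ℝ → ℝ, (∀ᶠ t : ℝ in 𝓝 0, HasDerivAt (fun t : ℝ => f (t • x)) (φ₁ t) t) ∧
      (∀ᶠ t in 𝓝 0, HasDerivAt φ₁ (φ₂ t) t) ∧ HasDerivAt φ₂ 0 0 ∧ φ₁ 0 = 0 ∧ φ₂ 0 = 0) :
    VanishesToOrder 4 f := by
  have hev : ∀ᶠ x in 𝓝 (0 : E), ContDiffAt ℝ (2 : ℕ) f x :=
    (hf.of_le (WithTop.coe_le_coe.2 le_top)).eventually (by simp)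
  have hr (x : E) (t : ℝ) : HasDerivAt (fun t : ℝ => t • x) x t := by
    simpa using (hasDerivAt_id t).smul_const x
  have hlim (x : E) : Tendsto (fun t : ℝ => t • x) (𝓝 0) (𝓝 0) := by
    simpa [ContinuousAt] using (hr x 0).continuousAt
  have key (x : E) : fderiv ℝ f 0 x = 0 ∧ fderiv ℝ (fderiv ℝ f) 0 x x = 0
      ∧ fderiv ℝ (fderiv ℝ (fderiv ℝ f)) 0 x x x = 0 := by
    obtain ⟨φ₁, φ₂, h1, h2, h3, e1, e2⟩ := h x
    -- Uniqueness of derivatives forces `φ₁`, and then `φ₂`, to be the differentials of `f`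
    -- evaluated on the ray.
    have a1 : φ₁ =ᶠ[𝓝 0] fun t => fderiv ℝ f (t • x) x := by
      filter_upwards [h1, (hlim x).eventually hev] with t ht hs
      exact ht.unique ((hs.differentiableAt (by simp)).hasFDerivAt.comp_hasDerivAt t (hr x t))
    have a2 : φ₂ =ᶠ[𝓝 0] fun t => fderiv ℝ (fderiv ℝ f) (t • x) x x := by
      filter_upwards [h2, (hlim x).eventually hev, a1.eventually_nhds] with t ht hs ha
      have hd := hasDerivAt_fderiv_apply (t := t) hs (hr x t) (hasDerivAt_const t x)
      rw [map_zero, add_zero] at hd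
      exact ht.unique (hd.congr_of_eventuallyEq ha)
    have h3f : ContDiffAt ℝ 3 f ((0 : ℝ) • x) := by
      rw [zero_smul]; exact hf.of_le (WithTop.coe_le_coe.2 le_top : (3 : ℕ∞ω) ≤ ∞)
    have hd := hasDerivAt_fderiv_fderiv_apply (t := 0) h3f (hr x 0) (hasDerivAt_const 0 x)
      (hasDerivAt_const 0 x)
    refine ⟨?_, ?_, ?_⟩
    · simpa [e1] using a1.eq_of_nhds.symm
    · simpa [e2] using a2.eq_of_nhds.symm
    · simpa using (h3.unique (hd.congr_of_eventuallyEq a2)).symm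
  exact vanishesToOrder_four hf h0 (fun x => (key x).1) (fun x => (key x).2.1)
    fun x => (key x).2.2

end Vanishing

/-! ### From vanishing order to bounds under iterated scaled derivatives -/

section BigOrder

variable {d : ℕ}

theorem norm_le_sum_single {F : Type*} [NormedAddCommGroup F] [NormedSpace ℝ F]
    (A : EuclideanSpace ℝ (Fin d) →L[ℝ] F) : ‖A‖ ≤ ∑ i, ‖A (EuclideanSpace.single i 1)‖ := by
  refine A.opNorm_le_bound (Finset.sum_nonneg fun _ _ => norm_nonneg _) fun v => ?_
  have hv : v = ∑ i, v i • EuclideanSpace.single i (1 : ℝ) := by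
    ext j
    simp [Finset.sum_apply, Pi.single_apply]
  calc ‖A v‖ = ‖∑ i, v i • A (EuclideanSpace.single i 1)‖ := by
        conv_lhs => rw [hv]
        simp only [map_sum, map_smul]
    _ ≤ ∑ i, ‖v i • A (EuclideanSpace.single i 1)‖ := norm_sum_le _ _
    _ ≤ ∑ i, ‖A (EuclideanSpace.single i 1)‖ * ‖v‖ := by
        refine Finset.sum_le_sum fun i _ => ?_
        rw [norm_smul, mul_comm]
        exact mul_le_mul_of_nonneg_left (PiLp.norm_apply_le v i) (norm_nonneg _)
    _ = _ := by rw [Finset.sum_mul]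

/-- By induction the partial derivatives are at most `C ‖x‖ ^ r` on the ball of radius `‖x‖`, and
the mean value inequality from `0` supplies one more factor `‖x‖`. The case `r = 0` is compactness
of the closed ball, which requires `R' < R`. -/
theorem VanishesToOrder.exists_bound {R R' : ℝ} (hR : R' < R) : ∀ {r : ℕ}
    {f : EuclideanSpace ℝ (Fin d) → ℝ}, ContDiffOn ℝ ∞ f (Metric.ball 0 R) → VanishesToOrder r f →
    ∃ C, 0 ≤ C ∧ ∀ x ∈ Metric.closedBall (0 : EuclideanSpace ℝ (Fin d)) R', |f x| ≤ C * ‖x‖ ^ r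
  | 0, f, hf, _ => by
    have hc : ContinuousOn f (Metric.closedBall 0 R') :=
      hf.continuousOn.mono (Metric.closedBall_subset_ball hR)
    obtain ⟨C, hC⟩ := (isCompact_closedBall 0 R').exists_bound_of_continuousOn hc
    refine ⟨max C 0, le_max_right _ _, fun x hx => ?_⟩
    rw [pow_zero, mul_one]
    exact (hC x hx).trans (le_max_left _ _)
  | r + 1, f, hf, h => by
    have hf' (i : Fin d) : ContDiffOn ℝ ∞ (fun x => fderiv ℝ f x (EuclideanSpace.single i 1))
        (Metric.ball 0 R) :=
      (hf.fderiv_of_isOpen Metric.isOpen_ball (m := ∞) le_rfl).clm_apply contDiffOn_const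
    choose C hC0 hC using fun i => VanishesToOrder.exists_bound hR (hf' i) (h.2.2 _)
    refine ⟨∑ i, C i, Finset.sum_nonneg fun i _ => hC0 i, fun x hx => ?_⟩
    have hsub : Metric.closedBall (0 : EuclideanSpace ℝ (Fin d)) ‖x‖ ⊆ Metric.closedBall 0 R' :=
      Metric.closedBall_subset_closedBall (by simpa using hx)
    have hb : ∀ y ∈ Metric.closedBall (0 : EuclideanSpace ℝ (Fin d)) ‖x‖,
        ‖fderiv ℝ f y‖ ≤ (∑ i, C i) * ‖x‖ ^ r := by
      intro y hy
      refine (norm_le_sum_single _).trans ?_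
      rw [Finset.sum_mul]
      refine Finset.sum_le_sum fun i _ => (hC i y (hsub hy)).trans ?_
      have hyx : ‖y‖ ≤ ‖x‖ := by simpa using hy
      exact mul_le_mul_of_nonneg_left (pow_le_pow_left₀ (norm_nonneg _) hyx r) (hC0 i)
    have hd : ∀ y ∈ Metric.closedBall (0 : EuclideanSpace ℝ (Fin d)) ‖x‖, DifferentiableAt ℝ f y :=
      fun y hy => (hf.contDiffAt (Metric.isOpen_ball.mem_nhds
        (Metric.closedBall_subset_ball hR (hsub hy)))).differentiableAt (by simp)
    have h1 := (convex_closedBall (0 : EuclideanSpace ℝ (Fin d)) ‖x‖).norm_image_sub_le_of_norm_fderiv_le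
      hd hb (Metric.mem_closedBall_self (norm_nonneg x)) (by simp : x ∈ Metric.closedBall 0 ‖x‖)
    rw [h.2.1, sub_zero, sub_zero, Real.norm_eq_abs] at h1
    rwa [pow_succ, ← mul_assoc]

/-- Differentiation loses one order and multiplication by the coordinate regains it; at order `0`
only smoothness is asserted. -/
theorem VanishesToOrder.scaledDeriv {f : EuclideanSpace ℝ (Fin d) → ℝ} (j i : Fin d) :
    ∀ {r : ℕ}, VanishesToOrder r f → VanishesToOrder r (scaledDeriv j i f)
  | 0, hf => ((EuclideanSpace.proj (𝕜 := ℝ) j).contDiff.contDiffAt).mul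
      (((hf : ContDiffAt ℝ ∞ f 0).fderiv_right (m := ∞) le_rfl).clm_apply contDiffAt_const)
  | _ + 1, hf => (hf.2.2 _).linear_mul (EuclideanSpace.proj (𝕜 := ℝ) j)

theorem contDiffOn_scaledDeriv {f : EuclideanSpace ℝ (Fin d) → ℝ}
    {U : Set (EuclideanSpace ℝ (Fin d))} (hU : IsOpen U) (hf : ContDiffOn ℝ ∞ f U) (j i : Fin d) :
    ContDiffOn ℝ ∞ (scaledDeriv j i f) U :=
  ((EuclideanSpace.proj (𝕜 := ℝ) j).contDiff.contDiffOn).mul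
    ((hf.fderiv_of_isOpen hU (m := ∞) le_rfl).clm_apply contDiffOn_const)

/-- Every iterated derivative is smooth on the ball of radius `R` and vanishes to order `r`, so the
one radius `R / 2` serves all lists of derivatives. -/
theorem isBigOrder_of_vanishesToOrder {m : ℕ∞ω} (hm : ∞ ≤ m) {r : ℕ}
    {f : EuclideanSpace ℝ (Fin d) → ℝ} {R : ℝ} (hR : 0 < R)
    (hf : ContDiffOn ℝ m f (Metric.ball 0 R)) (h : VanishesToOrder r f) : IsBigOrder m r f := by
  refine ⟨R / 2, half_pos hR, hf.mono (Metric.ball_subset_ball (half_le_self hR.le)), fun L => ?_⟩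
  have key : ContDiffOn ℝ ∞ (L.foldr (fun a h => scaledDeriv a.1 a.2 h) f) (Metric.ball 0 R) ∧
      VanishesToOrder r (L.foldr (fun a h => scaledDeriv a.1 a.2 h) f) := by
    induction L with
    | nil => exact ⟨hf.of_le hm, h⟩
    | cons a L ih =>
      exact ⟨contDiffOn_scaledDeriv Metric.isOpen_ball ih.1 _ _, ih.2.scaledDeriv _ _⟩
  obtain ⟨C, -, hC⟩ := key.2.exists_bound (half_lt_self hR) key.1
  exact ⟨C, fun x hx => hC x (Metric.ball_subset_closedBall hx)⟩

end BigOrder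

/-! ### The metric in charts and its behaviour under changes of chart -/

section Charts

variable {E : Type*} [NormedAddCommGroup E] [NormedSpace ℝ E]
  {M : Type*} [TopologicalSpace M] [ChartedSpace E M] [IsManifold 𝓘(ℝ, E) 1 M] {m : ℕ∞ω}
  (g : ContMDiffRiemannianMetric 𝓘(ℝ, E) m E (TangentSpace 𝓘(ℝ, E) : M → Type _))

theorem metricInChart_apply (q : M) (y u v : E) :
    metricInChart g q y u v = g.inner ((extChartAt 𝓘(ℝ, E) q).symm y)
      (mfderiv 𝓘(ℝ, E) 𝓘(ℝ, E) (extChartAt 𝓘(ℝ, E) q).symm y u)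
      (mfderiv 𝓘(ℝ, E) 𝓘(ℝ, E) (extChartAt 𝓘(ℝ, E) q).symm y v) := rfl

theorem inner_congr {x x' : M} (h : x = x') {u v u' v' : E} (hu : u = u') (hv : v = v') :
    g.inner x (show TangentSpace 𝓘(ℝ, E) x from u) (show TangentSpace 𝓘(ℝ, E) x from v)
      = g.inner x' (show TangentSpace 𝓘(ℝ, E) x' from u')
        (show TangentSpace 𝓘(ℝ, E) x' from v') := by
  subst h hu hv; rfl

theorem mdifferentiableAt_extChartAt_symm (q : M) {y : E}
    (hy : y ∈ (extChartAt 𝓘(ℝ, E) q).target) :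
    MDifferentiableAt 𝓘(ℝ, E) 𝓘(ℝ, E) (extChartAt 𝓘(ℝ, E) q).symm y := by
  have h := mdifferentiableWithinAt_extChartAt_symm (I := 𝓘(ℝ, E)) hy
  rwa [modelWithCornersSelf_coe, range_id, mdifferentiableWithinAt_univ] at h

theorem mfderiv_extChartAt_symm_injective (q : M) {y : E}
    (hy : y ∈ (extChartAt 𝓘(ℝ, E) q).target) {v : E}
    (hv : mfderiv 𝓘(ℝ, E) 𝓘(ℝ, E) (extChartAt 𝓘(ℝ, E) q).symm y v = 0) : v = 0 := by
  have h := mfderiv_extChartAt_comp_mfderivWithin_extChartAt_symm (I := 𝓘(ℝ, E)) hy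
  rw [modelWithCornersSelf_coe, range_id, mfderivWithin_univ] at h
  have h1 : mfderiv 𝓘(ℝ, E) 𝓘(ℝ, E) (extChartAt 𝓘(ℝ, E) q) ((extChartAt 𝓘(ℝ, E) q).symm y)
      (mfderiv 𝓘(ℝ, E) 𝓘(ℝ, E) (extChartAt 𝓘(ℝ, E) q).symm y v) = v := congrArg (fun A => A v) h
  rw [hv, map_zero] at h1
  exact h1.symm

/-- The tangent space at `p` is identified with `E` through the chart at `p` itself, so the
derivative of this chart at `p` is the identity. -/
theorem metricInChart_self (p : M) (u v : E) :
    metricInChart g p (extChartAt 𝓘(ℝ, E) p p) u v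
      = g.inner p (show TangentSpace 𝓘(ℝ, E) p from u) (show TangentSpace 𝓘(ℝ, E) p from v) := by
  have h := mfderivWithin_extChartAt_symm_comp_mfderiv_extChartAt' (I := 𝓘(ℝ, E))
    (mem_extChartAt_source (I := 𝓘(ℝ, E)) p)
  rw [modelWithCornersSelf_coe, range_id, mfderivWithin_univ, mfderiv_extChartAt_self] at h
  rw [metricInChart_apply]
  exact inner_congr g (extChartAt_to_inv p) (congrArg (fun A => A u) h) (congrArg (fun A => A v) h)

theorem toCoord_eq (p : M) (v : TangentSpace 𝓘(ℝ, E) p) : toCoord p v = v := by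
  rw [toCoord, mfderiv_extChartAt_self]
  rfl

/-- The coordinate fields of the chart are the constant sections in the trivialization of the
tangent bundle at `q`, so the coefficient is a regular section paired with regular fields. The
tangent bundle has class `C^m` because `M` has class `C^(m+1)`. -/
theorem contDiffOn_metricInChart_apply [hm1 : IsManifold 𝓘(ℝ, E) (m + 1) M] [IsManifold 𝓘(ℝ, E) m M]
    (q : M) (u v : E) :
    ContDiffOn ℝ m (fun y => metricInChart g q y u v) (extChartAt 𝓘(ℝ, E) q).target := by
  have : ContMDiffVectorBundle m E (TangentSpace 𝓘(ℝ, E) : M → Type _) 𝓘(ℝ, E) :=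
    TangentBundle.contMDiffVectorBundle (h := hm1)
  let e := trivializationAt E (TangentSpace 𝓘(ℝ, E)) q
  have hs (w : E) : ContMDiffOn 𝓘(ℝ, E) (𝓘(ℝ, E).prod 𝓘(ℝ, E)) m
      (fun x => TotalSpace.mk' E (E := TangentSpace 𝓘(ℝ, E)) x (e.symmL ℝ x w)) e.baseSet := by
    intro x hx
    have h1 := (e.contMDiffAt_symmL (IB := 𝓘(ℝ, E)) (n := m) hx)
    have h2 : ContMDiffAt 𝓘(ℝ, E) (𝓘(ℝ, E).prod 𝓘(ℝ, E)) m
      (fun x => TotalSpace.mk' E (E := Bundle.Trivial M E) x w) x :=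
        (contMDiffAt_section _).2 contMDiffAt_const
    exact (h1.clm_bundle_apply h2).contMDiffWithinAt
  have hg : ContMDiffOn 𝓘(ℝ, E) 𝓘(ℝ, ℝ) m (fun x => g.inner x (e.symmL ℝ x u) (e.symmL ℝ x v))
      e.baseSet := by
    intro x hx
    have h1 : ContMDiffWithinAt 𝓘(ℝ, E) (𝓘(ℝ, E).prod 𝓘(ℝ)) m
        (fun x ↦ TotalSpace.mk' ℝ (E := Bundle.Trivial M ℝ) x
          (g.inner x (e.symmL ℝ x u) (e.symmL ℝ x v))) e.baseSet x :=
      ContMDiffWithinAt.clm_bundle_apply₂ (F₁ := E) (F₂ := E)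
        (g.contMDiff.contMDiffAt.contMDiffWithinAt) (hs u x hx) (hs v x hx)
    simp only [contMDiffWithinAt_totalSpace] at h1
    exact h1.2
  have hbase : e.baseSet = (extChartAt 𝓘(ℝ, E) q).source := by
    rw [extChartAt_source]; rfl
  have hc := (hg.comp (contMDiffOn_extChartAt_symm (I := 𝓘(ℝ, E)) (n := m) q)
    (fun y hy => by rw [hbase]; exact (extChartAt 𝓘(ℝ, E) q).map_target hy))
  refine (contMDiffOn_iff_contDiffOn.1 hc).congr fun y hy => ?_
  have hx : (extChartAt 𝓘(ℝ, E) q).symm y ∈ (chartAt E q).source := by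
    rw [← extChartAt_source 𝓘(ℝ, E)]; exact (extChartAt 𝓘(ℝ, E) q).map_target hy
  have h := TangentBundle.symmL_trivializationAt (I := 𝓘(ℝ, E)) hx
  rw [modelWithCornersSelf_coe, range_id, mfderivWithin_univ,
    (extChartAt 𝓘(ℝ, E) q).right_inv hy] at h
  rw [metricInChart_apply]
  exact inner_congr g rfl (congrArg (fun A => A u) h).symm (congrArg (fun A => A v) h).symm

omit [TopologicalSpace M] [ChartedSpace E M] [IsManifold 𝓘(ℝ, E) 1 M] in
theorem contDiffOn_bilinear [FiniteDimensional ℝ E] {G : E → E →L[ℝ] E →L[ℝ] ℝ} {U : Set E}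
    (h : ∀ u v, ContDiffOn ℝ m (fun y => G y u v) U) : ContDiffOn ℝ m G U :=
  contDiffOn_clm_apply.2 fun u => contDiffOn_clm_apply.2 fun v => h u v

theorem isMetricOn_metricInChart [FiniteDimensional ℝ E] [IsManifold 𝓘(ℝ, E) (m + 1) M]
    [IsManifold 𝓘(ℝ, E) m M] (q : M) :
    IsMetricOn m (metricInChart g q) (extChartAt 𝓘(ℝ, E) q).target where
  isOpen := isOpen_extChartAt_target q
  contDiffOn := contDiffOn_bilinear (contDiffOn_metricInChart_apply g q)
  symm y _ v w := by
    rw [metricInChart_apply, metricInChart_apply]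
    exact g.symm _ _ _
  pos y hy v hv := by
    rw [metricInChart_apply]
    exact g.pos _ _ fun h => hv (mfderiv_extChartAt_symm_injective q hy h)

/-- The change of coordinates from the chart at `p` to the chart at `q`. -/
def chartChange (p q : M) (y : E) : E :=
  extChartAt 𝓘(ℝ, E) q ((extChartAt 𝓘(ℝ, E) p).symm y)

/-- The domain of the change of coordinates from the chart at `p` to the chart at `q`. -/
def chartChangeDomain (p q : M) : Set E :=
  (extChartAt 𝓘(ℝ, E) p).target ∩ (extChartAt 𝓘(ℝ, E) p).symm ⁻¹' (extChartAt 𝓘(ℝ, E) q).source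

omit [IsManifold 𝓘(ℝ, E) 1 M] in
theorem isOpen_chartChangeDomain (p q : M) : IsOpen (chartChangeDomain (E := E) p q) :=
  (continuousOn_extChartAt_symm p).isOpen_inter_preimage (isOpen_extChartAt_target p)
    (isOpen_extChartAt_source q)

omit [IsManifold 𝓘(ℝ, E) 1 M] in
theorem contDiffOn_chartChange [IsManifold 𝓘(ℝ, E) m M] (p q : M) :
    ContDiffOn ℝ m (chartChange p q) (chartChangeDomain (E := E) p q) := by
  refine (contDiffOn_ext_coord_change (I := 𝓘(ℝ, E)) (n := m) q p).mono fun y hy => ?_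
  rw [PartialEquiv.trans_source]
  exact hy

/-- Near `y` the inverse chart at `p` is the inverse chart at `q` composed with the change of
coordinates; the chain rule does the rest. -/
theorem metricInChart_chartChange (p q : M) {y : E} (hy : y ∈ chartChangeDomain (E := E) p q)
    (u v : E) : metricInChart g p y u v
      = metricInChart g q (chartChange p q y) (fderiv ℝ (chartChange p q) y u)
        (fderiv ℝ (chartChange p q) y v) := by
  have hq : chartChange p q y ∈ (extChartAt 𝓘(ℝ, E) q).target :=
    (extChartAt 𝓘(ℝ, E) q).map_source hy.2
  have hD := (isOpen_chartChangeDomain (E := E) p q).mem_nhds hy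
  have hd : DifferentiableAt ℝ (chartChange p q) y :=
    ((contDiffOn_chartChange (m := 1) p q).contDiffAt hD).differentiableAt one_ne_zero
  have hev : (extChartAt 𝓘(ℝ, E) p).symm
      =ᶠ[𝓝 y] (extChartAt 𝓘(ℝ, E) q).symm ∘ chartChange p q := by
    filter_upwards [hD] with z hz
    exact ((extChartAt 𝓘(ℝ, E) q).left_inv hz.2).symm
  have h := mfderiv_comp y (mdifferentiableAt_extChartAt_symm q hq) hd.mdifferentiableAt
  rw [mfderiv_eq_fderiv] at h
  have h1 := hev.mfderiv_eq (I := 𝓘(ℝ, E)) (I' := 𝓘(ℝ, E))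
  rw [metricInChart_apply, metricInChart_apply]
  have key (w : E) : (show E from mfderiv 𝓘(ℝ, E) 𝓘(ℝ, E) (extChartAt 𝓘(ℝ, E) p).symm y w)
      = mfderiv 𝓘(ℝ, E) 𝓘(ℝ, E) (extChartAt 𝓘(ℝ, E) q).symm (chartChange p q y)
        (fderiv ℝ (chartChange p q) y w) := by
    have h2 := congrArg (fun A : E →L[ℝ] E => A w) h1
    have h3 := congrArg (fun A : E →L[ℝ] E => A w) h
    exact h2.trans h3
  exact inner_congr g hev.eq_of_nhds (key u) (key v)

end Charts

/-! ### Transformation of the Christoffel symbols -/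

section ChristoffelTransformation

variable {E : Type*} [NormedAddCommGroup E] [NormedSpace ℝ E] [FiniteDimensional ℝ E]

set_option synthInstance.maxHeartbeats 400000 in
/-- Transformation law of the Christoffel symbols under a change of coordinates `τ`. -/
theorem IsMetricOn.fderiv_christoffel_eq {G G' : E → E →L[ℝ] E →L[ℝ] ℝ} {U U' D : Set E}
    (hG : IsMetricOn ∞ G U) (hG' : IsMetricOn ∞ G' U') {τ : E → E} (hD : IsOpen D) (hDU : D ⊆ U)
    (hτ : ContDiffOn ℝ ∞ τ D) (hmaps : MapsTo τ D U')
    (h : ∀ z ∈ D, ∀ u v, G z u v = G' (τ z) (fderiv ℝ τ z u) (fderiv ℝ τ z v)) {y : E} (hy : y ∈ D)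
    (u v : E) : fderiv ℝ τ y (christoffel G y u v)
      = christoffel G' (τ y) (fderiv ℝ τ y u) (fderiv ℝ τ y v) + fderiv ℝ (fderiv ℝ τ) y u v := by
  have hyU := hDU hy
  have hyU' := hmaps hy
  have hsm : ContDiffAt ℝ ∞ τ y := hτ.contDiffAt (hD.mem_nhds hy)
  -- Since `G` is the pullback of `G'` and is definite, the derivative of `τ` is injective, hence
  -- onto; vectors `fderiv ℝ τ y w` then suffice as test vectors.
  have hinj : Function.Injective (fderiv ℝ τ y : E →ₗ[ℝ] E) := by
    rw [← LinearMap.ker_eq_bot, LinearMap.ker_eq_bot']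
    intro w hw
    by_contra hne
    have h1 := hG.pos y hyU w hne
    rw [h y hy, show fderiv ℝ τ y w = 0 from hw, map_zero] at h1
    exact lt_irrefl _ h1
  have hsurj : Function.Surjective (fderiv ℝ τ y : E →ₗ[ℝ] E) :=
    LinearMap.injective_iff_surjective.1 hinj
  -- The derivative of the pullback relation. In the Koszul combination of three such identities the
  -- second derivatives of `τ` cancel except for the one in the directions `u`, `v`.
  have key (a b c : E) : fderiv ℝ G y a b c
      = fderiv ℝ G' (τ y) (fderiv ℝ τ y a) (fderiv ℝ τ y b) (fderiv ℝ τ y c)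
        + G' (τ y) (fderiv ℝ (fderiv ℝ τ) y a b) (fderiv ℝ τ y c)
        + G' (τ y) (fderiv ℝ τ y b) (fderiv ℝ (fderiv ℝ τ) y a c) := by
    have hl : HasDerivAt (fun s : ℝ => y + s • a) a 0 := hasDerivAt_add_smul y a 0
    have h0 : y = y + (0 : ℝ) • a := by simp
    have h2 : ContDiffAt ℝ 2 τ (y + (0 : ℝ) • a) := by
      rw [← h0]; exact hsm.of_le (WithTop.coe_le_coe.2 le_top : (2 : ℕ∞ω) ≤ ∞)
    have hG1 := ((hG.contDiffAt (h0 ▸ hyU : y + (0 : ℝ) • a ∈ U)).differentiableAt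
      (by simp)).hasFDerivAt.comp_hasDerivAt 0 hl
    have hτ1 := (h2.differentiableAt (by simp)).hasFDerivAt.comp_hasDerivAt 0 hl
    have hG1' := ((hG'.contDiffAt (h0 ▸ hyU' : τ (y + (0 : ℝ) • a) ∈ U')).differentiableAt
      (by simp)).hasFDerivAt.comp_hasDerivAt 0 hτ1
    have hb (b : E) := hasDerivAt_fderiv_apply h2 hl (hasDerivAt_const 0 b)
    have e1 := (hG1.clm_apply (hasDerivAt_const 0 b)).clm_apply (hasDerivAt_const 0 c)
    have e2 := (hG1'.clm_apply (hb b)).clm_apply (hb c)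
    have hev : ∀ᶠ s : ℝ in 𝓝 0, y + s • a ∈ D :=
      hl.continuousAt.preimage_mem_nhds (hD.mem_nhds (h0 ▸ hy : y + (0 : ℝ) • a ∈ D))
    have e3 := e1.unique (e2.congr_of_eventuallyEq (hev.mono fun s hs => h _ hs b c))
    simp only [Function.comp_apply, map_zero, add_zero, add_apply, ← h0] at e3
    exact e3
  refine hG'.ext_of_apply hyU' fun w => ?_
  obtain ⟨w, rfl⟩ := hsurj w
  change G' (τ y) _ (fderiv ℝ τ y w) = G' (τ y) _ (fderiv ℝ τ y w)
  rw [← h y hy, hG.apply_christoffel hyU, (G' (τ y)).map_add, add_apply,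
    hG'.apply_christoffel hyU', key, key, key, fderiv_fderiv_symm hsm v u,
    fderiv_fderiv_symm hsm w u, fderiv_fderiv_symm hsm w v,
    hG'.symm _ hyU' (fderiv ℝ τ y v) (fderiv ℝ (fderiv ℝ τ) y u w)]
  ring

end ChristoffelTransformation

theorem IsMetricOn.contDiffAt_christoffel_diag {E : Type*} [NormedAddCommGroup E] [NormedSpace ℝ E]
    [FiniteDimensional ℝ E] {m : ℕ∞ω} {G : E → E →L[ℝ] E →L[ℝ] ℝ} {U : Set E}
    (hG : IsMetricOn m G U) (hm : m + 1 ≤ m) {y : E} (hy : y ∈ U) (u : E) :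
    ContDiffAt ℝ m (fun z : E × E => christoffel G z.1 z.2 z.2) (y, u) := by
  have h1 : ContDiffAt ℝ m (fun z : E × E × E => christoffel G z.1 z.2.1 z.2.2) (y, u, u) :=
    (hG.contDiffOn_christoffel hm).contDiffAt
      ((hG.isOpen.prod isOpen_univ).mem_nhds ⟨hy, trivial⟩)
  have h2 : ContDiffAt ℝ m (fun z : E × E => (z.1, z.2, z.2)) (y, u) := by fun_prop
  generalize hΦ : (fun z : E × E × E => christoffel G z.1 z.2.1 z.2.2) = Φ at h1
  have h3 : ContDiffAt ℝ m (fun z : E × E => Φ (z.1, z.2, z.2)) (y, u) :=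
    ContDiffAt.comp (y, u) h1 h2
  rw [← hΦ] at h3
  exact h3

/-! ### Geodesics on the manifold, their uniqueness, and the exponential map -/

section Geodesics

universe u

variable {E : Type u} [NormedAddCommGroup E] [NormedSpace ℝ E] [FiniteDimensional ℝ E]
  {M : Type*} [TopologicalSpace M] [ChartedSpace E M] [IsManifold 𝓘(ℝ, E) 1 M] {m : ℕ∞ω}
  {g : ContMDiffRiemannianMetric 𝓘(ℝ, E) m E (TangentSpace 𝓘(ℝ, E) : M → Type _)}

omit [FiniteDimensional ℝ E] in
theorem IsGeodesicOn.mono {γ : ℝ → M} {s t : Set ℝ} (h : IsGeodesicOn g γ s) (hts : t ⊆ s) :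
    IsGeodesicOn g γ t :=
  ⟨h.1.mono hts, fun q τ hτ => h.2 q τ (hts hτ)⟩

/-- The geodesic equation does not depend on the chart. -/
theorem isGeodesicOn_of_chart [IsManifold 𝓘(ℝ, E) ∞ M]
    (hG : ∀ q, IsMetricOn ∞ (metricInChart g q) (extChartAt 𝓘(ℝ, E) q).target) (p : M)
    {c c' : ℝ → E} {s : Set ℝ} (hs : IsOpen s)
    (hmem : ∀ t ∈ s, c t ∈ (extChartAt 𝓘(ℝ, E) p).target) (hc : ∀ t ∈ s, HasDerivAt c (c' t) t)
    (hc' : ∀ t ∈ s, HasDerivAt c' (-christoffel (metricInChart g p) (c t) (c' t) (c' t)) t) :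
    IsGeodesicOn g (fun t => (extChartAt 𝓘(ℝ, E) p).symm (c t)) s := by
  refine ⟨(continuousOn_extChartAt_symm p).comp
    (fun t ht => (hc t ht).continuousAt.continuousWithinAt) hmem, fun q t ht hq => ?_⟩
  have hD := isOpen_chartChangeDomain (E := E) p q
  have hτ := contDiffOn_chartChange (E := E) (m := ∞) p q
  have htD : c t ∈ chartChangeDomain (E := E) p q := ⟨hmem t ht, hq⟩
  have hev : ∀ᶠ r in 𝓝 t, r ∈ s ∧ c r ∈ chartChangeDomain (E := E) p q :=
    Filter.Eventually.and (hs.mem_nhds ht)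
      ((hc t ht).continuousAt.preimage_mem_nhds (hD.mem_nhds htD))
  have h2 {r : ℝ} (hr : c r ∈ chartChangeDomain (E := E) p q) :
      ContDiffAt ℝ 2 (chartChange p q) (c r) :=
    (hτ.contDiffAt (hD.mem_nhds hr)).of_le (WithTop.coe_le_coe.2 le_top : (2 : ℕ∞ω) ≤ ∞)
  have h1 {r : ℝ} (hr : r ∈ s ∧ c r ∈ chartChangeDomain (E := E) p q) :
      HasDerivAt (fun τ => chartChange p q (c τ)) (fderiv ℝ (chartChange p q) (c r) (c' r)) r :=
    ((h2 hr.2).differentiableAt (by simp)).hasFDerivAt.comp_hasDerivAt r (hc r hr.1)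
  change DifferentiableAt ℝ (fun τ => chartChange p q (c τ)) t ∧
    HasDerivAt (deriv fun τ => chartChange p q (c τ))
      (-christoffel (metricInChart g q) (chartChange p q (c t))
        (deriv (fun τ => chartChange p q (c τ)) t) (deriv (fun τ => chartChange p q (c τ)) t)) t
  have h1t := h1 ⟨ht, htD⟩
  refine ⟨h1t.differentiableAt, ?_⟩
  have hd := hasDerivAt_fderiv_apply (h2 htD) (hc t ht) (hc' t ht)
  -- The second derivative of the coordinate change cancels against the inhomogeneous term of the
  -- transformation law.
  rw [map_neg, (hG p).fderiv_christoffel_eq (hG q) hD inter_subset_left hτ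
    (fun z hz => (extChartAt 𝓘(ℝ, E) q).map_source hz.2)
    (fun z hz u v => metricInChart_chartChange g p q hz u v) htD] at hd
  rw [h1t.deriv]
  refine (hd.congr_of_eventuallyEq (hev.mono fun r hr => (h1 hr).deriv)).congr_deriv ?_
  abel

/-- Local uniqueness of geodesics. -/
theorem IsGeodesicOn.eventuallyEq
    {q : M} (hG : IsMetricOn ∞ (metricInChart g q) (extChartAt 𝓘(ℝ, E) q).target)
    {γ₁ γ₂ : ℝ → M} {s : Set ℝ} (hs : IsOpen s) (h₁ : IsGeodesicOn g γ₁ s)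
    (h₂ : IsGeodesicOn g γ₂ s) {t : ℝ} (ht : t ∈ s)
    (hq : γ₁ t ∈ (extChartAt 𝓘(ℝ, E) q).source) (heq : γ₁ t = γ₂ t)
    (hderiv : deriv (fun τ => extChartAt 𝓘(ℝ, E) q (γ₁ τ)) t
      = deriv (fun τ => extChartAt 𝓘(ℝ, E) q (γ₂ τ)) t) : γ₁ =ᶠ[𝓝 t] γ₂ := by
  let Γ : E → E → E → E := christoffel (metricInChart g q)
  -- The geodesic equation as a first order autonomous system for position and velocity, with a
  -- `C^1` and hence locally Lipschitz right-hand side.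
  let V : E × E → E × E := fun z => (z.2, -Γ z.1 z.2 z.2)
  let z : (ℝ → M) → ℝ → E × E := fun γ τ => (extChartAt 𝓘(ℝ, E) q (γ τ),
    deriv (fun r => extChartAt 𝓘(ℝ, E) q (γ r)) τ)
  have hsrc := (isOpen_extChartAt_source (I := 𝓘(ℝ, E)) q)
  have hev {γ : ℝ → M} (hγ : IsGeodesicOn g γ s) (hγt : γ t ∈ (extChartAt 𝓘(ℝ, E) q).source) :
      ∀ᶠ τ in 𝓝 t, γ τ ∈ (extChartAt 𝓘(ℝ, E) q).source ∧ HasDerivAt (z γ) (V (z γ τ)) τ := by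
    have hc : ContinuousAt γ t := hγ.1.continuousAt (hs.mem_nhds ht)
    filter_upwards [hs.mem_nhds ht, hc.preimage_mem_nhds (hsrc.mem_nhds hγt)] with τ h1 h2
    obtain ⟨h3, h4⟩ := hγ.2 q τ h1 h2
    exact ⟨h2, h3.hasDerivAt.prodMk h4⟩
  have hz : z γ₁ t = z γ₂ t := Prod.ext (congrArg (extChartAt 𝓘(ℝ, E) q) heq) hderiv
  have hV : ContDiffAt ℝ 1 V (z γ₁ t) := by
    have h3 : ContDiffAt ℝ ∞ (fun z : E × E => Γ z.1 z.2 z.2) (z γ₁ t) :=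
      hG.contDiffAt_christoffel_diag le_rfl ((extChartAt 𝓘(ℝ, E) q).map_source hq) (z γ₁ t).2
    exact (contDiffAt_snd.prodMk h3.neg).of_le (WithTop.coe_le_coe.2 le_top)
  obtain ⟨K, S, hS, hK⟩ := hV.exists_lipschitzOnWith
  have e1 := hev h₁ hq
  have e2 := hev h₂ (heq ▸ hq)
  have hS1 := e1.self_of_nhds.2.continuousAt.preimage_mem_nhds hS
  have hS2 := e2.self_of_nhds.2.continuousAt.preimage_mem_nhds (hz ▸ hS)
  have key : z γ₁ =ᶠ[𝓝 t] z γ₂ :=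
    ODE_solution_unique_of_eventually (v := fun _ => V) (s := fun _ => S) (K := K)
      (Eventually.of_forall fun _ => hK)
      ((e1.and hS1).mono fun τ h => ⟨h.1.2, h.2⟩) ((e2.and hS2).mono fun τ h => ⟨h.1.2, h.2⟩) hz
  filter_upwards [key, e1, e2] with τ h h1 h2
  exact (extChartAt 𝓘(ℝ, E) q).injOn h1.1 h2.1 (congrArg Prod.fst h)

/-- Uniqueness of geodesics on a connected open set of times. -/
theorem IsGeodesicOn.eqOn [T2Space M]
    (hG : ∀ q, IsMetricOn ∞ (metricInChart g q) (extChartAt 𝓘(ℝ, E) q).target)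
    {γ₁ γ₂ : ℝ → M} {s : Set ℝ} (hs : IsOpen s) (hconn : IsPreconnected s)
    (h₁ : IsGeodesicOn g γ₁ s) (h₂ : IsGeodesicOn g γ₂ s) {t₀ : ℝ} (ht₀ : t₀ ∈ s) {q : M}
    (hq : γ₁ t₀ ∈ (extChartAt 𝓘(ℝ, E) q).source) (heq : γ₁ t₀ = γ₂ t₀)
    (hderiv : deriv (fun τ => extChartAt 𝓘(ℝ, E) q (γ₁ τ)) t₀
      = deriv (fun τ => extChartAt 𝓘(ℝ, E) q (γ₂ τ)) t₀) : EqOn γ₁ γ₂ s := by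
  -- The times near which the two curves agree. This set is open by definition; it remains to see
  -- that it is closed relative to `s`.
  let u : Set ℝ := {t | γ₁ =ᶠ[𝓝 t] γ₂}
  have hsub : s ⊆ u := by
    refine hconn.subset_of_closure_inter_subset isOpen_setOfPred_eventually_nhds
      ⟨t₀, ht₀, h₁.eventuallyEq (hG q) hs h₂ ht₀ hq heq hderiv⟩ ?_
    rintro t ⟨htu, hts⟩
    -- At a limit time the positions agree because `M` is Hausdorff, and the velocities because
    -- coordinate velocities of geodesics are continuous; local uniqueness then applies again.
    have hfreq : ∃ᶠ τ in 𝓝 t, γ₁ =ᶠ[𝓝 τ] γ₂ := mem_closure_iff_frequently.1 htu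
    have hct := tendsto_nhds_unique_of_frequently_eq (h₁.1.continuousAt (hs.mem_nhds hts))
      (h₂.1.continuousAt (hs.mem_nhds hts)) (hfreq.mono fun τ h => h.eq_of_nhds)
    have hsrc := mem_extChartAt_source (I := 𝓘(ℝ, E)) (γ₁ t)
    refine h₁.eventuallyEq (hG (γ₁ t)) hs h₂ hts hsrc hct ?_
    refine tendsto_nhds_unique_of_frequently_eq (h₁.2 (γ₁ t) t hts hsrc).2.continuousAt
      (h₂.2 (γ₁ t) t hts (hct ▸ hsrc)).2.continuousAt (hfreq.mono fun τ h => ?_)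
    exact (h.fun_comp (extChartAt 𝓘(ℝ, E) (γ₁ t))).deriv_eq
  exact fun t ht => (hsub ht).eq_of_nhds

theorem IsGeodesicFrom.apply_one_eq [T2Space M]
    (hG : ∀ q, IsMetricOn ∞ (metricInChart g q) (extChartAt 𝓘(ℝ, E) q).target) {p : M}
    {v : TangentSpace 𝓘(ℝ, E) p} {γ₁ γ₂ : ℝ → M} (h₁ : IsGeodesicFrom g p v γ₁)
    (h₂ : IsGeodesicFrom g p v γ₂) : γ₁ 1 = γ₂ 1 := by
  obtain ⟨⟨ε₁, hε₁, hg₁⟩, hp₁, hd₁⟩ := h₁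
  obtain ⟨⟨ε₂, hε₂, hg₂⟩, hp₂, hd₂⟩ := h₂
  have hε : 0 < min ε₁ ε₂ := lt_min hε₁ hε₂
  have hs₁ : Ioo (-min ε₁ ε₂) (1 + min ε₁ ε₂) ⊆ Ioo (-ε₁) (1 + ε₁) :=
    Ioo_subset_Ioo (neg_le_neg (min_le_left _ _)) (by gcongr; exact min_le_left _ _)
  have hs₂ : Ioo (-min ε₁ ε₂) (1 + min ε₁ ε₂) ⊆ Ioo (-ε₂) (1 + ε₂) :=
    Ioo_subset_Ioo (neg_le_neg (min_le_right _ _)) (by gcongr; exact min_le_right _ _)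
  have hsrc : γ₁ 0 ∈ (extChartAt 𝓘(ℝ, E) p).source := by
    rw [hp₁]; exact mem_extChartAt_source p
  have hderiv : deriv (fun τ => extChartAt 𝓘(ℝ, E) p (γ₁ τ)) 0
      = deriv (fun τ => extChartAt 𝓘(ℝ, E) p (γ₂ τ)) 0 := by rw [hd₁.deriv, hd₂.deriv]
  have h0 : (0 : ℝ) ∈ Ioo (-min ε₁ ε₂) (1 + min ε₁ ε₂) := ⟨by linarith, by linarith⟩
  have h1 : (1 : ℝ) ∈ Ioo (-min ε₁ ε₂) (1 + min ε₁ ε₂) := ⟨by linarith, by linarith⟩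
  exact (hg₁.mono hs₁).eqOn hG isOpen_Ioo isPreconnected_Ioo (hg₂.mono hs₂) h0 hsrc
    (hp₁.trans hp₂.symm) hderiv h1

/-- By uniqueness the geodesic chosen in the definition of `expMap` is irrelevant. -/
theorem IsGeodesicFrom.expMap_eq [T2Space M]
    (hG : ∀ q, IsMetricOn ∞ (metricInChart g q) (extChartAt 𝓘(ℝ, E) q).target) {p : M}
    {v : TangentSpace 𝓘(ℝ, E) p} {γ : ℝ → M} (h : IsGeodesicFrom g p v γ) :
    expMap g p v = γ 1 := by
  have hex : ∃ γ, IsGeodesicFrom g p v γ := ⟨γ, h⟩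
  rw [expMap, dif_pos hex]
  exact hex.choose_spec.apply_one_eq hG h

/-- Half the radius is taken so that `t • v` remains in the ball for `t ∈ (-1, 2)`, an open interval
containing `[0, 1]`. -/
theorem IsExponentialOn.isGeodesicFrom [IsManifold 𝓘(ℝ, E) ∞ M]
    (hG : ∀ q, IsMetricOn ∞ (metricInChart g q) (extChartAt 𝓘(ℝ, E) q).target) {p : M}
    {f : E → E} {ρ : ℝ}
    (hf : IsExponentialOn (metricInChart g p) (extChartAt 𝓘(ℝ, E) p).target f ρ)
    (hf0 : f 0 = extChartAt 𝓘(ℝ, E) p p) (hf' : HasFDerivAt f (ContinuousLinearMap.id ℝ E) 0)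
    {v : E} (hv : v ∈ Metric.ball (0 : E) (ρ / 2)) :
    IsGeodesicFrom g p v fun t => (extChartAt 𝓘(ℝ, E) p).symm (f (t • v)) := by
  have hv' : ‖v‖ < ρ / 2 := by simpa using hv
  have hρ : 0 < ρ := by linarith [norm_nonneg v]
  have hball : ∀ t ∈ Ioo (-1 : ℝ) (1 + 1), t • v ∈ Metric.ball (0 : E) ρ := by
    intro t ht
    have h2 : |t| ≤ 2 := abs_le.2 ⟨by linarith [ht.1], by linarith [ht.2]⟩
    rw [mem_ball_zero_iff, norm_smul, Real.norm_eq_abs]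
    calc |t| * ‖v‖ ≤ 2 * ‖v‖ := by gcongr
      _ < ρ := by linarith
  have hr (t : ℝ) : HasDerivAt (fun s : ℝ => s • v) v t := by
    simpa using (hasDerivAt_id t).smul_const v
  have hsm {t : ℝ} (ht : t ∈ Ioo (-1 : ℝ) (1 + 1)) : ContDiffAt ℝ 2 f (t • v) :=
    (hf.contDiffAt _ (hball t ht)).of_le (WithTop.coe_le_coe.2 le_top : (2 : ℕ∞ω) ≤ ∞)
  have hd {t : ℝ} (ht : t ∈ Ioo (-1 : ℝ) (1 + 1)) :
      HasDerivAt (fun s : ℝ => f (s • v)) (fderiv ℝ f (t • v) v) t :=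
    ((hsm ht).differentiableAt (by simp)).hasFDerivAt.comp_hasDerivAt t (hr t)
  have h0 : (0 : ℝ) ∈ Ioo (-1 : ℝ) (1 + 1) := by norm_num
  refine ⟨⟨1, one_pos, isGeodesicOn_of_chart hG p isOpen_Ioo
    (fun t ht => hf.mapsTo _ (hball t ht)) (fun t ht => hd ht) fun t ht => ?_⟩, ?_, ?_⟩
  · have h := hasDerivAt_fderiv_apply (hsm ht) (hr t) (hasDerivAt_const t v)
    rw [map_zero, add_zero] at h
    rwa [← eq_neg_of_add_eq_zero_left (hf.geodesic v t (hball t ht))]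
  · simp only [zero_smul, hf0, extChartAt_to_inv]
  · have h := hd h0
    rw [zero_smul, hf'.fderiv] at h
    refine HasDerivAt.congr_deriv ?_ (toCoord_eq p v).symm
    refine HasDerivAt.congr_of_eventuallyEq h ?_
    filter_upwards [isOpen_Ioo.mem_nhds h0] with t ht
    exact (extChartAt 𝓘(ℝ, E) p).right_inv (hf.mapsTo _ (hball t ht))

/-- The exponential map in the chart at `p`. -/
theorem exists_expMap_chart [T2Space M] (hm : m = ∞ ∨ m = ω) [IsManifold 𝓘(ℝ, E) m M]
    (g : ContMDiffRiemannianMetric 𝓘(ℝ, E) m E (TangentSpace 𝓘(ℝ, E) : M → Type _)) (p : M) :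
    ∃ ρ > 0, ∃ f : E → E, f 0 = extChartAt 𝓘(ℝ, E) p p ∧
      HasFDerivAt f (ContinuousLinearMap.id ℝ E) 0 ∧
      (∀ v ∈ Metric.ball (0 : E) ρ, ContDiffAt ℝ m f v) ∧
      IsExponentialOn (metricInChart g p) (extChartAt 𝓘(ℝ, E) p).target f ρ ∧
      ∀ v : E, v ∈ Metric.ball (0 : E) ρ → v ∈ expDomain g p ∧
        expMap g p v = (extChartAt 𝓘(ℝ, E) p).symm (f v) := by
  have hm' : m + 1 ≤ m := by rcases hm with rfl | rfl <;> exact le_rfl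
  have hm1 : ∞ ≤ m := by rcases hm with rfl | rfl; exacts [le_rfl, le_top]
  have : IsManifold 𝓘(ℝ, E) (m + 1) M := .of_le (n := m) hm'
  have : IsManifold 𝓘(ℝ, E) ∞ M := .of_le (n := m) hm1
  have hGm (q : M) := isMetricOn_metricInChart g q
  have hG (q : M) := (hGm q).of_le hm1
  have hp := mem_extChartAt_target (I := 𝓘(ℝ, E)) p
  have hS : ∀ᶠ z in 𝓝 (extChartAt 𝓘(ℝ, E) p p, (0 : E)), ContDiffAt ℝ m
      (fun z : E × E => christoffel (metricInChart g p) z.1 z.2 z.2) z := by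
    have hU : ∀ᶠ z in 𝓝 (extChartAt 𝓘(ℝ, E) p p, (0 : E)), z.1 ∈ (extChartAt 𝓘(ℝ, E) p).target :=
      continuousAt_fst.preimage_mem_nhds ((hGm p).isOpen.mem_nhds hp)
    filter_upwards [hU] with z hz
    exact (hGm p).contDiffAt_christoffel_diag hm' hz z.2
  -- The Christoffel term is quadratic in the velocity, as the spray construction requires.
  obtain ⟨r, hr, f, hf0, hf', hfs, hfg⟩ := exists_exponential_of_spray hm
    (S := fun y u => christoffel (metricInChart g p) y u u) hS
    (fun t y u => by rw [christoffel_smul_left, christoffel_smul_right, smul_smul, sq])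
  have hcont : ∀ᶠ v in 𝓝 (0 : E), f v ∈ (extChartAt 𝓘(ℝ, E) p).target :=
    hf'.continuousAt.preimage_mem_nhds ((hGm p).isOpen.mem_nhds (hf0 ▸ hp))
  obtain ⟨r', hr', hball⟩ := Metric.eventually_nhds_iff_ball.1 hcont
  have hexp : IsExponentialOn (metricInChart g p) (extChartAt 𝓘(ℝ, E) p).target f (min r r') :=
    ⟨fun v hv => hball v (Metric.ball_subset_ball (min_le_right _ _) hv),
      fun v hv => (hfs v (Metric.ball_subset_ball (min_le_left _ _) hv)).of_le hm1,
      fun v t hv => hfg v t (Metric.ball_subset_ball (min_le_left _ _) hv)⟩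
  have hpos : 0 < min r r' := lt_min hr hr'
  have hhalf : min r r' / 2 ≤ min r r' := half_le_self hpos.le
  -- One radius keeps `f` regular and inside the chart; halving it lets the geodesics run past time
  -- `1`.
  refine ⟨min r r' / 2, half_pos hpos, f, hf0, hf',
    fun v hv => hfs v (Metric.ball_subset_ball (hhalf.trans (min_le_left _ _)) hv),
    ⟨fun v hv => hexp.mapsTo v (Metric.ball_subset_ball hhalf hv),
      fun v hv => hexp.contDiffAt v (Metric.ball_subset_ball hhalf hv),
      fun v t hv => hexp.geodesic v t (Metric.ball_subset_ball hhalf hv)⟩, fun v hv => ?_⟩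
  have h := hexp.isGeodesicFrom hG hf0 hf' hv
  refine ⟨⟨_, h⟩, ?_⟩
  rw [h.expMap_eq hG, one_smul]

end Geodesics

/-! ### Expansion of the curvature terms in a frame -/

section Multilinearity

variable {E F : Type*} [NormedAddCommGroup E] [NormedSpace ℝ E] [NormedAddCommGroup F]
  [NormedSpace ℝ F]

theorem map_sum_smul_of_add_smul {T : E → F} (h : ∀ a b (s : ℝ), T (a + s • b) = T a + s • T b)
    {ι : Type*} (s : Finset ι) (x : ι → ℝ) (e : ι → E) :
    T (∑ i ∈ s, x i • e i) = ∑ i ∈ s, x i • T (e i) := by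
  have h0 : T 0 = 0 := by simpa using h 0 0 1
  let L : E →ₗ[ℝ] F :=
    { toFun := T
      map_add' := fun a b => by simpa using h a b 1
      map_smul' := fun c a => by simpa [h0] using h 0 a c }
  change L _ = ∑ i ∈ s, x i • L (e i)
  simp only [map_sum, map_smul]

variable [FiniteDimensional ℝ E] {G : E → E →L[ℝ] E →L[ℝ] ℝ} {U : Set E}

namespace IsMetricOn

theorem differentiableAt_curvatureCoord (hG : IsMetricOn ∞ G U) {y : E} (hy : y ∈ U) (u v w : E) :
    DifferentiableAt ℝ (fun z => curvatureCoord G z u v w) y := by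
  have h1 := (hG.contDiffAt_curvatureCoord hy u v w).differentiableAt (by simp)
  have h2 : DifferentiableAt ℝ (fun z : E => (z, u, v, w)) y := by fun_prop
  generalize hΦ : (fun z : E × E × E × E => curvatureCoord G z.1 z.2.1 z.2.2.1 z.2.2.2) = Φ at h1
  have h3 : DifferentiableAt ℝ (fun z : E => Φ (z, u, v, w)) y := DifferentiableAt.comp y h1 h2
  rw [← hΦ] at h3
  exact h3

/-- Carries linearity of the curvature, valid on the open set `U`, over to its derivative at a
point. -/
theorem fderiv_curvatureCoord_eq (hG : IsMetricOn ∞ G U) {y : E} (hy : y ∈ U)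
    {u v w u₁ v₁ w₁ u₂ v₂ w₂ : E} {s : ℝ}
    (h : ∀ z ∈ U, curvatureCoord G z u v w
      = curvatureCoord G z u₁ v₁ w₁ + s • curvatureCoord G z u₂ v₂ w₂) (x : E) :
    fderiv ℝ (fun z => curvatureCoord G z u v w) y x
      = fderiv ℝ (fun z => curvatureCoord G z u₁ v₁ w₁) y x
        + s • fderiv ℝ (fun z => curvatureCoord G z u₂ v₂ w₂) y x := by
  have hev : (fun z => curvatureCoord G z u v w) =ᶠ[𝓝 y] fun z =>
      curvatureCoord G z u₁ v₁ w₁ + s • curvatureCoord G z u₂ v₂ w₂ :=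
    eventually_of_mem (hG.isOpen.mem_nhds hy) h
  have hd := (hG.differentiableAt_curvatureCoord hy u₁ v₁ w₁).hasFDerivAt.add
    ((hG.differentiableAt_curvatureCoord hy u₂ v₂ w₂).hasFDerivAt.const_smul s)
  exact congrArg (fun A => A x) (hd.congr_of_eventuallyEq hev).fderiv

/-- Linearity of `∇R` is needed only in the first, second and fourth slots, which receive the radial
vector; the third holds a fixed frame vector. -/
theorem covDerivCurvatureCoord_smul_add₁ (hG : IsMetricOn ∞ G U) {y : E} (hy : y ∈ U)
    (a b u v w : E) (s : ℝ) : covDerivCurvatureCoord G y (a + s • b) u v w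
      = covDerivCurvatureCoord G y a u v w + s • covDerivCurvatureCoord G y b u v w := by
  simp only [covDerivCurvatureCoord, map_add, map_smul, christoffel_add_smul_left,
    hG.curvatureCoord_smul_add₁ hy, hG.curvatureCoord_smul_add₂ hy, hG.curvatureCoord_smul_add₃ hy]
  module

theorem covDerivCurvatureCoord_smul_add₂ (hG : IsMetricOn ∞ G U) {y : E} (hy : y ∈ U)
    (a b u v w : E) (s : ℝ) : covDerivCurvatureCoord G y u (a + s • b) v w
      = covDerivCurvatureCoord G y u a v w + s • covDerivCurvatureCoord G y u b v w := by
  rw [covDerivCurvatureCoord, hG.fderiv_curvatureCoord_eq hy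
    (fun z hz => hG.curvatureCoord_smul_add₁ hz a b v w s)]
  simp only [covDerivCurvatureCoord, christoffel_add_smul_right,
    hG.curvatureCoord_smul_add₁ hy]
  module

theorem covDerivCurvatureCoord_smul_add₄ (hG : IsMetricOn ∞ G U) {y : E} (hy : y ∈ U)
    (a b u v w : E) (s : ℝ) : covDerivCurvatureCoord G y u v w (a + s • b)
      = covDerivCurvatureCoord G y u v w a + s • covDerivCurvatureCoord G y u v w b := by
  rw [covDerivCurvatureCoord, hG.fderiv_curvatureCoord_eq hy
    (fun z hz => hG.curvatureCoord_smul_add₃ hz a b v w s)]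
  simp only [covDerivCurvatureCoord, christoffel_add_smul_right,
    hG.curvatureCoord_smul_add₃ hy]
  module

variable {ι : Type*} [Fintype ι]

theorem apply_curvatureCoord_sum (hG : IsMetricOn ∞ G U) {y : E} (hy : y ∈ U) (x : ι → ℝ)
    (e : ι → E) (a b : E) :
    G y (curvatureCoord G y (∑ k, x k • e k) a (∑ l, x l • e l)) b
      = ∑ k, ∑ l, G y (curvatureCoord G y (e k) a (e l)) b * x k * x l := by
  rw [map_sum_smul_of_add_smul (T := fun u => G y (curvatureCoord G y u a (∑ l, x l • e l)) b)
    (fun u v s => by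
      rw [hG.curvatureCoord_smul_add₁ hy, (G y).map_add, (G y).map_smul, add_apply, smul_apply])]
  refine Finset.sum_congr rfl fun k _ => ?_
  rw [map_sum_smul_of_add_smul (T := fun u => G y (curvatureCoord G y (e k) a u) b)
    (fun u v s => by
      rw [hG.curvatureCoord_smul_add₃ hy, (G y).map_add, (G y).map_smul, add_apply, smul_apply]),
    Finset.smul_sum]
  refine Finset.sum_congr rfl fun l _ => ?_
  simp only [smul_eq_mul]
  ring

theorem apply_covDerivCurvatureCoord_sum (hG : IsMetricOn ∞ G U) {y : E} (hy : y ∈ U) (x : ι → ℝ)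
    (e : ι → E) (a b : E) :
    G y (covDerivCurvatureCoord G y (∑ k, x k • e k) (∑ l, x l • e l) a (∑ n, x n • e n)) b
      = ∑ k, ∑ l, ∑ n,
        G y (covDerivCurvatureCoord G y (e k) (e l) a (e n)) b * x k * x l * x n := by
  rw [map_sum_smul_of_add_smul
    (T := fun u => G y (covDerivCurvatureCoord G y u (∑ l, x l • e l) a (∑ n, x n • e n)) b)
    (fun u v s => by
      rw [hG.covDerivCurvatureCoord_smul_add₁ hy, (G y).map_add, (G y).map_smul, add_apply,
        smul_apply])]
  refine Finset.sum_congr rfl fun k _ => ?_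
  rw [map_sum_smul_of_add_smul
    (T := fun u => G y (covDerivCurvatureCoord G y (e k) u a (∑ n, x n • e n)) b)
    (fun u v s => by
      rw [hG.covDerivCurvatureCoord_smul_add₂ hy, (G y).map_add, (G y).map_smul, add_apply,
        smul_apply]), Finset.smul_sum]
  refine Finset.sum_congr rfl fun l _ => ?_
  rw [map_sum_smul_of_add_smul
    (T := fun u => G y (covDerivCurvatureCoord G y (e k) (e l) a u) b)
    (fun u v s => by
      rw [hG.covDerivCurvatureCoord_smul_add₄ hy, (G y).map_add, (G y).map_smul, add_apply,
        smul_apply]), Finset.smul_sum, Finset.smul_sum]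
  refine Finset.sum_congr rfl fun n _ => ?_
  simp only [smul_eq_mul]
  ring

end IsMetricOn

end Multilinearity

/-! ### Third order expansion of the pulled back metric -/

section Expansion

variable {E X : Type*} [NormedAddCommGroup E] [NormedSpace ℝ E] [FiniteDimensional ℝ E]
  [NormedAddCommGroup X] [NormedSpace ℝ X]
  {G : E → E →L[ℝ] E →L[ℝ] ℝ} {U : Set E} {f : E → E} {ρ R : ℝ} {m : ℕ∞ω}

omit [FiniteDimensional ℝ E] in
set_option synthInstance.maxHeartbeats 400000 in
-- Stated for the class `m`, so that it gives both smoothness at `0` for the vanishing order and the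
-- final regularity of the remainder.
theorem contDiffAt_pullback (hG : IsMetricOn m G U) (hm : m + 1 ≤ m) {v : E} (hv : f v ∈ U)
    (hf : ContDiffAt ℝ m f v) (a b : E) :
    ContDiffAt ℝ m (fun v => G (f v) (fderiv ℝ f v a) (fderiv ℝ f v b)) v := by
  have hd (a : E) : ContDiffAt ℝ m (fun v => fderiv ℝ f v a) v :=
    (hf.fderiv_right (m := m) hm).clm_apply contDiffAt_const
  exact ((ContDiffAt.comp (g := G) v (hG.contDiffAt hv) hf).clm_apply (hd a)).clm_apply (hd b)

/-- Expansion to third order of the metric pulled back by the exponential map. -/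
theorem IsExponentialOn.vanishesToOrder_remainder (hG : IsMetricOn ∞ G U)
    (hf : IsExponentialOn G U f ρ) (hρ : 0 < ρ) (hf' : HasFDerivAt f (ContinuousLinearMap.id ℝ E) 0)
    (A : X →L[ℝ] E) (a b : E) {P : X → ℝ} (hP : ContDiffAt ℝ ∞ P 0)
    (hPA : ∀ x, P x = G (f 0) a b
      + 1 / 3 * G (f 0) (curvatureCoord G (f 0) (A x) a (A x)) b
      + 1 / 6 * G (f 0) (covDerivCurvatureCoord G (f 0) (A x) (A x) a (A x)) b) :
    VanishesToOrder 4 fun x =>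
      G (f (A x)) (fderiv ℝ f (A x) a) (fderiv ℝ f (A x) b) - P x := by
  have hmem : (0 : E) ∈ Metric.ball (0 : E) ρ := by simpa using hρ
  have hU : f 0 ∈ U := hf.mapsTo 0 hmem
  have hA0 : A 0 = 0 := map_zero A
  have hψ : ContDiffAt ℝ ∞ (fun v => G (f v) (fderiv ℝ f v a) (fderiv ℝ f v b)) (A 0) := by
    rw [hA0]
    exact contDiffAt_pullback hG le_rfl hU (hf.contDiffAt 0 hmem) a b
  have hψA : ContDiffAt ℝ ∞ (fun x => G (f (A x)) (fderiv ℝ f (A x) a) (fderiv ℝ f (A x) b)) 0 :=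
    ContDiffAt.comp (g := fun v => G (f v) (fderiv ℝ f v a) (fderiv ℝ f v b)) 0 hψ
      A.contDiff.contDiffAt
  have h₁ (c b u v : E) (s : ℝ) : curvatureCoord G (f 0) (s • b) u v
      = s • curvatureCoord G (f 0) b u v := by
    have h0 : curvatureCoord G (f 0) 0 u v = 0 := by
      simpa using hG.curvatureCoord_smul_add₁ hU 0 0 u v 1
    simpa [h0] using hG.curvatureCoord_smul_add₁ hU 0 b u v s
  have h₃ (b u v : E) (s : ℝ) : curvatureCoord G (f 0) u v (s • b)
      = s • curvatureCoord G (f 0) u v b := by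
    have h0 : curvatureCoord G (f 0) u v 0 = 0 := by
      simpa using hG.curvatureCoord_smul_add₃ hU 0 0 u v 1
    simpa [h0] using hG.curvatureCoord_smul_add₃ hU 0 b u v s
  have k₁ (b u v w : E) (s : ℝ) : covDerivCurvatureCoord G (f 0) (s • b) u v w
      = s • covDerivCurvatureCoord G (f 0) b u v w := by
    have h0 : covDerivCurvatureCoord G (f 0) 0 u v w = 0 := by
      simpa using hG.covDerivCurvatureCoord_smul_add₁ hU 0 0 u v w 1
    simpa [h0] using hG.covDerivCurvatureCoord_smul_add₁ hU 0 b u v w s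
  have k₂ (b u v w : E) (s : ℝ) : covDerivCurvatureCoord G (f 0) u (s • b) v w
      = s • covDerivCurvatureCoord G (f 0) u b v w := by
    have h0 : covDerivCurvatureCoord G (f 0) u 0 v w = 0 := by
      simpa using hG.covDerivCurvatureCoord_smul_add₂ hU 0 0 u v w 1
    simpa [h0] using hG.covDerivCurvatureCoord_smul_add₂ hU 0 b u v w s
  have k₄ (b u v w : E) (s : ℝ) : covDerivCurvatureCoord G (f 0) u v w (s • b)
      = s • covDerivCurvatureCoord G (f 0) u v w b := by
    have h0 : covDerivCurvatureCoord G (f 0) u v w 0 = 0 := by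
      simpa using hG.covDerivCurvatureCoord_smul_add₄ hU 0 0 u v w 1
    simpa [h0] using hG.covDerivCurvatureCoord_smul_add₄ hU 0 b u v w s
  -- On a ray `P` is a cubic polynomial in `t`, whose derivatives are compared with those of the
  -- metric.
  have hPt (x : X) (t : ℝ) : P (t • x) = G (f 0) a b
      + t ^ 2 * (1 / 3 * G (f 0) (curvatureCoord G (f 0) (A x) a (A x)) b)
      + t ^ 3 * (1 / 6 * G (f 0) (covDerivCurvatureCoord G (f 0) (A x) (A x) a (A x)) b) := by
    rw [hPA, map_smul, h₁ 0, h₃, k₁, k₂, k₄]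
    simp only [(G (f 0)).map_smul, smul_apply, smul_eq_mul]
    ring
  have hψ0 : G (f (A 0)) (fderiv ℝ f (A 0) a) (fderiv ℝ f (A 0) b) = G (f 0) a b := by
    rw [hA0, hf'.fderiv]; rfl
  refine vanishesToOrder_four_of_radial (hψA.sub hP) ?_ fun x => ?_
  · have h := hPt 0 0
    simp only [zero_smul, ne_eq, OfNat.ofNat_ne_zero, not_false_eq_true, zero_pow, zero_mul,
      add_zero] at h
    rw [hψ0, h, sub_self]
  · obtain ⟨φ₁, φ₂, e1, e2, e3, z1, z2⟩ := hf.radial_expansion hG hρ hf' (A x) a b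
    generalize hQ : G (f 0) (curvatureCoord G (f 0) (A x) a (A x)) b = Q at hPt z2
    generalize hC : G (f 0) (covDerivCurvatureCoord G (f 0) (A x) (A x) a (A x)) b = C at hPt e3
    -- The derivatives of the cubic at `0` are `0`, `2/3 Q` and `C`, exactly those of
    -- `radial_expansion`.
    have p1 (t : ℝ) : HasDerivAt (fun t : ℝ => P (t • x)) (t * (2 / 3 * Q) + t ^ 2 * (1 / 2 * C))
        t := by
      have h := (((hasDerivAt_pow 2 t).mul_const (1 / 3 * Q)).const_add (G (f 0) a b)).add
        ((hasDerivAt_pow 3 t).mul_const (1 / 6 * C))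
      have he : (fun t : ℝ => P (t • x))
          = (fun t => G (f 0) a b + t ^ 2 * (1 / 3 * Q)) + fun t => t ^ 3 * (1 / 6 * C) := by
        funext t
        rw [hPt, hQ, hC]; rfl
      rw [he]
      refine h.congr_deriv ?_
      norm_num
      ring
    have p2 (t : ℝ) : HasDerivAt (fun t : ℝ => t * (2 / 3 * Q) + t ^ 2 * (1 / 2 * C))
        (2 / 3 * Q + t * C) t := by
      refine (((hasDerivAt_id t).mul_const (2 / 3 * Q)).add
        ((hasDerivAt_pow 2 t).mul_const (1 / 2 * C))).congr_deriv ?_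
      norm_num
      ring
    have p3 : HasDerivAt (fun t : ℝ => 2 / 3 * Q + t * C) C 0 := by
      simpa using ((hasDerivAt_id (0 : ℝ)).mul_const C).const_add (2 / 3 * Q)
    refine ⟨fun t => φ₁ t - (t * (2 / 3 * Q) + t ^ 2 * (1 / 2 * C)),
      fun t => φ₂ t - (2 / 3 * Q + t * C), ?_, ?_, ?_, ?_, ?_⟩
    · filter_upwards [e1] with t ht
      simp only [map_smul]
      exact ht.sub (p1 t)
    · filter_upwards [e2] with t ht
      exact ht.sub (p2 t)
    · exact (e3.sub p3).congr_deriv (sub_self C)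
    · simp [z1]
    · simp [z2]

end Expansion

/-! ### The linear isomorphism given by an orthonormal frame -/

section NormalCoordinates

variable {d : ℕ}

/-- The linear map sending the standard basis to the vectors `e i`. -/
def frameMap {E : Type*} [NormedAddCommGroup E] [NormedSpace ℝ E] (e : Fin d → E) :
    EuclideanSpace ℝ (Fin d) →L[ℝ] E :=
  ∑ i, (EuclideanSpace.proj (𝕜 := ℝ) i).smulRight (e i)

theorem frameMap_apply {E : Type*} [NormedAddCommGroup E] [NormedSpace ℝ E] (e : Fin d → E)
    (x : EuclideanSpace ℝ (Fin d)) : frameMap e x = ∑ i, x i • e i := by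
  simp [frameMap]

theorem frameMap_single {E : Type*} [NormedAddCommGroup E] [NormedSpace ℝ E] (e : Fin d → E)
    (i : Fin d) : frameMap e (EuclideanSpace.single i 1) = e i := by
  simp [frameMap_apply]

/-- Orthonormality recovers `x j` by pairing with `e j`, so the map is injective, hence bijective on
a space of dimension `d`. -/
theorem exists_equiv_frameMap {e : Fin d → EuclideanSpace ℝ (Fin d)}
    {B : EuclideanSpace ℝ (Fin d) →L[ℝ] EuclideanSpace ℝ (Fin d) →L[ℝ] ℝ}
    (he : ∀ i j, B (e i) (e j) = if i = j then 1 else 0) :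
    ∃ A : EuclideanSpace ℝ (Fin d) ≃L[ℝ] EuclideanSpace ℝ (Fin d), (A : _ →L[ℝ] _) = frameMap e := by
  have hinj : Function.Injective 
      (frameMap e : EuclideanSpace ℝ (Fin d) →ₗ[ℝ] EuclideanSpace ℝ (Fin d)) := by
    rw [← LinearMap.ker_eq_bot, LinearMap.ker_eq_bot']
    intro x hx
    ext j
    have h1 : B (frameMap e x) (e j) = x j := by
      rw [frameMap_apply, map_sum]
      simp [sum_apply, he]
    rw [show frameMap e x = 0 from hx, B.map_zero, zero_apply] at h1
    exact h1.symm
  refine ⟨(LinearEquiv.ofInjectiveEndo _ hinj).toContinuousLinearEquiv, ?_⟩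
  ext; rfl

end NormalCoordinates

/-! ### Local diffeomorphisms and metric coefficients read in a chart -/

section NormalCoordinates

variable {d : ℕ} {m : ℕ∞ω} {M : Type*} [TopologicalSpace M]
  [ChartedSpace (EuclideanSpace ℝ (Fin d)) M] [IsManifold (𝓡 d) 1 M]

omit [IsManifold (𝓡 d) 1 M] in
/-- A map which in the chart at `p` has an invertible derivative at `0` is a local
diffeomorphism. -/
theorem isLocalDiffeomorphAt_of_chart (hm : 1 ≤ m) [IsManifold (𝓡 d) m M] (p : M)
    {F : EuclideanSpace ℝ (Fin d) → M} {h : EuclideanSpace ℝ (Fin d) → EuclideanSpace ℝ (Fin d)}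
    {A : EuclideanSpace ℝ (Fin d) ≃L[ℝ] EuclideanSpace ℝ (Fin d)} {R : ℝ} (hR : 0 < R)
    (hh : ∀ x ∈ Metric.ball 0 R, ContDiffAt ℝ m h x)
    (hA : HasFDerivAt h (A : EuclideanSpace ℝ (Fin d) →L[ℝ] EuclideanSpace ℝ (Fin d)) 0)
    (hmaps : ∀ x ∈ Metric.ball 0 R, h x ∈ (extChartAt (𝓡 d) p).target)
    (hF : ∀ x ∈ Metric.ball 0 R, F x = (extChartAt (𝓡 d) p).symm (h x)) :
    IsLocalDiffeomorphAt 𝓘(ℝ, EuclideanSpace ℝ (Fin d)) (𝓡 d) m F 0 := by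
  have h0 : (0 : EuclideanSpace ℝ (Fin d)) ∈ Metric.ball 0 R := Metric.mem_ball_self hR
  obtain ⟨e, he0, hef, hes, het⟩ := exists_openPartialHomeomorph_contDiffAt hm
    (eventually_of_mem (Metric.isOpen_ball.mem_nhds h0) hh) hA
  -- The restriction to the ball is needed because `F` is described by `h`, and `h` is known to take
  -- values in the chart, only there.
  let e' := e.restrOpen (Metric.ball 0 R) Metric.isOpen_ball
  have he's : e'.source = e.source ∩ Metric.ball 0 R := e.restrOpen_source _ _
  have he't : e'.target ⊆ e.target := inter_subset_left
  have hsub : e'.target ⊆ (extChartAt (𝓡 d) p).target := by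
    intro y hy
    have h1 := e'.map_target hy
    rw [he's] at h1
    have h2 : h (e'.symm y) = y := by rw [← hef]; exact e'.right_inv hy
    rw [← h2]
    exact hmaps _ h1.2
  let Φ := e'.toPartialEquiv.trans (extChartAt (𝓡 d) p).symm
  have hsource : Φ.source = e'.source := by
    rw [PartialEquiv.trans_source]
    exact inter_eq_left.2 fun x hx => hsub (e'.map_source hx)
  have htarget : Φ.target = (extChartAt (𝓡 d) p).source ∩ extChartAt (𝓡 d) p ⁻¹' e'.target := rfl
  have hcoe : ∀ x ∈ e'.source, F x = Φ x := by
    intro x hx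
    rw [he's] at hx
    rw [hF x hx.2, ← hef]
    rfl
  refine ⟨{ toPartialEquiv := Φ, open_source := ?_, open_target := ?_, contMDiffOn_toFun := ?_,
            contMDiffOn_invFun := ?_ }, ?_, ?_⟩
  · rw [hsource]; exact e'.open_source
  · rw [htarget]
    exact (continuousOn_extChartAt p).isOpen_inter_preimage (isOpen_extChartAt_source p)
      e'.open_target
  · rw [hsource]
    have h1 : ContMDiffOn 𝓘(ℝ, EuclideanSpace ℝ (Fin d)) 𝓘(ℝ, EuclideanSpace ℝ (Fin d)) m e'
        e'.source := by
      refine ContDiffOn.contMDiffOn fun x hx => ContDiffAt.contDiffWithinAt ?_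
      rw [he's] at hx
      have h2 := hh x hx.2
      rw [← hef] at h2
      exact h2
    exact (contMDiffOn_extChartAt_symm (I := 𝓡 d) (n := m) p).comp h1
      fun x hx => hsub (e'.map_source hx)
  · rw [htarget]
    have h1 : ContMDiffOn 𝓘(ℝ, EuclideanSpace ℝ (Fin d)) 𝓘(ℝ, EuclideanSpace ℝ (Fin d)) m e'.symm
        e'.target :=
      ContDiffOn.contMDiffOn fun x hx => (het x (he't hx)).contDiffWithinAt
    refine h1.comp ((contMDiffOn_extChartAt (I := 𝓡 d) (n := m) (x := p)).mono fun x hx => ?_)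
      fun x hx => hx.2
    rw [← extChartAt_source (𝓡 d)]
    exact hx.1
  · change 0 ∈ Φ.source
    rw [hsource, he's]
    exact ⟨he0, h0⟩
  · intro x hx
    exact hcoe x (hsource ▸ hx)

/-- The chain rule for `F`, written near `x` as the inverse chart composed with `h`. -/
theorem metricCoeff_eq_of_chart
    (g : ContMDiffRiemannianMetric (𝓡 d) m (EuclideanSpace ℝ (Fin d))
      (TangentSpace (𝓡 d) : M → Type _)) (p : M)
    {F : EuclideanSpace ℝ (Fin d) → M} {h : EuclideanSpace ℝ (Fin d) → EuclideanSpace ℝ (Fin d)}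
    {x : EuclideanSpace ℝ (Fin d)} (hF : F =ᶠ[𝓝 x] fun x => (extChartAt (𝓡 d) p).symm (h x))
    (hh : DifferentiableAt ℝ h x) (hx : h x ∈ (extChartAt (𝓡 d) p).target) (i j : Fin d) :
    metricCoeff g F i j x = metricInChart g p (h x) (fderiv ℝ h x (EuclideanSpace.single i 1))
      (fderiv ℝ h x (EuclideanSpace.single j 1)) := by
  have h1 := mfderiv_comp x (mdifferentiableAt_extChartAt_symm p hx) hh.mdifferentiableAt
  rw [mfderiv_eq_fderiv] at h1
  have h2 := hF.mfderiv_eq (I := 𝓘(ℝ, EuclideanSpace ℝ (Fin d))) (I' := 𝓡 d)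
  have key (w : EuclideanSpace ℝ (Fin d)) :
      (show EuclideanSpace ℝ (Fin d) from mfderiv 𝓘(ℝ, EuclideanSpace ℝ (Fin d)) (𝓡 d) F x w)
      = mfderiv 𝓘(ℝ, EuclideanSpace ℝ (Fin d)) (𝓡 d) (extChartAt (𝓡 d) p).symm (h x)
        (fderiv ℝ h x w) :=
    (congrArg (fun A : EuclideanSpace ℝ (Fin d) →L[ℝ] EuclideanSpace ℝ (Fin d) => A w) h2).trans
      (congrArg (fun A : EuclideanSpace ℝ (Fin d) →L[ℝ] EuclideanSpace ℝ (Fin d) => A w) h1)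
  rw [metricCoeff, metricInChart_apply]
  exact inner_congr g hF.eq_of_nhds (key _) (key _)

end NormalCoordinates

end RiemannianNormal

end


/-! ### The expansion in geodesic normal coordinates -/

theorem proposition2p1 {d : ℕ} (m : ℕ∞ω) (hm : m = ∞ ∨ m = ω)
    {M : Type*} [TopologicalSpace M] [T2Space M] [ChartedSpace (EuclideanSpace ℝ (Fin d)) M]
    [IsManifold (𝓡 d) 1 M] [IsManifold (𝓡 d) m M]
    (g : ContMDiffRiemannianMetric (𝓡 d) m (EuclideanSpace ℝ (Fin d))
      (TangentSpace (𝓡 d) : M → Type _))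
    (p : M) (e : Fin d → TangentSpace (𝓡 d) p)
    (he : ∀ i j, g.inner p (e i) (e j) = if i = j then 1 else 0) :
    (∃ ρ : ℝ, 0 < ρ ∧ ∀ x ∈ Metric.ball (0 : EuclideanSpace ℝ (Fin d)) ρ,
      ∑ i, x i • e i ∈ RiemannianNormal.expDomain g p) ∧
    RiemannianNormal.normalCoord g p e 0 = p ∧
    IsLocalDiffeomorphAt 𝓘(ℝ, EuclideanSpace ℝ (Fin d)) (𝓡 d) m
      (RiemannianNormal.normalCoord g p e) 0 ∧
    ∀ i j : Fin d, RiemannianNormal.IsBigOrder m 4 fun x : EuclideanSpace ℝ (Fin d) =>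
      RiemannianNormal.metricCoeff g (RiemannianNormal.normalCoord g p e) i j x
        - ((if i = j then 1 else 0)
          + 1 / 3 * ∑ k, ∑ l,
              RiemannianNormal.curvature g p (e k) (e i) (e l) (e j) * x k * x l
          + 1 / 6 * ∑ k, ∑ l, ∑ n,
              RiemannianNormal.covDerivCurvature g p (e k) (e l) (e i) (e n) (e j)
                * x k * x l * x n) := by
  have hm' : m + 1 ≤ m := by rcases hm with rfl | rfl <;> exact le_rfl
  have hm1 : ∞ ≤ m := by rcases hm with rfl | rfl; exacts [le_rfl, le_top]
  have hm2 : 1 ≤ m := le_trans (WithTop.coe_le_coe.2 le_top) hm1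
  have : IsManifold (𝓡 d) (m + 1) M := .of_le (n := m) hm'
  obtain ⟨ρ, hρ, f, hf0, hf', hfs, hf, hexp⟩ := RiemannianNormal.exists_expMap_chart hm g p
  have hGm := RiemannianNormal.isMetricOn_metricInChart g p
  have hG := hGm.of_le hm1
  -- The frame read in the chart at `p`: no conversion is needed, since the coordinate map `toCoord`
  -- at `p` is the identity.
  let E : Fin d → EuclideanSpace ℝ (Fin d) := e
  let G := RiemannianNormal.metricInChart g p
  have hself (u v : EuclideanSpace ℝ (Fin d)) : G (f 0) u v = g.inner p u v := by
    rw [hf0]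
    exact RiemannianNormal.metricInChart_self g p u v
  have hE (i j : Fin d) : G (f 0) (E i) (E j) = if i = j then 1 else 0 := by
    rw [hself]; exact he i j
  obtain ⟨A, hA⟩ := RiemannianNormal.exists_equiv_frameMap hE
  have hAx (x : EuclideanSpace ℝ (Fin d)) : A x = ∑ i, x i • E i := by
    rw [← RiemannianNormal.frameMap_apply, ← hA]; rfl
  have hAs (i : Fin d) : A (EuclideanSpace.single i 1) = E i := by
    rw [← RiemannianNormal.frameMap_single E i, ← hA]; rfl
  have hnear : ∀ᶠ x in 𝓝 (0 : EuclideanSpace ℝ (Fin d)), A x ∈ Metric.ball 0 ρ :=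
    A.continuous.continuousAt.preimage_mem_nhds
      (Metric.isOpen_ball.mem_nhds (by simpa using hρ))
  -- On this ball `A` lands in the domain where the exponential map is `f` in the chart, so normal
  -- coordinates become `f ∘ A`.
  obtain ⟨R, hR, hball⟩ := Metric.eventually_nhds_iff_ball.1 hnear
  have hsum (x : EuclideanSpace ℝ (Fin d)) (hx : x ∈ Metric.ball 0 R) :
      ∑ i, x i • e i ∈ RiemannianNormal.expDomain g p ∧
      RiemannianNormal.normalCoord g p e x = (extChartAt (𝓡 d) p).symm (f (A x)) := by
    have h := hexp (A x) (hball x hx)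
    rw [hAx x] at h ⊢
    exact h
  have hcs (x : EuclideanSpace ℝ (Fin d)) (hx : x ∈ Metric.ball 0 R) :
      ContDiffAt ℝ m (fun x => f (A x)) x :=
    ContDiffAt.comp (g := f) x (hfs _ (hball x hx)) A.contDiff.contDiffAt
  have hR0 : (0 : EuclideanSpace ℝ (Fin d)) ∈ Metric.ball 0 R := Metric.mem_ball_self hR
  refine ⟨⟨R, hR, fun x hx => (hsum x hx).1⟩, ?_, ?_, fun i j => ?_⟩
  · rw [(hsum 0 hR0).2, map_zero, hf0, extChartAt_to_inv]
  · refine RiemannianNormal.isLocalDiffeomorphAt_of_chart hm2 p (A := A) hR hcs ?_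
      (fun x hx => hf.mapsTo _ (hball x hx)) fun x hx => (hsum x hx).2
    have h1 : HasFDerivAt f (ContinuousLinearMap.id ℝ _) (A 0) := by rwa [map_zero]
    exact h1.comp 0 A.hasFDerivAt
  · let ψ : EuclideanSpace ℝ (Fin d) → ℝ := fun v => G (f v) (fderiv ℝ f v (E i)) (fderiv ℝ f v (E j))
    let P : EuclideanSpace ℝ (Fin d) → ℝ := fun x => (if i = j then 1 else 0)
          + 1 / 3 * ∑ k, ∑ l,
              G (f 0) (RiemannianNormal.curvatureCoord G (f 0) (E k) (E i) (E l)) (E j) * x k * x l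
          + 1 / 6 * ∑ k, ∑ l, ∑ n,
              G (f 0) (RiemannianNormal.covDerivCurvatureCoord G (f 0) (E k) (E l) (E i) (E n))
                (E j) * x k * x l * x n
    have hP : ContDiff ℝ m P := by fun_prop
    have hU : f 0 ∈ (extChartAt (𝓡 d) p).target := hf.mapsTo 0 (by simpa using hρ)
    -- The sums over the frame are the curvature terms at the radial vector `A x`, by
    -- multilinearity, and orthonormality gives the constant term.
    have hPA (x : EuclideanSpace ℝ (Fin d)) : P x = G (f 0) (E i) (E j)
        + 1 / 3 * G (f 0) (RiemannianNormal.curvatureCoord G (f 0) (A x) (E i) (A x)) (E j)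
        + 1 / 6 * G (f 0) (RiemannianNormal.covDerivCurvatureCoord G (f 0) (A x) (A x) (E i) (A x))
          (E j) := by
      rw [hE, hAx, hG.apply_curvatureCoord_sum hU, hG.apply_covDerivCurvatureCoord_sum hU]
    have hvan := hf.vanishesToOrder_remainder hG hρ hf'
      (A : EuclideanSpace ℝ (Fin d) →L[ℝ] EuclideanSpace ℝ (Fin d)) (E i) (E j)
      (hP.contDiffAt.of_le hm1) hPA
    -- Equality on the ball suffices: vanishing order depends only on the germ at `0`, and
    -- regularity is required only on a ball.
    have heq : EqOn (fun x => RiemannianNormal.metricCoeff g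
        (RiemannianNormal.normalCoord g p e) i j x
        - ((if i = j then 1 else 0)
          + 1 / 3 * ∑ k, ∑ l,
              RiemannianNormal.curvature g p (e k) (e i) (e l) (e j) * x k * x l
          + 1 / 6 * ∑ k, ∑ l, ∑ n,
              RiemannianNormal.covDerivCurvature g p (e k) (e l) (e i) (e n) (e j)
                * x k * x l * x n)) (fun x => ψ (A x) - P x) (Metric.ball 0 R) := by
      intro x hx
      have h1 : RiemannianNormal.metricCoeff g (RiemannianNormal.normalCoord g p e) i j x
          = ψ (A x) := by
        have hd := ((hfs _ (hball x hx)).differentiableAt (by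
          exact (zero_lt_one.trans_le hm2).ne')).hasFDerivAt.comp x A.hasFDerivAt
        have hd' : fderiv ℝ (fun x => f (A x)) x = _ := hd.fderiv
        rw [RiemannianNormal.metricCoeff_eq_of_chart g p
          (eventually_of_mem (Metric.isOpen_ball.mem_nhds hx) fun z hz => (hsum z hz).2)
          hd.differentiableAt (hf.mapsTo _ (hball x hx)), hd']
        simp only [ContinuousLinearMap.comp_apply, ContinuousLinearEquiv.coe_coe, hAs]
        rfl
      have h2 (u v w z : TangentSpace (𝓡 d) p) : RiemannianNormal.curvature g p u v w z
          = G (f 0) (RiemannianNormal.curvatureCoord G (f 0) u v w) z := by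
        rw [RiemannianNormal.curvature, hf0]
        simp only [RiemannianNormal.toCoord_eq]
        rfl
      have h3 (a u v w z : TangentSpace (𝓡 d) p) : RiemannianNormal.covDerivCurvature g p a u v w z
          = G (f 0) (RiemannianNormal.covDerivCurvatureCoord G (f 0) a u v w) z := by
        rw [RiemannianNormal.covDerivCurvature, hf0]
        simp only [RiemannianNormal.toCoord_eq]
        rfl
      simp only [h1, h2, h3]
      rfl
    refine RiemannianNormal.isBigOrder_of_vanishesToOrder hm1 hR (ContDiffOn.congr ?_ heq)
      (hvan.congr (eventually_of_mem (Metric.isOpen_ball.mem_nhds hR0) heq))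
    intro x hx
    have h1 : ContDiffAt ℝ m ψ (A x) :=
      RiemannianNormal.contDiffAt_pullback hGm hm' (hf.mapsTo _ (hball x hx)) (hfs _ (hball x hx))
        (E i) (E j)
    exact ((ContDiffAt.comp (g := ψ) x h1 A.contDiff.contDiffAt).sub
      hP.contDiffAt).contDiffWithinAt
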